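/- For $\alpha\in\mathbb R$ let $Q_\alpha(x)=2\sqrt2\,\alpha/(e^{\alpha x}+e^{-\alpha x})$, $Q=Q_1$, $Q_\alpha'=\partial_\alpha Q_\alpha$, $Q'=Q_1'$, and let $\langle f\mid g\rangle=\mathrm{Re}\int_{\mathbb R} f\bar g\,dx$. Put $$\mathcal L_\pm w=-\partial_x^2w+w-2Q^2w\pm Q^2\bar w,\qquad \mathcal N_\alpha(v_1,v_2)=Q_\alpha v_1^2+2Q_\alpha v_1v_2+v_1^2v_2,$$ $$\mathcal N_{\alpha,e/o}(v_e,v_o)=\tfrac12\big(\mathcal N_\alpha(v_e+v_o,\overline{v_e-v_o})\pm\mathcal N_\alpha(v_e-v_o,\overline{v_e+v_o})\big)$$ (sign $+$ for $e$, $-$ for $o$). Let $\kappa(\alpha)=1$ for all $\alpha$, or $\kappa(\alpha)=\alpha^2$ for all $\alpha$. The modulated system for $(v_e,v_o,\theta,\alpha)$, with $v_e(t,\cdot)$ even and $v_o(t,\cdot)$ odd, consists of $$i\partial_tv_e+\mathcal L_-v_e=(\kappa(\alpha)+\dot\theta)Q_\alpha+(1+\dot\theta)v_e-i\dot\alpha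 Q_\alpha'+(Q_\alpha^2-Q^2)(2v_e+\overline{v_e})+\mathcal N_{\alpha,e}(v_e,v_o),$$ $$i\partial_tv_o+\mathcal L_+v_o=(1+\dot\theta)v_o+(Q_\alpha^2-Q^2)(2v_o-\overline{v_o})+\mathcal N_{\alpha,o}(v_e,v_o),$$ and the orthogonality conditions $\langle iv\mid Q_\alpha'\rangle=\langle v\mid Q_\alpha\rangle=0$ for $v=v_e+v_o$. A solution on $[-T,T]$ has $v_e,v_o\in C([-T,T];H^1(\mathbb R))$ and $\theta,\alpha\in C^1([-T,T];\mathbb R)$, and the equations hold in the sense of distributions in $x$ for every $t\in[-T,T]$. (For $\kappa(\alpha)=\alpha^2$ the two equations together say that $u=e^{i\theta}(Q_\alpha+v)$ solves $i\partial_tu-\partial_x^2u=u(t,x)^2\,\overline{u(t,-x)}$.) Decompose $$v_e=a_e\,iQ+b_eQ'+\eta_e,\qquad v_o=a_o\,i\partial_xQ+b_o\,xQ+\eta_o,$$ with real $a_e,b_e,a_o,b_o$, with $\eta_e,\eta_o\in H^1$ and with $\langle\eta_e\mid Q\rangle=\langle i\eta_e\mid Q'\rangle=\langle\eta_o\mid\partial_xQ\rangle=\langle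 i\eta_o\mid xQ\rangle=0$. Proposition. For every $K>0$ there are $c,C>0$ and $\varepsilon_0\in(0,1)$ such that the following holds for all $0<\varepsilon\le\varepsilon_0$. Let $\theta(0),\alpha(0)\in\mathbb R$, an even $v_e(0)$ and an odd $v_o(0)$, decomposed as above, be initial data that satisfy the orthogonality conditions and $$|\alpha(0)-1|\le K\varepsilon,\quad |a_e(0)|+|b_e(0)|+|a_o(0)|\le K\varepsilon,\quad |b_o(0)|+\|\eta_e(0)\|_{H^1}+\|\eta_o(0)\|_{H^1}\le K\varepsilon^2.$$ Then for every $0<T\le c\log(1/\varepsilon)$ the modulated system has a unique solution on $[-T,T]$ with these initial data, and it satisfies $$\sup_{|t|\le T}\big(|a_e|+|b_e|+|a_o|+|b_o|+\|\eta_e\|_{H^1}+\|\eta_o\|_{H^1}+|\alpha-1|\big)\le C\varepsilon,$$ $$\sup_{|t|\le T}\big(|\kappa(\alpha)+\dot\theta|+|\dot\alpha|\big)\le C\varepsilon^2.$$ In particular the last bound reads $|1+\dot\theta|+|\dot\alpha|\le C\varepsilon^2$ for $\kappa=1$. -/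

import Mathlib

open MeasureTheory Set Filter Topology
open scoped FourierTransform SchwartzMap ComplexConjugate

namespace NNLS

noncomputable section

/-- The space `L²(ℝ; ℂ)`. -/
abbrev L2 : Type := Lp ℂ 2 (volume : Measure ℝ)

/-! ### The Sobolev space `H¹(ℝ)`, through the Fourier transform -/

/-- The function `ξ ↦ ⟨ξ⟩ f̂(ξ)` with `⟨ξ⟩ = 1 + |ξ|`. -/
def weightedFourier (f : L2) (ξ : ℝ) : ℂ := ((1 + |ξ| : ℝ) : ℂ) * (𝓕 f : L2) ξ

/-- `f ∈ H¹(ℝ)`. -/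
def MemH1 (f : L2) : Prop := MemLp (weightedFourier f) 2 (volume : Measure ℝ)

/-- The `H¹` norm (meaningful for `f` with `MemH1 f`). -/
def normH1 (f : L2) : ℝ := (eLpNorm (weightedFourier f) 2 (volume : Measure ℝ)).toReal

/-- `w ∈ C([-T, T]; H¹)`. -/
def ContinuousInH1 (T : ℝ) (w : ℝ → L2) : Prop :=
  (∀ t ∈ Icc (-T) T, MemH1 (w t)) ∧
    ∀ t ∈ Icc (-T) T, Tendsto (fun s => normH1 (w s - w t)) (𝓝[Icc (-T) T] t) (𝓝 0)

/-- `f` is even (almost everywhere). -/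
def IsEven (f : L2) : Prop := ∀ᵐ x : ℝ, f (-x) = f x

/-- `f` is odd (almost everywhere). -/
def IsOdd (f : L2) : Prop := ∀ᵐ x : ℝ, f (-x) = -f x

/-- The real semi-inner product `⟨f ∣ g⟩ = Re ∫ f conj(g) dx`. -/
def rip (f g : ℝ → ℂ) : ℝ := (∫ x : ℝ, f x * conj (g x)).re

/-! ### The ground states -/

/-- The ground state `Q_α(x) = 2√2 α / (e^{αx} + e^{-αx})`. -/
def groundState (α x : ℝ) : ℝ := 2 * √2 * α / (Real.exp (α * x) + Real.exp (-(α * x)))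

/-- `Q'_α = ∂_α Q_α`, the derivative in the parameter `α`. -/
def groundStateDα (α x : ℝ) : ℝ := deriv (fun β : ℝ => groundState β x) α

/-- `Q = Q_1`. -/
def Q (x : ℝ) : ℝ := groundState 1 x

/-- `Q' = ∂_α Q_α` at `α = 1`. -/
def Q' (x : ℝ) : ℝ := groundStateDα 1 x

/-- `∂_x Q`. -/
def dxQ (x : ℝ) : ℝ := deriv Q x

/-! ### The nonlinearity -/

/-- `𝒩_α(v₁, v₂) = Q_α v₁² + 2 Q_α v₁ v₂ + v₁² v₂` for complex values `v₁, v₂` and `q = Q_α(x)`. -/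
def nonlin (q : ℝ) (v₁ v₂ : ℂ) : ℂ := q * v₁ ^ 2 + 2 * q * v₁ * v₂ + v₁ ^ 2 * v₂

/-- The even part `𝒩_{α,e}(v_e, v_o)`. -/
def nonlinE (q : ℝ) (ve vo : ℂ) : ℂ :=
  (nonlin q (ve + vo) (conj (ve - vo)) + nonlin q (ve - vo) (conj (ve + vo))) / 2

/-- The odd part `𝒩_{α,o}(v_e, v_o)`. -/
def nonlinO (q : ℝ) (ve vo : ℂ) : ℂ :=
  (nonlin q (ve + vo) (conj (ve - vo)) - nonlin q (ve - vo) (conj (ve + vo))) / 2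

/-! ### The modulated system -/

/-- `w` solves `i ∂_t w + 𝓛_σ w = R` on `[-T, T]`, where
`𝓛_σ w = -∂_x² w + w - 2 Q² w + σ Q² conj(w)`, in the sense of distributions in `x`, for every
time `t`: for each Schwartz function `φ`,
`i (d/dt) ∫ w φ + ∫ (-w φ'' + (w - 2 Q² w + σ Q² conj(w)) φ) = ∫ R φ`. -/
def SolvesLinearized (σ T : ℝ) (w : ℝ → L2) (R : ℝ → ℝ → ℂ) : Prop :=
  ∀ φ : 𝓢(ℝ, ℂ), ∀ t ∈ Icc (-T) T, ∃ D : ℂ,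
    HasDerivWithinAt (fun s => ∫ x : ℝ, w s x * φ x) D (Icc (-T) T) t ∧
    Complex.I * D
        + ((∫ x : ℝ, -(w t x * iteratedDeriv 2 φ x))
          + ∫ x : ℝ, (w t x - 2 * (Q x : ℂ) ^ 2 * w t x
              + σ * (Q x : ℂ) ^ 2 * conj (w t x)) * φ x)
      = ∫ x : ℝ, R t x * φ x

/-- The right-hand side of the equation for `v_e`; `dθ`, `dα` are the values of the time
derivatives of `θ`, `α`, and `k` is the number in the coefficient `k + dθ` of `Q_α`. -/
def rhsE (k dθ dα α : ℝ) (ve vo : ℝ → ℂ) (x : ℝ) : ℂ :=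
  ((k + dθ : ℝ) : ℂ) * groundState α x + ((1 + dθ : ℝ) : ℂ) * ve x
    - Complex.I * dα * groundStateDα α x
    + ((groundState α x ^ 2 - Q x ^ 2 : ℝ) : ℂ) * (2 * ve x + conj (ve x))
    + nonlinE (groundState α x) (ve x) (vo x)

/-- The right-hand side of the equation for `v_o`. -/
def rhsO (dθ α : ℝ) (ve vo : ℝ → ℂ) (x : ℝ) : ℂ :=
  ((1 + dθ : ℝ) : ℂ) * vo x
    + ((groundState α x ^ 2 - Q x ^ 2 : ℝ) : ℂ) * (2 * vo x - conj (vo x))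
    + nonlinO (groundState α x) (ve x) (vo x)

/-- The orthogonality conditions `⟨i v ∣ Q'_α⟩ = ⟨v ∣ Q_α⟩ = 0` for `v = v_e + v_o`. -/
def Constraint (α : ℝ) (ve vo : ℝ → ℂ) : Prop :=
  rip (fun x => Complex.I * (ve x + vo x)) (fun x => groundStateDα α x) = 0 ∧
  rip (fun x => ve x + vo x) (fun x => groundState α x) = 0

/-- `(v_e, v_o, θ, α)` is an `H¹` solution on `[-T, T]` of the modulated system in which the
ground state `Q_α` on the right-hand side has the coefficient `κ(α) + θ̇`. -/
structure IsModulatedSolution (κ : ℝ → ℝ) (T : ℝ) (ve vo : ℝ → L2) (θ α : ℝ → ℝ) : Prop where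
  continuous_e : ContinuousInH1 T ve
  continuous_o : ContinuousInH1 T vo
  even : ∀ t ∈ Icc (-T) T, IsEven (ve t)
  odd : ∀ t ∈ Icc (-T) T, IsOdd (vo t)
  contDiff_θ : ContDiffOn ℝ 1 θ (Icc (-T) T)
  contDiff_α : ContDiffOn ℝ 1 α (Icc (-T) T)
  constraint : ∀ t ∈ Icc (-T) T, Constraint (α t) (ve t) (vo t)
  eq_e : SolvesLinearized (-1) T ve (fun t =>
    rhsE (κ (α t)) (derivWithin θ (Icc (-T) T) t) (derivWithin α (Icc (-T) T) t) (α t)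
      (ve t) (vo t))
  eq_o : SolvesLinearized 1 T vo (fun t =>
    rhsO (derivWithin θ (Icc (-T) T) t) (α t) (ve t) (vo t))

/-! ### The root-space decomposition -/

/-- The symplectic decompositions `v_e = a_e i Q + b_e Q' + η_e` and
`v_o = a_o i ∂_x Q + b_o x Q + η_o`, with
`⟨η_e ∣ Q⟩ = ⟨i η_e ∣ Q'⟩ = ⟨η_o ∣ ∂_x Q⟩ = ⟨i η_o ∣ x Q⟩ = 0` and `η_e, η_o ∈ H¹`. -/
structure IsRootDecomposition (ve vo : L2) (ae be ao bo : ℝ) (ηe ηo : L2) : Prop where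
  eq_e : ∀ᵐ x : ℝ, ve x = ae * (Complex.I * Q x) + be * Q' x + ηe x
  eq_o : ∀ᵐ x : ℝ, vo x = ao * (Complex.I * dxQ x) + bo * (x * Q x) + ηo x
  memH1_e : MemH1 ηe
  memH1_o : MemH1 ηo
  orth_e : rip ηe (fun x => Q x) = 0
  orth_e' : rip (fun x => Complex.I * ηe x) (fun x => Q' x) = 0
  orth_o : rip ηo (fun x => dxQ x) = 0
  orth_o' : rip (fun x => Complex.I * ηo x) (fun x => x * Q x) = 0

end

end NNLS

/-! Put v = v_e + v_o and v*(x) = conj v(-x). The two equations of the system are the even and odd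
parts of a single one, i∂_t v - ∂_x² v = p Q_α + (p - κ) v - i a Q'_α + (2 Q_α² v + Q_α² v*) +
O(v²), with p = κ + θ̇ and a = α̇; the terms of 𝓛_± that carry Q² cancel against those on the
right-hand side (`rhsE_ae`, `rhsO_ae`, `solvesLinearized_iff`).

Modulation. Differentiate the two orthogonality conditions along this equation. The soliton equation
Q_α'' = α² Q_α - Q_α³ and its α-derivative cancel the Laplacian against the linear potential terms.
What remains is a 2×2 linear system for (p, a), whose determinant is -m² + O(v) with m = ½∫Q², and
whose sources are quadratic in (α - 1, v) because κ(1) = 1. So p and a are Lipschitz functions of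
(α, v) that vanish to second order, which is the ε² bound. Conversely, the closed equation obtained
by inserting these functions preserves the orthogonality conditions (`orth_of_weakSol`,
`eq_of_orth`).

Well-posedness. An H¹ function is represented by W ∈ L² through v = J W, which is isometric for the
H¹ norm. As H¹ is an algebra, the closed right-hand side is locally Lipschitz without loss of
derivatives. In the interaction picture z = U(-t) W the distributional equation is an ordinary
differential equation in L² × ℝ × ℝ (`weakSol_of_hasDerivWithinAt`, `hasDerivWithinAt_of_weakSol`).
After truncation its field is bounded and globally Lipschitz, so Picard–Lindelöf applies on every
interval.

Bounds. The orthogonality conditions and α(0) - 1 = O(ε) force a_e and b_e to be O(ε²) initially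
(`exists_abs_coeff_le`), so the data are a_o i∂_xQ + O(ε²). The mode i∂_xQ is stationary for the
linearization at (α, v) = (1, 0) (`LamX_modeX`). As long as (v, α - 1) = O(ε), the difference
between v and this mode solves the linearized equation with a forcing O(ε²), and Gronwall bounds it
by a multiple of ε² e^{kT}, hence by ε when T ≤ c log(1/ε) and ε is small. Meanwhile α moves by O(ε²
T). A continuity argument closes the estimate (`exists_apriori`), so the truncation is never active.
Another solution coincides with the constructed one as long as it is small, and a second continuity
argument shows that it stays small (`IsModulatedSolution.eq_of_isTraj`). -/

namespace NNLS
-- Operators on L² and their behaviour under the Fourier transform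
noncomputable section

/-! ### Multiplication operators and the bilinear pairing on `L²` -/

/-- Multiplication by an essentially bounded function. -/
def mulOp (m : ℝ → ℂ) (h : MemLp m ⊤ volume) : L2 →L[ℂ] L2 :=
  (ContinuousLinearMap.mul ℂ ℂ).holderL volume ⊤ 2 2 (h.toLp m)

lemma mulOp_ae (m : ℝ → ℂ) (h : MemLp m ⊤ volume) (f : L2) :
    mulOp m h f =ᵐ[volume] fun x => m x * f x := by
  have h1 := ContinuousLinearMap.coeFn_holder (r := 2) (ContinuousLinearMap.mul ℂ ℂ) (h.toLp m) f
  filter_upwards [h1, h.coeFn_toLp] with x hx hx'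
  simp only [mulOp]
  rw [ContinuousLinearMap.holderL_apply_apply, hx, hx']
  simp

lemma norm_mulOp_le (m : ℝ → ℂ) (h : MemLp m ⊤ volume) (f : L2) (C : ℝ)
    (hC : ∀ᵐ x, ‖m x‖ ≤ C) : ‖mulOp m h f‖ ≤ C * ‖f‖ := by
  apply Lp.norm_le_mul_norm_of_ae_le_mul
  filter_upwards [mulOp_ae m h f, hC] with x hx hc
  rw [hx, norm_mul]
  gcongr

lemma memLp_top_of_forall {m : ℝ → ℂ} (h : AEStronglyMeasurable m volume) (C : ℝ)
    (hC : ∀ x, ‖m x‖ ≤ C) : MemLp m ⊤ volume :=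
  MeasureTheory.memLp_top_of_bound h C (Eventually.of_forall hC)

/-- The bilinear pairing `∫ f g`. -/
def pair : L2 →L[ℂ] L2 →L[ℂ] ℂ := (ContinuousLinearMap.mul ℂ ℂ).lpPairing volume 2 2

lemma pair_eq (f g : L2) : pair f g = ∫ x, f x * g x := by
  simp [pair, ContinuousLinearMap.lpPairing_eq_integral]

lemma pair_comm (f g : L2) : pair f g = pair g f := by
  simp_rw [pair_eq, mul_comm]

lemma integrable_mul (f g : L2) : Integrable (fun x => f x * g x) :=
  (Lp.memLp f).integrable_mul (Lp.memLp g)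

lemma pair_mulOp (m : ℝ → ℂ) (h : MemLp m ⊤ volume) (f g : L2) :
    pair (mulOp m h f) g = pair f (mulOp m h g) := by
  rw [pair_eq, pair_eq]
  apply integral_congr_ae
  filter_upwards [mulOp_ae m h f, mulOp_ae m h g] with x h1 h2
  rw [h1, h2]; ring

/-- The class in `L²` of a Schwartz function. -/
abbrev toL2 (φ : 𝓢(ℝ, ℂ)) : L2 := φ.toLp 2

lemma toL2_ae (φ : 𝓢(ℝ, ℂ)) : toL2 φ =ᵐ[volume] φ := φ.coeFn_toLp 2

lemma pair_toL2 (f : L2) (φ : 𝓢(ℝ, ℂ)) : pair f (toL2 φ) = ∫ x, f x * φ x := by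
  rw [pair_eq]
  apply integral_congr_ae
  filter_upwards [toL2_ae φ] with x h
  rw [h]

lemma integrable_mul_schwartz (f : L2) (φ : 𝓢(ℝ, ℂ)) : Integrable (fun x => f x * φ x) := by
  refine (integrable_mul f (toL2 φ)).congr ?_
  filter_upwards [toL2_ae φ] with x h
  rw [h]

lemma toL2_add (φ ψ : 𝓢(ℝ, ℂ)) : toL2 (φ + ψ) = toL2 φ + toL2 ψ :=
  map_add (SchwartzMap.toLpCLM ℂ ℂ 2 volume) φ ψ

lemma toL2_sub (φ ψ : 𝓢(ℝ, ℂ)) : toL2 (φ - ψ) = toL2 φ - toL2 ψ :=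
  map_sub (SchwartzMap.toLpCLM ℂ ℂ 2 volume) φ ψ

lemma toL2_smul (c : ℂ) (φ : 𝓢(ℝ, ℂ)) : toL2 (c • φ) = c • toL2 φ :=
  map_smul (SchwartzMap.toLpCLM ℂ ℂ 2 volume) c φ

lemma denseRange_toL2 : DenseRange (toL2) :=
  SchwartzMap.denseRange_toLpCLM (E := ℝ) (F := ℂ) (p := 2) (μ := volume) (by simp)

/-- Complex conjugation on `L²`. -/
def conjL2 : L2 →L[ℝ] L2 := (Complex.conjCLE : ℂ →L[ℝ] ℂ).compLpL 2 volume

lemma conjL2_ae (f : L2) : conjL2 f =ᵐ[volume] fun x => conj (f x) := by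
  filter_upwards [ContinuousLinearMap.coeFn_compLpL (Complex.conjCLE : ℂ →L[ℝ] ℂ) f] with x hx
  simpa [conjL2] using hx

lemma norm_conjL2 (f : L2) : ‖conjL2 f‖ = ‖f‖ := by
  apply le_antisymm <;> apply Lp.norm_le_norm_of_ae_le <;>
  · filter_upwards [conjL2_ae f] with x hx
    simp [hx]

/-- The reflection `f ↦ f (-·)` on `L²`. -/
def reflL2 : L2 →L[ℂ] L2 :=
  (Lp.compMeasurePreservingₗᵢ ℂ (fun x : ℝ => -x) (Measure.measurePreserving_neg volume)).toContinuousLinearMap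

lemma reflL2_ae (f : L2) : reflL2 f =ᵐ[volume] fun x => f (-x) :=
  Lp.coeFn_compMeasurePreserving f (Measure.measurePreserving_neg (volume : Measure ℝ))

lemma norm_reflL2 (f : L2) : ‖reflL2 f‖ = ‖f‖ :=
  (Lp.compMeasurePreservingₗᵢ ℂ (fun x : ℝ => -x)
    (Measure.measurePreserving_neg volume)).norm_map f

lemma ae_neg {p : ℝ → Prop} (h : ∀ᵐ x : ℝ, p x) : ∀ᵐ x : ℝ, p (-x) :=
  (Measure.measurePreserving_neg (volume : Measure ℝ)).quasiMeasurePreserving.ae h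

lemma pair_reflL2 (f g : L2) : pair (reflL2 f) (reflL2 g) = pair f g := by
  rw [pair_eq, pair_eq, ← integral_neg_eq_self]
  apply integral_congr_ae
  filter_upwards [ae_neg (reflL2_ae f), ae_neg (reflL2_ae g)] with x h1 h2
  simp [h1, h2]

lemma pair_conjL2 (f g : L2) : pair (conjL2 f) (conjL2 g) = conj (pair f g) := by
  rw [pair_eq, pair_eq, ← integral_conj]
  apply integral_congr_ae
  filter_upwards [conjL2_ae f, conjL2_ae g] with x h1 h2
  simp [h1, h2]

/-! ### Fourier duality -/

/-- The multiplication formula for Schwartz functions extends to L² because both sides are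
continuous in each argument. -/
lemma pair_fourierInv (f g : L2) : pair (𝓕⁻ f) g = pair f (𝓕⁻ g) := by
  have hc : Continuous (fun f : L2 => 𝓕⁻ f) := (Lp.fourierTransformₗᵢ ℝ ℂ).symm.continuous
  refine denseRange_toL2.induction_on₂ (p := fun f g => pair (𝓕⁻ f) g = pair f (𝓕⁻ g))
    (isClosed_eq ?_ ?_) (fun φ ψ => ?_) f g
  · exact (pair.continuous.comp (hc.comp continuous_fst)).clm_apply continuous_snd
  · exact (pair.continuous.comp continuous_fst).clm_apply (hc.comp continuous_snd)
  · simp only [toL2, SchwartzMap.toLp_fourierInv_eq]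
    rw [pair_toL2, pair_comm, pair_toL2]
    have := SchwartzMap.integral_fourierInv_mul_eq φ ψ
    calc _ = ∫ x, (𝓕⁻ φ) x * ψ x := by
          apply integral_congr_ae
          filter_upwards [toL2_ae (𝓕⁻ φ)] with x h
          rw [h]
      _ = _ := this
      _ = _ := by
          apply integral_congr_ae
          filter_upwards [toL2_ae (𝓕⁻ ψ)] with x h
          rw [h, mul_comm]

/-- The reflection of a Schwartz function. -/
def reflS : 𝓢(ℝ, ℂ) →L[ℂ] 𝓢(ℝ, ℂ) :=
  SchwartzMap.compCLMOfContinuousLinearEquiv ℂ (ContinuousLinearEquiv.neg ℝ)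

@[simp] lemma reflS_apply (φ : 𝓢(ℝ, ℂ)) (x : ℝ) : reflS φ x = φ (-x) := rfl

/-- The complex conjugate of a Schwartz function. -/
def conjS : 𝓢(ℝ, ℂ) →L[ℝ] 𝓢(ℝ, ℂ) :=
  SchwartzMap.postcompCLM (Complex.conjCLE : ℂ →L[ℝ] ℂ)

@[simp] lemma conjS_apply (φ : 𝓢(ℝ, ℂ)) (x : ℝ) : conjS φ x = conj (φ x) := rfl

lemma reflL2_toL2 (φ : 𝓢(ℝ, ℂ)) : reflL2 (toL2 φ) = toL2 (reflS φ) := by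
  apply Lp.ext
  filter_upwards [reflL2_ae (toL2 φ), ae_neg (toL2_ae φ), toL2_ae (reflS φ)] with x h1 h2 h3
  rw [h1, h2, h3, reflS_apply]

lemma conjL2_toL2 (φ : 𝓢(ℝ, ℂ)) : conjL2 (toL2 φ) = toL2 (conjS φ) := by
  apply Lp.ext
  filter_upwards [conjL2_ae (toL2 φ), toL2_ae φ, toL2_ae (conjS φ)] with x h1 h2 h3
  rw [h1, h2, h3, conjS_apply]

lemma fourierInv_reflS (φ : 𝓢(ℝ, ℂ)) : 𝓕⁻ (reflS φ) = reflS (𝓕⁻ φ) := by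
  ext x
  rw [reflS_apply, SchwartzMap.fourierInv_coe, SchwartzMap.fourierInv_coe,
    Real.fourierInv_eq', Real.fourierInv_eq', ← integral_neg_eq_self]
  simp

lemma fourierInv_conjS (φ : 𝓢(ℝ, ℂ)) : 𝓕⁻ (conjS φ) = conjS (reflS (𝓕⁻ φ)) := by
  ext x
  rw [conjS_apply, reflS_apply, SchwartzMap.fourierInv_coe, SchwartzMap.fourierInv_coe,
    Real.fourierInv_eq', Real.fourierInv_eq', ← integral_conj]
  congr 1
  ext y
  have h2 : (starRingEnd ℂ) 2 = 2 := map_ofNat _ 2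
  simp [← Complex.exp_conj, h2]

lemma continuous_fourierInv : Continuous (fun f : L2 => 𝓕⁻ f) :=
  (Lp.fourierTransformₗᵢ ℝ ℂ).symm.continuous

lemma fourierInv_reflL2 (f : L2) : 𝓕⁻ (reflL2 f) = reflL2 (𝓕⁻ f) := by
  refine denseRange_toL2.induction_on (p := fun f : L2 => 𝓕⁻ (reflL2 f) = reflL2 (𝓕⁻ f)) f
    (isClosed_eq (continuous_fourierInv.comp reflL2.continuous)
      (reflL2.continuous.comp continuous_fourierInv)) (fun φ => ?_)
  rw [reflL2_toL2, SchwartzMap.toLp_fourierInv_eq, fourierInv_reflS, SchwartzMap.toLp_fourierInv_eq,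
    reflL2_toL2]

/-- Conjugation on the Fourier side is conjugation composed with reflection in space. This makes the
nonlocal involution v ↦ v* a plain conjugation of the representative in L². -/
lemma fourierInv_conjL2 (f : L2) : 𝓕⁻ (conjL2 f) = conjL2 (reflL2 (𝓕⁻ f)) := by
  refine denseRange_toL2.induction_on (p := fun f : L2 => 𝓕⁻ (conjL2 f) = conjL2 (reflL2 (𝓕⁻ f))) f
    (isClosed_eq (continuous_fourierInv.comp conjL2.continuous)
      (conjL2.continuous.comp (reflL2.continuous.comp continuous_fourierInv))) (fun φ => ?_)
  rw [conjL2_toL2, SchwartzMap.toLp_fourierInv_eq, fourierInv_conjS, SchwartzMap.toLp_fourierInv_eq,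
    reflL2_toL2, conjL2_toL2]

end

/-! ### H¹ parametrized by L², and Schwartz functions inside it -/

noncomputable section

/-! ### `H¹` as the image of `L²` under `⟨ξ⟩⁻¹` on the Fourier side -/

lemma one_add_abs_pos (ξ : ℝ) : 0 < 1 + |ξ| := by positivity

lemma one_add_abs_ne (ξ : ℝ) : ((1 + |ξ| : ℝ) : ℂ) ≠ 0 :=
  Complex.ofReal_ne_zero.2 (one_add_abs_pos ξ).ne.symm

/-- The inverse Fourier transform on `L²` as a continuous linear map. -/
def fourierInvL : L2 →L[ℂ] L2 := (Lp.fourierTransformₗᵢ ℝ ℂ).symm.toContinuousLinearEquiv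

lemma fourierInvL_apply (f : L2) : fourierInvL f = 𝓕⁻ f := rfl

/-- The Fourier transform on `L²` as a continuous linear map. -/
def fourierL : L2 →L[ℂ] L2 := (Lp.fourierTransformₗᵢ ℝ ℂ).toContinuousLinearEquiv

lemma fourierL_apply (f : L2) : fourierL f = 𝓕 f := rfl

lemma fourierInvL_fourierL (f : L2) : fourierInvL (fourierL f) = f := by
  simp [fourierInvL_apply, fourierL_apply]

lemma fourierL_fourierInvL (f : L2) : fourierL (fourierInvL f) = f := by
  simp [fourierInvL_apply, fourierL_apply]

lemma norm_fourierInvL (f : L2) : ‖fourierInvL f‖ = ‖f‖ :=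
  (Lp.fourierTransformₗᵢ ℝ ℂ).symm.norm_map f

lemma norm_fourierL (f : L2) : ‖fourierL f‖ = ‖f‖ :=
  (Lp.fourierTransformₗᵢ ℝ ℂ).norm_map f

/-- The symbol `⟨ξ⟩⁻¹`. -/
def invWeight (ξ : ℝ) : ℂ := ((1 + |ξ| : ℝ) : ℂ)⁻¹

lemma norm_invWeight (ξ : ℝ) : ‖invWeight ξ‖ = (1 + |ξ|)⁻¹ := by
  rw [invWeight, norm_inv, Complex.norm_real, Real.norm_of_nonneg (one_add_abs_pos ξ).le]

lemma continuous_invWeight : Continuous invWeight :=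
  Continuous.inv₀ (by fun_prop) one_add_abs_ne

lemma memLp_invWeight : MemLp invWeight ⊤ volume := by
  refine memLp_top_of_forall continuous_invWeight.aestronglyMeasurable 1 fun ξ => ?_
  rw [norm_invWeight]
  exact inv_le_one_of_one_le₀ (by linarith [abs_nonneg ξ])

/-- The symbol `2 π i ξ ⟨ξ⟩⁻¹`. -/
def derivWeight (ξ : ℝ) : ℂ := 2 * Real.pi * Complex.I * ξ * invWeight ξ

lemma memLp_derivWeight : MemLp derivWeight ⊤ volume := by
  refine memLp_top_of_forall (Continuous.aestronglyMeasurable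
    (by unfold derivWeight; exact Continuous.mul (by fun_prop) continuous_invWeight))
    (2 * Real.pi) fun ξ => ?_
  rw [derivWeight, norm_mul, norm_invWeight]
  have := Real.pi_pos
  simp only [norm_mul, Complex.norm_ofNat, Complex.norm_real, Complex.norm_I, Real.norm_eq_abs,
    abs_of_pos Real.pi_pos, mul_one]
  rw [mul_assoc]
  refine mul_le_of_le_one_right (by positivity) ?_
  rw [← div_eq_mul_inv, div_le_one (one_add_abs_pos ξ)]
  linarith

/-- The isomorphism from `L²` onto `H¹`, `g ↦ 𝓕⁻¹ (⟨ξ⟩⁻¹ g)`. -/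
def J : L2 →L[ℂ] L2 := fourierInvL ∘L mulOp invWeight memLp_invWeight

/-- The weak derivative of `J g`. -/
def DJ : L2 →L[ℂ] L2 := fourierInvL ∘L mulOp derivWeight memLp_derivWeight

lemma J_apply (g : L2) : J g = fourierInvL (mulOp invWeight memLp_invWeight g) := rfl

lemma norm_J_le (g : L2) : ‖J g‖ ≤ ‖g‖ := by
  rw [J_apply, norm_fourierInvL]
  refine (norm_mulOp_le _ _ g 1 (Eventually.of_forall fun ξ => ?_)).trans (one_mul _).le
  rw [norm_invWeight]
  exact inv_le_one_of_one_le₀ (by linarith [abs_nonneg ξ])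

lemma weightedFourier_J (g : L2) : weightedFourier (J g) =ᵐ[volume] g := by
  have h1 : (𝓕 (J g) : L2) = mulOp invWeight memLp_invWeight g := by
    rw [J_apply, ← fourierL_apply, fourierL_fourierInvL]
  filter_upwards [mulOp_ae invWeight memLp_invWeight g] with ξ h2
  rw [weightedFourier, h1, h2, invWeight, ← mul_assoc, mul_inv_cancel₀ (one_add_abs_ne ξ), one_mul]

lemma memH1_J (g : L2) : MemH1 (J g) :=
  (memLp_congr_ae (weightedFourier_J g)).2 (Lp.memLp g)

lemma normH1_J (g : L2) : normH1 (J g) = ‖g‖ := by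
  rw [normH1, eLpNorm_congr_ae (weightedFourier_J g), Lp.norm_def]

lemma exists_J_eq {f : L2} (h : MemH1 f) : ∃ g : L2, J g = f := by
  refine ⟨h.toLp _, ?_⟩
  have : mulOp invWeight memLp_invWeight (h.toLp _) = fourierL f := by
    apply Lp.ext
    filter_upwards [mulOp_ae invWeight memLp_invWeight (h.toLp _), h.coeFn_toLp] with ξ h1 h2
    rw [h1, h2, weightedFourier, invWeight, ← mul_assoc, inv_mul_cancel₀ (one_add_abs_ne ξ),
      one_mul, fourierL_apply]
  rw [J_apply, this, fourierInvL_fourierL]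

lemma J_injective : Function.Injective J := by
  intro f g h
  have : ‖f - g‖ = 0 := by rw [← normH1_J, map_sub, h, sub_self, ← map_zero J, normH1_J, norm_zero]
  exact sub_eq_zero.1 (norm_eq_zero.1 this)

/-- The functional dual to a Schwartz function, on the Fourier side. -/
def dualS (φ : 𝓢(ℝ, ℂ)) : L2 := mulOp invWeight memLp_invWeight (toL2 (𝓕⁻ φ))

/-- Transfers distributional testing to the Fourier side, where the free propagator is a multiplier
and moves freely across the pairing. -/
lemma pair_J_toL2 (g : L2) (φ : 𝓢(ℝ, ℂ)) : pair (J g) (toL2 φ) = pair g (dualS φ) := by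
  rw [J_apply, fourierInvL_apply, pair_fourierInv, SchwartzMap.toLp_fourierInv_eq, pair_mulOp, dualS]

/-! ### Schwartz functions in `H¹` -/

/-- The derivative of a Schwartz function. -/
abbrev dS : 𝓢(ℝ, ℂ) →L[ℂ] 𝓢(ℝ, ℂ) := SchwartzMap.derivCLM ℂ ℂ

/-- Multiplication of a Schwartz function by the coordinate. -/
def xS : 𝓢(ℝ, ℂ) →L[ℂ] 𝓢(ℝ, ℂ) := SchwartzMap.smulLeftCLM ℂ (fun x : ℝ => (x : ℂ))

@[simp] lemma xS_apply (φ : 𝓢(ℝ, ℂ)) (x : ℝ) : xS φ x = x * φ x := by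
  rw [xS, SchwartzMap.smulLeftCLM_apply_apply (by fun_prop)]
  rfl

lemma dS_apply (φ : 𝓢(ℝ, ℂ)) (x : ℝ) : dS φ x = deriv φ x := rfl

lemma hasDerivAt_schwartz (φ : 𝓢(ℝ, ℂ)) (x : ℝ) : HasDerivAt φ (dS φ x) x :=
  (φ.differentiableAt).hasDerivAt

lemma fourier_dS (φ : 𝓢(ℝ, ℂ)) (ξ : ℝ) :
    (𝓕 (dS φ) : 𝓢(ℝ, ℂ)) ξ = 2 * Real.pi * Complex.I * ξ * (𝓕 φ : 𝓢(ℝ, ℂ)) ξ := by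
  rw [SchwartzMap.fourier_coe, SchwartzMap.fourier_coe]
  have := Real.fourier_deriv (f := φ) φ.integrable φ.differentiable (dS φ).integrable
  have h2 := congrFun this ξ
  simp only [smul_eq_mul] at h2
  exact h2

lemma fourierInv_dS (φ : 𝓢(ℝ, ℂ)) (ξ : ℝ) :
    (𝓕⁻ (dS φ) : 𝓢(ℝ, ℂ)) ξ = -(2 * Real.pi * Complex.I * ξ) * (𝓕⁻ φ : 𝓢(ℝ, ℂ)) ξ := by
  have := fourier_dS φ (-ξ)
  rw [SchwartzMap.fourier_coe, SchwartzMap.fourier_coe] at this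
  rw [SchwartzMap.fourierInv_coe, SchwartzMap.fourierInv_coe, Real.fourierInv_eq_fourier_neg,
    Real.fourierInv_eq_fourier_neg, this]
  push_cast
  ring

/-- The sign as a complex number. -/
def sgn (ξ : ℝ) : ℂ := ((if 0 ≤ ξ then 1 else -1 : ℝ) : ℂ)

lemma norm_sgn (ξ : ℝ) : ‖sgn ξ‖ = 1 := by
  unfold sgn; split_ifs <;> simp

lemma sgn_mul (ξ : ℝ) : sgn ξ * ξ = ((|ξ| : ℝ) : ℂ) := by
  unfold sgn
  split_ifs with h
  · rw [abs_of_nonneg h]; simp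
  · rw [abs_of_neg (not_le.1 h)]; simp

lemma memLp_sgn : MemLp sgn ⊤ volume := by
  refine memLp_top_of_forall (Measurable.aestronglyMeasurable ?_) 1 fun ξ => (norm_sgn ξ).le
  unfold sgn
  exact Complex.measurable_ofReal.comp
    (Measurable.ite measurableSet_Ici measurable_const measurable_const)

/-- The class of a Schwartz function in `H¹`: the function `⟨ξ⟩ φ̂`. -/
def iota : 𝓢(ℝ, ℂ) →L[ℂ] L2 :=
  fourierL ∘L SchwartzMap.toLpCLM ℂ ℂ 2 volume +
    (2 * Real.pi * Complex.I : ℂ)⁻¹ • (mulOp sgn memLp_sgn ∘L fourierL ∘L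
      SchwartzMap.toLpCLM ℂ ℂ 2 volume ∘L dS)

lemma iota_apply (φ : 𝓢(ℝ, ℂ)) : iota φ = fourierL (toL2 φ) +
    (2 * Real.pi * Complex.I : ℂ)⁻¹ • mulOp sgn memLp_sgn (fourierL (toL2 (dS φ))) := rfl

lemma two_pi_I_ne : (2 * Real.pi * Complex.I : ℂ) ≠ 0 := by
  simp [Real.pi_ne_zero]

lemma fourierL_toL2_ae (φ : 𝓢(ℝ, ℂ)) : fourierL (toL2 φ) =ᵐ[volume] (𝓕 φ : 𝓢(ℝ, ℂ)) := by
  rw [fourierL_apply, SchwartzMap.toLp_fourier_eq]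
  exact toL2_ae _

/-- Since |ξ| = sgn(ξ) ξ, the factor |ξ| on the Fourier side is a derivative followed by a bounded
multiplier. This form of `iota` makes its continuity automatic and bounds it by the L² norms of φ
and φ'. -/
lemma iota_ae (φ : 𝓢(ℝ, ℂ)) :
    iota φ =ᵐ[volume] fun ξ => ((1 + |ξ| : ℝ) : ℂ) * (𝓕 φ : 𝓢(ℝ, ℂ)) ξ := by
  rw [iota_apply]
  filter_upwards [Lp.coeFn_add (fourierL (toL2 φ)) ((2 * Real.pi * Complex.I : ℂ)⁻¹ •
      mulOp sgn memLp_sgn (fourierL (toL2 (dS φ)))),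
    Lp.coeFn_smul (2 * Real.pi * Complex.I : ℂ)⁻¹ (mulOp sgn memLp_sgn (fourierL (toL2 (dS φ)))),
    mulOp_ae sgn memLp_sgn (fourierL (toL2 (dS φ))), fourierL_toL2_ae φ,
    fourierL_toL2_ae (dS φ)] with ξ h1 h2 h3 h4 h5
  rw [h1, Pi.add_apply, h2, Pi.smul_apply, h3, h4, h5, fourier_dS, smul_eq_mul, Complex.ofReal_add,
    ← sgn_mul]
  have := two_pi_I_ne
  generalize (𝓕 φ : 𝓢(ℝ, ℂ)) ξ = z
  generalize sgn ξ = s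
  field_simp
  push_cast
  ring

lemma norm_iota_le (φ : 𝓢(ℝ, ℂ)) : ‖iota φ‖ ≤ ‖toL2 φ‖ + ‖toL2 (dS φ)‖ := by
  rw [iota_apply]
  refine (norm_add_le _ _).trans ?_
  rw [norm_fourierL, norm_smul]
  gcongr
  have h1 := norm_mulOp_le sgn memLp_sgn (fourierL (toL2 (dS φ))) 1
    (Eventually.of_forall fun ξ => (norm_sgn ξ).le)
  rw [norm_fourierL, one_mul] at h1
  have h2 : ‖(2 * Real.pi * Complex.I : ℂ)⁻¹‖ ≤ 1 := by
    rw [norm_inv]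
    apply inv_le_one_of_one_le₀
    simp only [norm_mul, Complex.norm_ofNat, Complex.norm_real, Complex.norm_I, Real.norm_eq_abs,
      abs_of_pos Real.pi_pos, mul_one]
    linarith [Real.pi_gt_three]
  calc _ ≤ 1 * ‖toL2 (dS φ)‖ := by gcongr
    _ = _ := one_mul _

lemma J_iota (φ : 𝓢(ℝ, ℂ)) : J (iota φ) = toL2 φ := by
  have : mulOp invWeight memLp_invWeight (iota φ) = fourierL (toL2 φ) := by
    apply Lp.ext
    filter_upwards [mulOp_ae invWeight memLp_invWeight (iota φ), iota_ae φ, fourierL_toL2_ae φ]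
      with ξ h1 h2 h3
    rw [h1, h2, h3, invWeight, ← mul_assoc, inv_mul_cancel₀ (one_add_abs_ne ξ), one_mul]
  rw [J_apply, this, fourierInvL_fourierL]

lemma DJ_iota (φ : 𝓢(ℝ, ℂ)) : DJ (iota φ) = toL2 (dS φ) := by
  have : mulOp derivWeight memLp_derivWeight (iota φ) = fourierL (toL2 (dS φ)) := by
    apply Lp.ext
    filter_upwards [mulOp_ae derivWeight memLp_derivWeight (iota φ), iota_ae φ,
      fourierL_toL2_ae (dS φ)] with ξ h1 h2 h3
    rw [h1, h2, h3, derivWeight, invWeight, fourier_dS]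
    have := one_add_abs_ne ξ
    field_simp
  rw [show DJ (iota φ) = fourierInvL (mulOp derivWeight memLp_derivWeight (iota φ)) from rfl, this,
    fourierInvL_fourierL]

lemma norm_toL2_le (φ : 𝓢(ℝ, ℂ)) : ‖toL2 φ‖ ≤ ‖iota φ‖ := by
  rw [← J_iota]; exact norm_J_le _

lemma norm_toL2_dS_le (φ : 𝓢(ℝ, ℂ)) : ‖toL2 (dS φ)‖ ≤ ‖DJ‖ * ‖iota φ‖ := by
  rw [← DJ_iota]; exact DJ.le_opNorm _

/-- A vector g orthogonal to the range is orthogonal to ⟨ξ⟩ψ for every test function ψ, because ψ is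
the Fourier transform of a Schwartz function; hence ⟨ξ⟩g = 0. -/
lemma denseRange_iota : DenseRange iota := by
  have h : (LinearMap.range iota.toLinearMap).topologicalClosure = ⊤ := by
    rw [Submodule.topologicalClosure_eq_top_iff, eq_bot_iff]
    intro g hg
    rw [Submodule.mem_orthogonal] at hg
    have hloc : LocallyIntegrable (fun ξ : ℝ => ((1 + |ξ| : ℝ) : ℂ) * g ξ) volume := by
      have h1 : LocallyIntegrable (g : ℝ → ℂ) volume :=
        (Lp.memLp g).locallyIntegrable (by norm_num)
      rw [← locallyIntegrableOn_univ] at h1 ⊢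
      refine h1.continuousOn_mul (Continuous.continuousOn (by fun_prop)) ?_
      exact isClosed_univ.isLocallyClosed
    have h0 := ae_eq_zero_of_integral_contDiff_smul_eq_zero hloc (fun ψ hψ hc => by
      have hc' : HasCompactSupport (fun x => (ψ x : ℂ)) := hc.comp_left (g := Complex.ofReal) (by simp)
      have hψ' : ContDiff ℝ ((⊤ : ℕ∞) : WithTop ℕ∞) (fun x => (ψ x : ℂ)) :=
        Complex.ofRealCLM.contDiff.comp hψ
      have h1 := hg (iota (𝓕⁻ (hc'.toSchwartzMap hψ'))) ⟨_, rfl⟩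
      rw [L2.inner_def] at h1
      rw [← h1]
      apply integral_congr_ae
      filter_upwards [iota_ae (𝓕⁻ (hc'.toSchwartzMap hψ'))] with ξ h2
      rw [h2, FourierTransform.fourier_fourierInv_eq]
      have h3 : hc'.toSchwartzMap hψ' ξ = (ψ ξ : ℂ) := rfl
      rw [h3]
      simp only [RCLike.inner_apply, map_mul, Complex.conj_ofReal, Complex.real_smul]
      ring)
    rw [Submodule.mem_bot]
    apply (Lp.eq_zero_iff_ae_eq_zero).2
    filter_upwards [h0] with ξ h1
    exact (mul_eq_zero.1 h1).resolve_left (one_add_abs_ne ξ)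
  exact (Submodule.dense_iff_topologicalClosure_eq_top).2 h

end

/-! ### H¹ as an algebra with involution, and the free Schrödinger group -/

noncomputable section

/-! ### The algebra structure of `H¹` -/

/-- By Cauchy–Schwarz, ⟨ξ⟩⁻¹ ∈ L² makes v̂ integrable for v ∈ H¹, and this is the embedding into
L^∞. -/
lemma memLp_invWeight_two : MemLp invWeight 2 volume := by
  rw [memLp_two_iff_integrable_sq_norm continuous_invWeight.aestronglyMeasurable]
  have := integrable_one_add_norm (E := ℝ) (μ := volume) (r := 2) (by simp)
  refine this.congr (Eventually.of_forall fun ξ => ?_)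
  simp only [norm_invWeight, Real.norm_eq_abs]
  rw [Real.rpow_neg (one_add_abs_pos ξ).le, inv_pow]
  norm_cast

/-- Multiplication by `⟨ξ⟩⁻¹` from `L²` to `L¹`. -/
def invWeightL1 : L2 →L[ℂ] Lp ℂ 1 (volume : Measure ℝ) :=
  (ContinuousLinearMap.mul ℂ ℂ).holderL volume 2 2 1 (memLp_invWeight_two.toLp _)

lemma invWeightL1_ae (g : L2) : invWeightL1 g =ᵐ[volume] fun ξ => invWeight ξ * g ξ := by
  have h1 := ContinuousLinearMap.coeFn_holder (r := 1) (ContinuousLinearMap.mul ℂ ℂ)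
    (memLp_invWeight_two.toLp _) g
  filter_upwards [h1, memLp_invWeight_two.coeFn_toLp] with x hx hx'
  simp only [invWeightL1]
  rw [ContinuousLinearMap.holderL_apply_apply, hx, hx']
  simp

/-- The constant of the embedding `H¹ ⊂ L^∞`. -/
def supC : ℝ := ‖invWeightL1‖

lemma supC_nonneg : 0 ≤ supC := norm_nonneg _

lemma norm_schwartz_le (φ : 𝓢(ℝ, ℂ)) (x : ℝ) : ‖φ x‖ ≤ supC * ‖iota φ‖ := by
  have h1 : φ x = 𝓕⁻ ((𝓕 φ : 𝓢(ℝ, ℂ)) : ℝ → ℂ) x := by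
    rw [← SchwartzMap.fourierInv_coe, FourierTransform.fourierInv_fourier_eq]
  rw [h1, Real.fourierInv_eq']
  refine (norm_integral_le_integral_norm _).trans ?_
  have h2 : ∫ v : ℝ, ‖Complex.exp (↑(2 * Real.pi * inner ℝ v x) * Complex.I) •
      (𝓕 φ : 𝓢(ℝ, ℂ)) v‖ = ‖invWeightL1 (iota φ)‖ := by
    rw [L1.norm_eq_integral_norm]
    apply integral_congr_ae
    filter_upwards [invWeightL1_ae (iota φ), iota_ae φ] with ξ h3 h4
    rw [h3, h4, invWeight, ← mul_assoc, inv_mul_cancel₀ (one_add_abs_ne ξ), one_mul, norm_smul,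
      Complex.norm_exp_ofReal_mul_I, one_mul]
  rw [h2]
  exact invWeightL1.le_opNorm _

/-- Approximation by Schwartz functions in H¹ converges in L², hence almost everywhere along a
subsequence, and the pointwise bound passes to the limit. -/
lemma norm_J_ae_le (g : L2) : ∀ᵐ x, ‖J g x‖ ≤ supC * ‖g‖ := by
  obtain ⟨u, hu1, hu2⟩ : ∃ u : ℕ → L2, (∀ n, u n ∈ range iota) ∧ Tendsto u atTop (𝓝 g) :=
    mem_closure_iff_seq_limit.1 (denseRange_iota g)
  choose φ hφ using hu1
  have h1 : Tendsto (fun n => J (u n)) atTop (𝓝 (J g)) := (J.continuous.tendsto g).comp hu2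
  have h2 : TendstoInMeasure volume (fun n => (J (u n) : ℝ → ℂ)) atTop (J g) :=
    tendstoInMeasure_of_tendsto_Lp h1
  obtain ⟨ns, hns, h3⟩ := h2.exists_seq_tendsto_ae
  have h4 : ∀ᵐ x, ∀ n, J (u n) x = φ n x := by
    rw [ae_all_iff]
    intro n
    rw [← hφ n, J_iota]
    exact toL2_ae _
  filter_upwards [h3, h4] with x h5 h6
  refine le_of_tendsto_of_tendsto h5.norm
    ((((hu2.comp hns.tendsto_atTop).norm).const_mul supC)) (Eventually.of_forall fun n => ?_)
  simp only [Function.comp_apply]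
  rw [h6, ← hφ]
  exact norm_schwartz_le _ _

lemma memLp_J (g : L2) : MemLp (J g : ℝ → ℂ) ⊤ volume :=
  MeasureTheory.memLp_top_of_bound (Lp.aestronglyMeasurable _) _ (norm_J_ae_le g)

/-- The product of Schwartz functions. -/
def mulS : 𝓢(ℝ, ℂ) →ₗ[ℂ] 𝓢(ℝ, ℂ) →L[ℂ] 𝓢(ℝ, ℂ) :=
  SchwartzMap.pairing (ContinuousLinearMap.mul ℂ ℂ)

@[simp] lemma mulS_apply (φ ψ : 𝓢(ℝ, ℂ)) (x : ℝ) : mulS φ ψ x = φ x * ψ x := by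
  simp [mulS, SchwartzMap.pairing_apply_apply]

lemma dS_mulS (φ ψ : 𝓢(ℝ, ℂ)) : dS (mulS φ ψ) = mulS (dS φ) ψ + mulS φ (dS ψ) := by
  ext x
  have h := (hasDerivAt_schwartz φ x).mul (hasDerivAt_schwartz ψ x)
  rw [dS_apply, add_apply, mulS_apply, mulS_apply, ← h.deriv]
  congr 1

lemma norm_toL2_mulS_le (φ ψ : 𝓢(ℝ, ℂ)) : ‖toL2 (mulS φ ψ)‖ ≤ supC * ‖iota φ‖ * ‖toL2 ψ‖ := by
  apply Lp.norm_le_mul_norm_of_ae_le_mul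
  filter_upwards [toL2_ae (mulS φ ψ), toL2_ae ψ] with x h1 h2
  rw [h1, h2, mulS_apply, norm_mul]
  gcongr
  exact norm_schwartz_le φ x

lemma norm_toL2_mulS_le' (φ ψ : 𝓢(ℝ, ℂ)) : ‖toL2 (mulS φ ψ)‖ ≤ supC * ‖toL2 φ‖ * ‖iota ψ‖ := by
  have : mulS φ ψ = mulS ψ φ := by ext x; simp [mul_comm]
  rw [this]
  linarith [norm_toL2_mulS_le ψ φ]

/-- The constant in the product estimate. -/
def algC : ℝ := supC * (1 + 2 * ‖DJ‖)

lemma algC_nonneg : 0 ≤ algC := mul_nonneg supC_nonneg (by positivity)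

/-- Leibniz rule: in each term one factor is taken in L^∞ through the embedding, the other in L². -/
lemma norm_iota_mulS_le (φ ψ : 𝓢(ℝ, ℂ)) : ‖iota (mulS φ ψ)‖ ≤ algC * ‖iota φ‖ * ‖iota ψ‖ := by
  refine (norm_iota_le _).trans ?_
  rw [dS_mulS, toL2_add]
  have h0 := norm_add_le (toL2 (mulS (dS φ) ψ)) (toL2 (mulS φ (dS ψ)))
  have h1 := norm_toL2_mulS_le φ ψ
  have h2 := norm_toL2_mulS_le' (dS φ) ψ
  have h3 := norm_toL2_mulS_le φ (dS ψ)
  have hs := supC_nonneg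
  have h4 : supC * ‖iota φ‖ * ‖toL2 ψ‖ ≤ supC * ‖iota φ‖ * ‖iota ψ‖ := by
    gcongr; exact norm_toL2_le ψ
  have h5 : supC * ‖toL2 (dS φ)‖ * ‖iota ψ‖ ≤ supC * (‖DJ‖ * ‖iota φ‖) * ‖iota ψ‖ := by
    gcongr; exact norm_toL2_dS_le φ
  have h6 : supC * ‖iota φ‖ * ‖toL2 (dS ψ)‖ ≤ supC * ‖iota φ‖ * (‖DJ‖ * ‖iota ψ‖) := by
    gcongr; exact norm_toL2_dS_le ψ
  unfold algC
  nlinarith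

/-- Multiplication by a Schwartz function on `H¹`. -/
def mulX₁ (φ : 𝓢(ℝ, ℂ)) : L2 →L[ℂ] L2 :=
  LinearMap.extendOfNorm (iota.toLinearMap ∘ₗ (mulS φ).toLinearMap) iota.toLinearMap

lemma mulX₁_iota (φ ψ : 𝓢(ℝ, ℂ)) : mulX₁ φ (iota ψ) = iota (mulS φ ψ) :=
  LinearMap.extendOfNorm_eq (e := iota.toLinearMap) denseRange_iota
    ⟨_, norm_iota_mulS_le φ⟩ ψ

lemma norm_mulX₁_le (φ : 𝓢(ℝ, ℂ)) : ‖mulX₁ φ‖ ≤ algC * ‖iota φ‖ :=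
  LinearMap.opNorm_extendOfNorm_le (e := iota.toLinearMap) denseRange_iota
    (mul_nonneg algC_nonneg (norm_nonneg _)) (norm_iota_mulS_le φ)

lemma clm_ext_iota {E : Type*} [NormedAddCommGroup E] [NormedSpace ℂ E] {A B : L2 →L[ℂ] E}
    (h : ∀ φ, A (iota φ) = B (iota φ)) : A = B :=
  ContinuousLinearMap.coeFn_injective (denseRange_iota.equalizer A.continuous B.continuous
    (funext h))

/-- `mulX₁` as a linear map. -/
def mulX₂ : 𝓢(ℝ, ℂ) →ₗ[ℂ] L2 →L[ℂ] L2 where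
  toFun := mulX₁
  map_add' φ ψ := clm_ext_iota fun χ => by simp [mulX₁_iota]
  map_smul' c φ := clm_ext_iota fun χ => by simp [mulX₁_iota]

/-- The product on `H¹`. -/
def mulX : L2 →L[ℂ] L2 →L[ℂ] L2 := LinearMap.extendOfNorm mulX₂ iota.toLinearMap

lemma mulX_iota (φ : 𝓢(ℝ, ℂ)) : mulX (iota φ) = mulX₁ φ :=
  LinearMap.extendOfNorm_eq (f := mulX₂) (e := iota.toLinearMap) denseRange_iota
    ⟨_, norm_mulX₁_le⟩ φ

/-- The product `mulX` is an extension by density in each factor separately. It is identified with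
the pointwise product first for a Schwartz left factor, then, with the right factor fixed, by
density in the left one. -/
lemma J_mulX (f g : L2) : J (mulX f g) = mulOp (J f) (memLp_J f) (J g) := by
  have h1 : ∀ (φ : 𝓢(ℝ, ℂ)) (g : L2), J (mulX (iota φ) g) = mulOp φ (φ.memLp_top) (J g) := by
    intro φ g
    have : J ∘L mulX (iota φ) = mulOp φ (φ.memLp_top) ∘L J := by
      refine clm_ext_iota fun ψ => ?_
      simp only [ContinuousLinearMap.comp_apply, mulX_iota, mulX₁_iota, J_iota]
      apply Lp.ext
      filter_upwards [mulOp_ae φ φ.memLp_top (toL2 ψ), toL2_ae ψ, toL2_ae (mulS φ ψ)] with x h1 h2 h3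
      rw [h1, h2, h3, mulS_apply]
    exact congrArg (fun A : L2 →L[ℂ] L2 => A g) this
  have h2 : J ∘L mulX.flip g = mulOp (J g) (memLp_J g) ∘L J := by
    refine clm_ext_iota fun φ => ?_
    simp only [ContinuousLinearMap.comp_apply, ContinuousLinearMap.flip_apply, h1, J_iota]
    apply Lp.ext
    filter_upwards [mulOp_ae φ φ.memLp_top (J g), mulOp_ae (J g) (memLp_J g) (toL2 φ), toL2_ae φ]
      with x h1 h2 h3
    rw [h1, h2, h3, mul_comm]
  have h3 : J (mulX f g) = mulOp (J g) (memLp_J g) (J f) :=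
    congrArg (fun A : L2 →L[ℂ] L2 => A f) h2
  rw [h3]
  apply Lp.ext
  filter_upwards [mulOp_ae (J g) (memLp_J g) (J f), mulOp_ae (J f) (memLp_J f) (J g)] with x h1 h2
  rw [h1, h2, mul_comm]

lemma J_mulX_ae (f g : L2) : J (mulX f g) =ᵐ[volume] fun x => J f x * J g x := by
  rw [J_mulX]; exact mulOp_ae _ _ _

/-! ### Conjugation and reflection -/

lemma invWeight_neg (ξ : ℝ) : invWeight (-ξ) = invWeight ξ := by simp [invWeight]

lemma conj_invWeight (ξ : ℝ) : conj (invWeight ξ) = invWeight ξ := by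
  rw [invWeight, map_inv₀, Complex.conj_ofReal]

lemma J_reflL2 (g : L2) : J (reflL2 g) = reflL2 (J g) := by
  rw [J_apply, J_apply, fourierInvL_apply, fourierInvL_apply, ← fourierInv_reflL2]
  congr 1
  apply Lp.ext
  filter_upwards [mulOp_ae invWeight memLp_invWeight (reflL2 g), reflL2_ae g,
    reflL2_ae (mulOp invWeight memLp_invWeight g),
    ae_neg (mulOp_ae invWeight memLp_invWeight g)] with x h1 h2 h3 h4
  rw [h1, h2, h3, h4, invWeight_neg]

lemma J_conjL2 (g : L2) : J (conjL2 g) = conjL2 (reflL2 (J g)) := by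
  rw [J_apply, J_apply, fourierInvL_apply, fourierInvL_apply, ← fourierInv_conjL2]
  congr 1
  apply Lp.ext
  filter_upwards [mulOp_ae invWeight memLp_invWeight (conjL2 g), conjL2_ae g,
    conjL2_ae (mulOp invWeight memLp_invWeight g),
    mulOp_ae invWeight memLp_invWeight g] with x h1 h2 h3 h4
  rw [h1, h2, h3, h4, map_mul, conj_invWeight]

lemma J_reflL2_ae (g : L2) : J (reflL2 g) =ᵐ[volume] fun x => J g (-x) := by
  rw [J_reflL2]; exact reflL2_ae _

lemma J_conjL2_ae (g : L2) : J (conjL2 g) =ᵐ[volume] fun x => conj (J g (-x)) := by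
  rw [J_conjL2]
  filter_upwards [conjL2_ae (reflL2 (J g)), reflL2_ae (J g)] with x h1 h2
  rw [h1, h2]

/-! ### The free propagator -/

/-- The symbol `e^{4 π² i t ξ²}` of the propagator of `i ∂_t - ∂_x²`. -/
def phase (t ξ : ℝ) : ℂ := Complex.exp ((4 * Real.pi ^ 2 * t * ξ ^ 2 : ℝ) * Complex.I)

lemma norm_phase (t ξ : ℝ) : ‖phase t ξ‖ = 1 := Complex.norm_exp_ofReal_mul_I _

lemma memLp_phase (t : ℝ) : MemLp (phase t) ⊤ volume :=
  memLp_top_of_forall (Continuous.aestronglyMeasurable (by unfold phase; fun_prop)) 1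
    fun ξ => (norm_phase t ξ).le

/-- The propagator. -/
def U (t : ℝ) : L2 →L[ℂ] L2 := mulOp (phase t) (memLp_phase t)

lemma U_ae (t : ℝ) (f : L2) : U t f =ᵐ[volume] fun ξ => phase t ξ * f ξ := mulOp_ae _ _ _

lemma norm_U (t : ℝ) (f : L2) : ‖U t f‖ = ‖f‖ := by
  apply le_antisymm <;> apply Lp.norm_le_norm_of_ae_le <;>
  · filter_upwards [U_ae t f] with x hx
    rw [hx, norm_mul, norm_phase, one_mul]

lemma U_add (s t : ℝ) (f : L2) : U (s + t) f = U s (U t f) := by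
  apply Lp.ext
  filter_upwards [U_ae (s + t) f, U_ae s (U t f), U_ae t f] with ξ h1 h2 h3
  rw [h1, h2, h3, ← mul_assoc, phase, phase, phase, ← Complex.exp_add]
  congr 2
  push_cast
  ring

lemma U_zero (f : L2) : U 0 f = f := by
  apply Lp.ext
  filter_upwards [U_ae 0 f] with ξ h1
  rw [h1]; simp [phase]

lemma U_neg_U (t : ℝ) (f : L2) : U (-t) (U t f) = f := by
  rw [← U_add, neg_add_cancel, U_zero]

lemma U_U_neg (t : ℝ) (f : L2) : U t (U (-t) f) = f := by
  rw [← U_add, add_neg_cancel, U_zero]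

lemma pair_U (t : ℝ) (f g : L2) : pair (U t f) g = pair f (U t g) := pair_mulOp _ _ _ _

lemma U_reflL2 (t : ℝ) (f : L2) : U t (reflL2 f) = reflL2 (U t f) := by
  apply Lp.ext
  filter_upwards [U_ae t (reflL2 f), reflL2_ae f, reflL2_ae (U t f), ae_neg (U_ae t f)]
    with ξ h1 h2 h3 h4
  rw [h1, h2, h3, h4]; simp [phase]

end

/-! ### Equivalence of the distributional equation with a differential equation in the interaction
picture -/

noncomputable section

/-! ### Differentiability and continuity of the propagator -/

lemma hasDerivAt_of_norm_le_sq {E : Type*} [NormedAddCommGroup E] [NormedSpace ℝ E] {f : ℝ → E}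
    {f' : E} {t C δ : ℝ} (hδ : 0 < δ)
    (h : ∀ s, |s - t| ≤ δ → ‖f s - f t - (s - t) • f'‖ ≤ C * (s - t) ^ 2) :
    HasDerivAt f f' t := by
  rw [hasDerivAt_iff_isLittleO]
  have h1 : (fun s => f s - f t - (s - t) • f') =O[𝓝 t] fun s => (s - t) ^ 2 := by
    refine Asymptotics.IsBigO.of_bound C ?_
    filter_upwards [Metric.closedBall_mem_nhds t hδ] with s hs
    have := h s (by simpa [Real.dist_eq] using hs)
    simpa using this
  refine h1.trans_isLittleO ?_
  have h2 : (fun s : ℝ => (s - t) ^ 2) =o[𝓝 t] fun s => (s - t) := by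
    have := Asymptotics.isLittleO_pow_id (𝕜 := ℝ) (n := 2) (by norm_num)
    have h3 : Tendsto (fun s : ℝ => s - t) (𝓝 t) (𝓝 0) := by
      have : Continuous (fun s : ℝ => s - t) := by fun_prop
      simpa using this.tendsto t
    exact this.comp_tendsto h3
  exact h2

/-- For |a| ≤ 1 this is Taylor's bound; for |a| ≥ 1 the triangle inequality gives 2|a| ≤ 2a². A
bound valid for every a is needed because a is proportional to ξ². -/
lemma norm_exp_I_sub_le (a : ℝ) : ‖Complex.exp (a * Complex.I) - 1 - a * Complex.I‖ ≤ 2 * a ^ 2 := by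
  have hn : ‖(a * Complex.I : ℂ)‖ = |a| := by simp
  rcases le_total |a| 1 with h | h
  · have := Complex.norm_exp_sub_one_sub_id_le (x := a * Complex.I) (by rw [hn]; exact h)
    rw [hn, sq_abs] at this
    nlinarith [sq_nonneg a]
  · have h1 : ‖Complex.exp (a * Complex.I) - 1‖ ≤ |a| := by
      have := Real.norm_exp_I_mul_ofReal_sub_one_le (x := a)
      rwa [mul_comm] at this
    have h2 := norm_sub_le (Complex.exp (a * Complex.I) - 1) (a * Complex.I)
    rw [hn] at h2
    nlinarith [sq_abs a]

/-- Here g₁ is the generator applied to g and g₂ is, up to sign, its square applied to g. The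
second-order Taylor bound for the phase, multiplied by g, is square integrable thanks to g₂. -/
lemma hasDerivAt_U {g g₁ g₂ : L2} (h₁ : ∀ᵐ ξ : ℝ, g₁ ξ = (4 * Real.pi ^ 2 * ξ ^ 2 : ℝ) * Complex.I * g ξ)
    (h₂ : ∀ᵐ ξ : ℝ, g₂ ξ = ((4 * Real.pi ^ 2 * ξ ^ 2) ^ 2 : ℝ) * g ξ) (t : ℝ) :
    HasDerivAt (fun s => U s g) (U t g₁) t := by
  refine hasDerivAt_of_norm_le_sq (C := 2 * ‖g₂‖) one_pos fun s _ => ?_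
  rw [show 2 * ‖g₂‖ * (s - t) ^ 2 = (2 * (s - t) ^ 2) * ‖g₂‖ by ring]
  apply Lp.norm_le_mul_norm_of_ae_le_mul
  filter_upwards [h₁, h₂, U_ae s g, U_ae t g, U_ae t g₁, Lp.coeFn_sub (U s g - U t g) ((s - t) • U t g₁),
    Lp.coeFn_sub (U s g) (U t g), Lp.coeFn_smul (s - t) (U t g₁)] with ξ e1 e2 e3 e4 e5 e6 e7 e8
  rw [e6, Pi.sub_apply, e7, Pi.sub_apply, e8, Pi.smul_apply, e3, e4, e5, e1, e2]
  set a : ℝ := 4 * Real.pi ^ 2 * ξ ^ 2 with ha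
  have hp : phase s ξ = phase t ξ * Complex.exp (((s - t) * a : ℝ) * Complex.I) := by
    rw [phase, phase, ← Complex.exp_add]
    congr 1
    rw [ha]; push_cast; ring
  have : phase s ξ * g ξ - phase t ξ * g ξ - (s - t) • (phase t ξ * (a * Complex.I * g ξ)) =
      phase t ξ * (Complex.exp (((s - t) * a : ℝ) * Complex.I) - 1 - ((s - t) * a : ℝ) * Complex.I)
        * g ξ := by
    rw [hp, Complex.real_smul]; push_cast; ring
  rw [this, norm_mul, norm_mul, norm_phase, one_mul, norm_mul, Complex.norm_real,
    Real.norm_of_nonneg (by positivity)]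
  have := norm_exp_I_sub_le ((s - t) * a)
  calc _ ≤ 2 * ((s - t) * a) ^ 2 * ‖g ξ‖ := by gcongr
    _ = _ := by ring

lemma fourierInv_dS_dS (φ : 𝓢(ℝ, ℂ)) (ξ : ℝ) :
    (𝓕⁻ (dS (dS φ)) : 𝓢(ℝ, ℂ)) ξ = -(4 * Real.pi ^ 2 * ξ ^ 2 : ℝ) * (𝓕⁻ φ : 𝓢(ℝ, ℂ)) ξ := by
  rw [fourierInv_dS, fourierInv_dS]
  have := Complex.I_sq
  push_cast
  linear_combination (4 * Real.pi ^ 2 * ξ ^ 2) * (𝓕⁻ φ : 𝓢(ℝ, ℂ)) ξ * this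

lemma dualS_ae (φ : 𝓢(ℝ, ℂ)) :
    dualS φ =ᵐ[volume] fun ξ => invWeight ξ * (𝓕⁻ φ : 𝓢(ℝ, ℂ)) ξ := by
  filter_upwards [mulOp_ae invWeight memLp_invWeight (toL2 (𝓕⁻ φ)), toL2_ae (𝓕⁻ φ)] with ξ h1 h2
  rw [dualS, h1, h2]

lemma hasDerivAt_U_dualS (φ : 𝓢(ℝ, ℂ)) (t : ℝ) :
    HasDerivAt (fun s => U s (dualS φ)) (U t (-Complex.I • dualS (dS (dS φ)))) t := by
  refine hasDerivAt_U (g₂ := dualS (dS (dS (dS (dS φ))))) ?_ ?_ t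
  · filter_upwards [dualS_ae φ, dualS_ae (dS (dS φ)), Lp.coeFn_smul (-Complex.I) (dualS (dS (dS φ)))]
      with ξ h1 h2 h3
    rw [h3, Pi.smul_apply, h2, h1, fourierInv_dS_dS, smul_eq_mul]
    ring
  · filter_upwards [dualS_ae φ, dualS_ae (dS (dS (dS (dS φ))))] with ξ h1 h2
    rw [h2, h1, fourierInv_dS_dS, fourierInv_dS_dS]
    push_cast
    ring

/-- Strong continuity: orbits of Schwartz functions are differentiable, and since U t is isometric
they approximate the orbit of g uniformly in t. -/
lemma continuous_U_apply (g : L2) : Continuous (fun t => U t g) := by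
  refine continuous_of_uniform_approx_of_continuous fun u hu => ?_
  obtain ⟨ε, hε, hu⟩ := Metric.mem_uniformity_dist.1 hu
  obtain ⟨_, ⟨φ, rfl⟩, hφ⟩ := Metric.dense_iff.1 denseRange_toL2 g ε hε |>.imp
    fun x hx => And.intro hx.2 hx.1
  refine ⟨fun t => U t (toL2 φ), ?_, fun t => hu ?_⟩
  · have h := fun t => hasDerivAt_U (g := toL2 φ)
      (g₁ := (4 * Real.pi ^ 2 * Complex.I : ℂ) • toL2 (xS (xS φ)))
      (g₂ := (16 * Real.pi ^ 4 : ℂ) • toL2 (xS (xS (xS (xS φ))))) (by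
        filter_upwards [toL2_ae φ, toL2_ae (xS (xS φ)),
          Lp.coeFn_smul (4 * Real.pi ^ 2 * Complex.I : ℂ) (toL2 (xS (xS φ)))] with ξ h1 h2 h3
        rw [h3, Pi.smul_apply, h2, h1]
        simp only [xS_apply, smul_eq_mul]
        push_cast; ring) (by
        filter_upwards [toL2_ae φ, toL2_ae (xS (xS (xS (xS φ)))),
          Lp.coeFn_smul (16 * Real.pi ^ 4 : ℂ) (toL2 (xS (xS (xS (xS φ)))))] with ξ h1 h2 h3
        rw [h3, Pi.smul_apply, h2, h1]
        simp only [xS_apply, smul_eq_mul]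
        push_cast; ring) t
    exact continuous_iff_continuousAt.2 fun t => (h t).continuousAt
  · rw [dist_eq_norm, ← map_sub, norm_U, ← dist_eq_norm, dist_comm]
    exact Metric.mem_ball.1 hφ

lemma continuous_U : Continuous (fun p : ℝ × L2 => U p.1 p.2) := by
  rw [continuous_iff_continuousAt]
  rintro ⟨t, g⟩
  have h1 : Tendsto (fun p : ℝ × L2 => U p.1 (p.2 - g)) (𝓝 (t, g)) (𝓝 0) := by
    rw [tendsto_zero_iff_norm_tendsto_zero]
    simp only [norm_U]
    have : Continuous fun p : ℝ × L2 => ‖p.2 - g‖ := by fun_prop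
    simpa using this.tendsto (t, g)
  have h2 : Tendsto (fun p : ℝ × L2 => U p.1 g) (𝓝 (t, g)) (𝓝 (U t g)) :=
    ((continuous_U_apply g).comp continuous_fst).tendsto (t, g)
  have h3 := h1.add h2
  simp only [map_sub, sub_add_cancel, zero_add] at h3
  exact h3

/-! ### Weak and strong solutions -/

/-- Product rule in which A is only weakly differentiable, and only against the frozen vector B t.
The increment of B is strongly differentiable, so continuity of A suffices for its term. -/
lemma hasDerivWithinAt_pair {A B : ℝ → L2} {d : ℂ} {B' : L2} {S : Set ℝ} {t : ℝ}
    (h : HasDerivWithinAt (fun s => pair (A s) (B t)) d S t) (hA : ContinuousWithinAt A S t)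
    (hB : HasDerivWithinAt B B' S t) :
    HasDerivWithinAt (fun s => pair (A s) (B s)) (d + pair (A t) B') S t := by
  have h1 : HasDerivWithinAt (fun s => pair (A s) (B s - B t)) (pair (A t) B') S t := by
    rw [hasDerivWithinAt_iff_tendsto_slope] at hB ⊢
    have h2 : Tendsto A (𝓝[S \ {t}] t) (𝓝 (A t)) := hA.tendsto.mono_left (nhdsWithin_mono _ sdiff_subset)
    have h3 := (pair.continuous₂.tendsto (A t, B')).comp (h2.prodMk_nhds hB)
    refine h3.congr fun s => ?_
    simp [slope, vsub_eq_sub]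
  exact (h.add h1).congr (fun s _ => by simp) (by simp)

lemma hasDerivWithinAt_pair_left {A : ℝ → L2} {A' : L2} {S : Set ℝ} {t : ℝ}
    (hA : HasDerivWithinAt A A' S t) (g : L2) :
    HasDerivWithinAt (fun s => pair (A s) g) (pair A' g) S t :=
  ((pair.flip g).hasFDerivAt.restrictScalars ℝ).comp_hasDerivWithinAt t hA

/-- `i ∂_t w - ∂_x² w = F` weakly on `[-T, T]`, for `w = J W` and `F` replaced by `J F`. -/
def WeakSol (T : ℝ) (W F : ℝ → L2) : Prop :=
  ∀ φ : 𝓢(ℝ, ℂ), ∀ t ∈ Icc (-T) T,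
    HasDerivWithinAt (fun s => pair (J (W s)) (toL2 φ))
      (-Complex.I * (pair (J (F t)) (toL2 φ) + pair (J (W t)) (toL2 (dS (dS φ))))) (Icc (-T) T) t

lemma weakSol_of_hasDerivWithinAt {T : ℝ} {z F : ℝ → L2}
    (h : ∀ t ∈ Icc (-T) T, HasDerivWithinAt z (U (-t) (-Complex.I • F t)) (Icc (-T) T) t) :
    WeakSol T (fun t => U t (z t)) F := by
  intro φ t ht
  have h1 : HasDerivWithinAt (fun s => pair (z s) (U t (dualS φ)))
      (pair (U (-t) (-Complex.I • F t)) (U t (dualS φ))) (Icc (-T) T) t :=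
    hasDerivWithinAt_pair_left (h t ht) _
  have h2 := hasDerivWithinAt_pair (B := fun s => U s (dualS φ)) h1 (h t ht).continuousWithinAt
    (hasDerivAt_U_dualS φ t).hasDerivWithinAt
  simp only [pair_J_toL2]
  refine (h2.congr_of_mem (fun s _ => ?_) ht).congr_deriv ?_
  · rw [pair_U]
  · rw [pair_U (-t), U_neg_U, pair_U]
    simp only [map_smul, smul_apply, smul_eq_mul]
    ring

/-- The Schwartz function whose inverse Fourier transform is `e^{4π² i t ξ²} ψ`. -/
def phaseS (ψ : ℝ → ℝ) (hψ : ContDiff ℝ ((⊤ : ℕ∞) : WithTop ℕ∞) ψ) (hc : HasCompactSupport ψ) (t : ℝ) :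
    𝓢(ℝ, ℂ) :=
  𝓕 (HasCompactSupport.toSchwartzMap (f := fun ξ => phase t ξ * (ψ ξ : ℂ))
    ((hc.comp_left (g := Complex.ofReal) (by simp)).mul_left) (by
      refine ContDiff.mul ?_ (Complex.ofRealCLM.contDiff.comp hψ)
      unfold phase
      refine ContDiff.cexp (ContDiff.mul (Complex.ofRealCLM.contDiff.comp ?_) contDiff_const)
      exact contDiff_const.mul (contDiff_id.pow 2)))

lemma fourierInv_phaseS (ψ : ℝ → ℝ) (hψ : ContDiff ℝ ((⊤ : ℕ∞) : WithTop ℕ∞) ψ)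
    (hc : HasCompactSupport ψ) (t ξ : ℝ) :
    (𝓕⁻ (phaseS ψ hψ hc t) : 𝓢(ℝ, ℂ)) ξ = phase t ξ * ψ ξ := by
  rw [phaseS, FourierTransform.fourierInv_fourier_eq]
  rfl

/-- With ψ compactly supported, ψ times the phase is again a test function. So the propagator stays
within the Schwartz functions allowed in `WeakSol`. -/
lemma U_dualS_phaseS (ψ : ℝ → ℝ) (hψ : ContDiff ℝ ((⊤ : ℕ∞) : WithTop ℕ∞) ψ)
    (hc : HasCompactSupport ψ) (t : ℝ) :
    U t (dualS (phaseS ψ hψ hc 0)) = dualS (phaseS ψ hψ hc t) := by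
  apply Lp.ext
  filter_upwards [U_ae t (dualS (phaseS ψ hψ hc 0)), dualS_ae (phaseS ψ hψ hc 0),
    dualS_ae (phaseS ψ hψ hc t)] with ξ h1 h2 h3
  rw [h1, h2, h3, fourierInv_phaseS, fourierInv_phaseS]
  simp [phase]; ring

lemma U_dualS_dS_phaseS (ψ : ℝ → ℝ) (hψ : ContDiff ℝ ((⊤ : ℕ∞) : WithTop ℕ∞) ψ)
    (hc : HasCompactSupport ψ) (t : ℝ) :
    U t (dualS (dS (dS (phaseS ψ hψ hc 0)))) = dualS (dS (dS (phaseS ψ hψ hc t))) := by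
  apply Lp.ext
  filter_upwards [U_ae t (dualS (dS (dS (phaseS ψ hψ hc 0)))), dualS_ae (dS (dS (phaseS ψ hψ hc 0))),
    dualS_ae (dS (dS (phaseS ψ hψ hc t)))] with ξ h1 h2 h3
  rw [h1, h2, h3, fourierInv_dS_dS, fourierInv_dS_dS, fourierInv_phaseS, fourierInv_phaseS]
  simp [phase]; ring

lemma eq_of_pair_phaseS_eq (f g : L2) (h : ∀ ψ hψ hc, pair f (dualS (phaseS ψ hψ hc 0)) =
    pair g (dualS (phaseS ψ hψ hc 0))) : f = g := by
  have hloc : LocallyIntegrable (fun ξ : ℝ => invWeight ξ * (f - g : L2) ξ) volume := by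
    have h1 : LocallyIntegrable ((f - g : L2) : ℝ → ℂ) volume :=
      (Lp.memLp (f - g)).locallyIntegrable (by norm_num)
    rw [← locallyIntegrableOn_univ] at h1 ⊢
    exact h1.continuousOn_mul continuous_invWeight.continuousOn isClosed_univ.isLocallyClosed
  have h0 := ae_eq_zero_of_integral_contDiff_smul_eq_zero hloc (fun ψ hψ hc => by
    have h1 : pair (f - g) (dualS (phaseS ψ hψ hc 0)) = 0 := by
      rw [map_sub, sub_apply, h, sub_self]
    rw [pair_eq] at h1
    rw [← h1]
    apply integral_congr_ae
    filter_upwards [dualS_ae (phaseS ψ hψ hc 0)] with ξ h2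
    rw [h2, fourierInv_phaseS]
    simp [phase]; ring)
  have : f - g = 0 := by
    apply (Lp.eq_zero_iff_ae_eq_zero).2
    filter_upwards [h0] with ξ h1
    exact (mul_eq_zero.1 h1).resolve_left (inv_ne_zero (one_add_abs_ne ξ))
  exact sub_eq_zero.1 this

lemma hasDerivWithinAt_pair_of_weakSol {T : ℝ} {W F : ℝ → L2} (h : WeakSol T W F)
    {s : ℝ} (hs : s ∈ Icc (-T) T) (hW : ContinuousWithinAt W (Icc (-T) T) s)
    (ψ : ℝ → ℝ) (hψ : ContDiff ℝ ((⊤ : ℕ∞) : WithTop ℕ∞) ψ) (hc : HasCompactSupport ψ) :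
    HasDerivWithinAt (fun r => pair (U (-r) (W r)) (dualS (phaseS ψ hψ hc 0)))
      (pair (U (-s) (-Complex.I • F s)) (dualS (phaseS ψ hψ hc 0))) (Icc (-T) T) s := by
  have h1 : HasDerivWithinAt (fun r => pair (W r) (U (-s) (dualS (phaseS ψ hψ hc 0))))
      (-Complex.I * (pair (F s) (dualS (phaseS ψ hψ hc (-s))) +
        pair (W s) (dualS (dS (dS (phaseS ψ hψ hc (-s))))))) (Icc (-T) T) s := by
    have := h (phaseS ψ hψ hc (-s)) s hs
    simp only [pair_J_toL2] at this
    rw [U_dualS_phaseS]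
    exact this
  have h2 : HasDerivAt (fun r => U (-r) (dualS (phaseS ψ hψ hc 0)))
      (-(U (-s) (-Complex.I • dualS (dS (dS (phaseS ψ hψ hc 0)))))) s := by
    have := (hasDerivAt_U_dualS (phaseS ψ hψ hc 0) (-s)).scomp s (hasDerivAt_neg s)
    rw [neg_one_smul] at this
    exact this
  have h3 := hasDerivWithinAt_pair (B := fun r => U (-r) (dualS (phaseS ψ hψ hc 0))) h1
    hW h2.hasDerivWithinAt
  refine (h3.congr_of_mem (fun r _ => ?_) hs).congr_deriv ?_
  · rw [pair_U]
  · rw [← U_dualS_phaseS, ← U_dualS_dS_phaseS]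
    simp only [map_smul, pair_U, map_neg, smul_apply, smul_eq_mul]
    ring

lemma exists_primitive {E : Type*} [NormedAddCommGroup E] [NormedSpace ℝ E] [CompleteSpace E]
    {T : ℝ} (hT : 0 < T) {G : ℝ → E} (hG : ContinuousOn G (Icc (-T) T)) (y₀ : E) :
    ∃ y : ℝ → E, y 0 = y₀ ∧ ∀ t ∈ Icc (-T) T, HasDerivWithinAt y (G t) (Icc (-T) T) t := by
  have hT' : -T ≤ T := by linarith
  have hc : Continuous (IccExtend hT' ((Icc (-T) T).domRestrict G)) := hG.domRestrict.Icc_extend'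
  refine ⟨fun t => y₀ + ∫ s in (0 : ℝ)..t, IccExtend hT' ((Icc (-T) T).domRestrict G) s, by simp,
    fun t ht => ?_⟩
  have h := (intervalIntegral.integral_hasDerivAt_right (hc.intervalIntegrable 0 t)
      (hc.stronglyMeasurableAtFilter _ _) hc.continuousAt).const_add y₀
  rw [IccExtend_of_mem _ _ ht] at h
  exact h.hasDerivWithinAt

/-- Uniqueness for the free equation with forcing: U(-t) W and the primitive of the forcing agree at
0, and their difference, tested against each `phaseS` vector, has zero derivative. -/
lemma hasDerivWithinAt_of_weakSol {T : ℝ} (hT : 0 < T) {W F : ℝ → L2} (hW : ContinuousOn W (Icc (-T) T))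
    (hF : ContinuousOn F (Icc (-T) T)) (h : WeakSol T W F) :
    ∀ t ∈ Icc (-T) T, HasDerivWithinAt (fun s => U (-s) (W s)) (U (-t) (-Complex.I • F t))
      (Icc (-T) T) t := by
  have hGc : ContinuousOn (fun t => U (-t) (-Complex.I • F t)) (Icc (-T) T) :=
    continuous_U.comp_continuousOn (f := fun t => (-t, -Complex.I • F t))
      (continuousOn_id.neg.prodMk (hF.const_smul (-Complex.I)))
  obtain ⟨y, hy0, hy⟩ := exists_primitive hT hGc (W 0)
  have key : ∀ t ∈ Icc (-T) T, U (-t) (W t) = y t := by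
    intro t ht
    refine eq_of_pair_phaseS_eq _ _ fun ψ hψ hc => ?_
    have hd : ∀ s ∈ Icc (-T) T, HasDerivWithinAt (fun r => pair (U (-r) (W r))
        (dualS (phaseS ψ hψ hc 0)) - pair (y r) (dualS (phaseS ψ hψ hc 0))) 0 (Icc (-T) T) s := by
      intro s hs
      have h3 := hasDerivWithinAt_pair_of_weakSol h hs (hW s hs) ψ hψ hc
      have h4 := hasDerivWithinAt_pair_left (hy s hs) (dualS (phaseS ψ hψ hc 0))
      exact (h3.sub h4).congr_deriv (sub_self _)
    have h0 : (0 : ℝ) ∈ Icc (-T) T := ⟨by linarith, hT.le⟩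
    have h5 := (convex_Icc (-T) T).norm_image_sub_le_of_norm_hasDerivWithin_le (C := 0)
      hd (fun s _ => by simp) h0 ht
    rw [zero_mul, neg_zero, U_zero, hy0, sub_self, sub_zero, norm_le_zero_iff] at h5
    exact sub_eq_zero.1 h5
  intro t ht
  exact (hy t ht).congr_of_mem key ht

end

/-! ### The ground state, its decay and its dilations -/

noncomputable section

/-! ### The ground state as a Schwartz function -/

lemma hasDerivAt_inv_cosh (x : ℝ) :
    HasDerivAt (fun x => (Real.cosh x)⁻¹) (-((Real.cosh x)⁻¹ * (Real.sinh x / Real.cosh x))) x := by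
  have h := (Real.hasDerivAt_cosh x).inv (Real.cosh_pos x).ne'
  refine h.congr_deriv ?_
  have := (Real.cosh_pos x).ne'
  field_simp

lemma hasDerivAt_sinh_div_cosh (x : ℝ) :
    HasDerivAt (fun x => Real.sinh x / Real.cosh x) (1 - (Real.sinh x / Real.cosh x) ^ 2) x := by
  have h := (Real.hasDerivAt_sinh x).div (Real.hasDerivAt_cosh x) (Real.cosh_pos x).ne'
  refine h.congr_deriv ?_
  have := (Real.cosh_pos x).ne'
  field_simp

/-- Both sech and tanh have derivatives polynomial in themselves. As |tanh| ≤ 1, every derivative of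
sech is bounded by a multiple of sech, which gives the Schwartz decay. -/
lemma iteratedDeriv_inv_cosh (n : ℕ) : ∃ p : Polynomial ℝ,
    iteratedDeriv n (fun x => (Real.cosh x)⁻¹) =
      fun x => (Real.cosh x)⁻¹ * p.eval (Real.sinh x / Real.cosh x) := by
  induction n with
  | zero => exact ⟨1, by simp⟩
  | succ n ih =>
    obtain ⟨p, hp⟩ := ih
    refine ⟨-Polynomial.X * p + (1 - Polynomial.X ^ 2) * Polynomial.derivative p, ?_⟩
    rw [iteratedDeriv_succ, hp]
    ext x
    have h := (hasDerivAt_inv_cosh x).mul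
      ((p.hasDerivAt (Real.sinh x / Real.cosh x)).comp x (hasDerivAt_sinh_div_cosh x))
    have h' := h.deriv
    simp only [Polynomial.eval_add, Polynomial.eval_mul, Polynomial.eval_neg, Polynomial.eval_X,
      Polynomial.eval_sub, Polynomial.eval_one, Polynomial.eval_pow]
    refine h'.trans ?_
    simp only [Function.comp_apply]
    ring

lemma pow_mul_inv_cosh_le (k : ℕ) (x : ℝ) : |x| ^ k * (Real.cosh x)⁻¹ ≤ 2 * k.factorial := by
  have h1 := Real.pow_div_factorial_le_exp |x| (abs_nonneg x) k
  have h2 : Real.exp |x| ≤ 2 * Real.cosh x := by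
    rw [← Real.cosh_abs, Real.cosh_eq]
    linarith [Real.exp_pos (-|x|)]
  rw [← div_eq_mul_inv, div_le_iff₀ (Real.cosh_pos x)]
  rw [div_le_iff₀ (by positivity)] at h1
  nlinarith [(Nat.cast_pos (α := ℝ)).2 k.factorial_pos]

/-- `1 / cosh` as a Schwartz function. -/
def invCoshS : 𝓢(ℝ, ℝ) where
  toFun x := (Real.cosh x)⁻¹
  smooth' := Real.contDiff_cosh.inv fun x => (Real.cosh_pos x).ne'
  decay' k n := by
    obtain ⟨p, hp⟩ := iteratedDeriv_inv_cosh n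
    obtain ⟨M, hM⟩ := (isCompact_Icc (a := (-1 : ℝ)) (b := 1)).exists_bound_of_continuousOn
      (f := fun t => p.eval t) p.continuous.continuousOn
    refine ⟨2 * k.factorial * M, fun x => ?_⟩
    rw [norm_iteratedFDeriv_eq_norm_iteratedDeriv, hp, norm_mul, Real.norm_eq_abs x,
      Real.norm_of_nonneg (inv_nonneg.2 (Real.cosh_pos x).le), ← mul_assoc]
    have h1 := pow_mul_inv_cosh_le k x
    have h2 : ‖p.eval (Real.sinh x / Real.cosh x)‖ ≤ M := by
      apply hM
      have hc := Real.cosh_pos x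
      have h3 : |Real.sinh x| ≤ Real.cosh x :=
        abs_le_of_sq_le_sq (by linarith [Real.cosh_sq x]) hc.le
      rw [mem_Icc, le_div_iff₀ hc, div_le_iff₀ hc]
      constructor <;> linarith [abs_le.1 h3]
    gcongr

/-- The ground state `Q` as a complex Schwartz function. -/
def qS : 𝓢(ℝ, ℂ) := ((√2 : ℝ) : ℂ) • SchwartzMap.postcompCLM Complex.ofRealCLM invCoshS

lemma groundState_eq (α x : ℝ) : groundState α x = α * (√2 * (Real.cosh (α * x))⁻¹) := by
  have h := Real.exp_pos (α * x)
  have h' := Real.exp_pos (-(α * x))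
  rw [groundState, Real.cosh_eq]
  field_simp

lemma Q_eq (x : ℝ) : Q x = √2 * (Real.cosh x)⁻¹ := by
  rw [Q, groundState_eq, one_mul, one_mul]

lemma groundState_eq_Q (α x : ℝ) : groundState α x = α * Q (α * x) := by
  rw [groundState_eq, Q_eq]

@[simp] lemma qS_apply (x : ℝ) : qS x = (Q x : ℂ) := by
  rw [Q_eq, Complex.ofReal_mul]
  rfl

lemma hasDerivAt_Q (x : ℝ) : HasDerivAt Q (-(Q x * (Real.sinh x / Real.cosh x))) x := by
  have h := (hasDerivAt_inv_cosh x).const_mul (√2)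
  have : Q = fun x => √2 * (Real.cosh x)⁻¹ := funext Q_eq
  rw [Q_eq, this]
  exact h.congr_deriv (by ring)

lemma dxQ_eq (x : ℝ) : dxQ x = -(Q x * (Real.sinh x / Real.cosh x)) := (hasDerivAt_Q x).deriv

lemma hasDerivAt_Q' (x : ℝ) : HasDerivAt Q (dxQ x) x := by rw [dxQ_eq]; exact hasDerivAt_Q x

lemma hasDerivAt_dxQ (x : ℝ) : HasDerivAt dxQ (Q x - Q x ^ 3) x := by
  have h := ((hasDerivAt_Q x).mul (hasDerivAt_sinh_div_cosh x)).neg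
  have h2 : dxQ = fun x => -(Q x * (Real.sinh x / Real.cosh x)) := funext dxQ_eq
  rw [h2]
  refine h.congr_deriv ?_
  rw [Q_eq]
  have hc := (Real.cosh_pos x).ne'
  have h3 : (√2) ^ 2 = 2 := Real.sq_sqrt (by norm_num)
  have h4 := Real.cosh_sq x
  field_simp
  rw [h3]
  linarith

@[simp] lemma dS_qS_apply (x : ℝ) : dS qS x = (dxQ x : ℂ) := by
  rw [dS_apply, show (qS : ℝ → ℂ) = fun x => (Q x : ℂ) from funext qS_apply]
  exact (hasDerivAt_Q' x).ofReal_comp.deriv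

lemma dS_dS_qS_apply (x : ℝ) : dS (dS qS) x = (Q x : ℂ) - (Q x : ℂ) ^ 3 := by
  rw [dS_apply, show (dS qS : ℝ → ℂ) = fun x => (dxQ x : ℂ) from funext dS_qS_apply]
  rw [(hasDerivAt_dxQ x).ofReal_comp.deriv]
  push_cast; rfl

lemma dS_dS_dS_qS_apply (x : ℝ) :
    dS (dS (dS qS)) x = (dxQ x : ℂ) - 3 * (Q x : ℂ) ^ 2 * (dxQ x : ℂ) := by
  rw [dS_apply, show (dS (dS qS) : ℝ → ℂ) = fun x => ((Q x - Q x ^ 3 : ℝ) : ℂ) from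
    funext fun x => by rw [dS_dS_qS_apply]; push_cast; rfl]
  have h := ((hasDerivAt_Q' x).sub ((hasDerivAt_Q' x).pow 3)).ofReal_comp.deriv
  refine Eq.trans h ?_
  push_cast
  ring

lemma Q_neg (x : ℝ) : Q (-x) = Q x := by simp [Q_eq]

lemma dxQ_neg (x : ℝ) : dxQ (-x) = -dxQ x := by
  simp only [dxQ_eq, Q_neg, Real.sinh_neg, Real.cosh_neg]; ring

/-! ### Dilations -/

/-- The generator `x ∂_x` of dilations. -/
def eulerS : 𝓢(ℝ, ℂ) →L[ℂ] 𝓢(ℝ, ℂ) := xS ∘L dS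

@[simp] lemma eulerS_apply (f : 𝓢(ℝ, ℂ)) (x : ℝ) : eulerS f x = x * dS f x := xS_apply _ _

lemma dS_xS (f : 𝓢(ℝ, ℂ)) : dS (xS f) = f + xS (dS f) := by
  ext x
  have h := (Complex.ofRealCLM.hasDerivAt (x := x)).mul (hasDerivAt_schwartz f x)
  rw [dS_apply, show (xS f : ℝ → ℂ) = fun x : ℝ => (x : ℂ) * f x from funext (xS_apply f), add_apply,
    xS_apply]
  refine Eq.trans h.deriv ?_
  simp

/-- The dilation `f ↦ f (α ·)`, for `α ≠ 0`. -/
def dil (α : ℝ) : 𝓢(ℝ, ℂ) →L[ℂ] 𝓢(ℝ, ℂ) :=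
  if h : α ≠ 0 then SchwartzMap.compCLMOfContinuousLinearEquiv ℂ
    (ContinuousLinearEquiv.unitsEquivAut ℝ (Units.mk0 α h)) else 0

lemma dil_apply {α : ℝ} (h : 0 < α) (f : 𝓢(ℝ, ℂ)) (x : ℝ) : dil α f x = f (α * x) := by
  rw [dil, dif_pos h.ne', mul_comm]; rfl

lemma dil_one (f : 𝓢(ℝ, ℂ)) : dil 1 f = f := by
  ext x; rw [dil_apply one_pos, one_mul]

lemma dS_dil {α : ℝ} (h : 0 < α) (f : 𝓢(ℝ, ℂ)) : dS (dil α f) = (α : ℂ) • dil α (dS f) := by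
  ext x
  have h1 : HasDerivAt (fun x => f (α * x)) ((α : ℂ) * dS f (α * x)) x := by
    have := (hasDerivAt_schwartz f (α * x)).scomp x ((hasDerivAt_id x).const_mul α)
    exact this.congr_deriv (by simp)
  rw [dS_apply, show (dil α f : ℝ → ℂ) = fun x => f (α * x) from funext (dil_apply h f), h1.deriv,
    smul_apply, dil_apply h, smul_eq_mul]

/-- Domination uniform in the dilation parameter by ⟨x⟩⁻¹ ∈ L²; it turns pointwise Taylor remainders
in γ into L² remainders. -/
lemma exists_bound_weight (f : 𝓢(ℝ, ℂ)) (k : ℕ) {a : ℝ} (ha : 0 < a) :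
    ∃ C, 0 ≤ C ∧ ∀ γ, a ≤ γ → ∀ x : ℝ, |x| ^ k * ‖f (γ * x)‖ ≤ C * ‖invWeight x‖ := by
  obtain ⟨C₁, h1⟩ := f.decay k 0
  obtain ⟨C₂, h2⟩ := f.decay (k + 1) 0
  refine ⟨C₁ / a ^ k + C₂ / a ^ (k + 1), ?_, fun γ hγ x => ?_⟩
  · have := h1.1; have := h2.1; positivity
  · have e1 := h1.2 (γ * x)
    have e2 := h2.2 (γ * x)
    rw [norm_iteratedFDeriv_zero, Real.norm_eq_abs, abs_mul, abs_of_pos (ha.trans_le hγ)] at e1 e2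
    rw [norm_invWeight, ← div_eq_mul_inv, le_div_iff₀ (one_add_abs_pos x)]
    have e3 : |x| ^ k * ‖f (γ * x)‖ ≤ C₁ / a ^ k := by
      rw [le_div_iff₀ (by positivity)]
      refine le_trans ?_ e1
      rw [mul_pow]
      have : a ^ k ≤ γ ^ k := by gcongr
      calc _ = a ^ k * (|x| ^ k * ‖f (γ * x)‖) := by ring
        _ ≤ γ ^ k * (|x| ^ k * ‖f (γ * x)‖) := by gcongr
        _ = _ := by ring
    have e4 : |x| ^ (k + 1) * ‖f (γ * x)‖ ≤ C₂ / a ^ (k + 1) := by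
      rw [le_div_iff₀ (by positivity)]
      refine le_trans ?_ e2
      rw [mul_pow]
      have : a ^ (k + 1) ≤ γ ^ (k + 1) := by gcongr
      calc _ = a ^ (k + 1) * (|x| ^ (k + 1) * ‖f (γ * x)‖) := by ring
        _ ≤ γ ^ (k + 1) * (|x| ^ (k + 1) * ‖f (γ * x)‖) := by gcongr
        _ = _ := by ring
    calc _ = |x| ^ k * ‖f (γ * x)‖ + |x| ^ (k + 1) * ‖f (γ * x)‖ := by ring
      _ ≤ _ := add_le_add e3 e4

lemma norm_taylor_le {h h' h'' : ℝ → ℂ} (hh : ∀ γ, HasDerivAt h (h' γ) γ)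
    (hh' : ∀ γ, HasDerivAt h' (h'' γ) γ) {S : Set ℝ} (hS : Convex ℝ S) {M : ℝ}
    (hM : ∀ γ ∈ S, ‖h'' γ‖ ≤ M) {α β : ℝ} (hα : α ∈ S) (hβ : β ∈ S) :
    ‖h β - h α - (β - α) • h' α‖ ≤ M * (β - α) ^ 2 := by
  have hsub : segment ℝ α β ⊆ S := hS.segment_subset hα hβ
  have h1 : ∀ γ ∈ segment ℝ α β, HasDerivWithinAt (fun γ => h γ - (γ - α) • h' α) (h' γ - h' α)
      (segment ℝ α β) γ := by
    intro γ _
    have := (hh γ).sub (((hasDerivAt_id γ).sub_const α).smul_const (h' α))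
    simp only [one_smul] at this
    exact this.hasDerivWithinAt
  have hM0 : 0 ≤ M := (norm_nonneg _).trans (hM α hα)
  have h2 : ∀ γ ∈ segment ℝ α β, ‖h' γ - h' α‖ ≤ M * |β - α| := by
    intro γ hγ
    have := hS.norm_image_sub_le_of_norm_hasDerivWithin_le
      (fun γ _ => (hh' γ).hasDerivWithinAt) hM hα (hsub hγ)
    refine this.trans ?_
    gcongr
    rw [Real.norm_eq_abs]
    have := norm_sub_le_of_mem_segment hγ
    simpa [Real.norm_eq_abs, abs_sub_comm] using this
  have h3 := (convex_segment α β).norm_image_sub_le_of_norm_hasDerivWithin_le h1 h2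
    (left_mem_segment ℝ α β) (right_mem_segment ℝ α β)
  simp only [sub_self, zero_smul, sub_zero] at h3
  rw [sub_right_comm]
  refine h3.trans (le_of_eq ?_)
  rw [Real.norm_eq_abs, mul_assoc, ← sq, sq_abs]

lemma hasDerivAt_dil (f : 𝓢(ℝ, ℂ)) {α : ℝ} (hα : 0 < α) :
    HasDerivAt (fun β => toL2 (dil β f)) (toL2 ((α⁻¹ : ℂ) • dil α (eulerS f))) α := by
  -- The second derivative of γ ↦ f(γx) is x² f''(γx), hence the weight 2. Staying above α/2 keeps γ
  -- away from 0.
  obtain ⟨C, hC0, hC⟩ := exists_bound_weight (dS (dS f)) 2 (half_pos hα)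
  refine hasDerivAt_of_norm_le_sq (C := C * ‖memLp_invWeight_two.toLp invWeight‖) (half_pos hα)
    fun β hβ => ?_
  have hβ' : α / 2 ≤ β := by linarith [abs_le.1 hβ]
  have hβ0 : 0 < β := by linarith
  rw [show C * ‖memLp_invWeight_two.toLp invWeight‖ * (β - α) ^ 2 =
    (C * (β - α) ^ 2) * ‖memLp_invWeight_two.toLp invWeight‖ by ring]
  apply Lp.norm_le_mul_norm_of_ae_le_mul
  filter_upwards [memLp_invWeight_two.coeFn_toLp, toL2_ae (dil β f), toL2_ae (dil α f),
    toL2_ae ((α⁻¹ : ℂ) • dil α (eulerS f)),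
    Lp.coeFn_sub (toL2 (dil β f) - toL2 (dil α f)) ((β - α) • toL2 ((α⁻¹ : ℂ) • dil α (eulerS f))),
    Lp.coeFn_sub (toL2 (dil β f)) (toL2 (dil α f)),
    Lp.coeFn_smul (β - α) (toL2 ((α⁻¹ : ℂ) • dil α (eulerS f)))] with x e1 e2 e3 e4 e5 e6 e7
  rw [e5, Pi.sub_apply, e6, Pi.sub_apply, e7, Pi.smul_apply, e1, e2, e3, e4, dil_apply hβ0,
    dil_apply hα, smul_apply, dil_apply hα, eulerS_apply, smul_eq_mul]
  have k1 : ∀ (g : 𝓢(ℝ, ℂ)) (γ : ℝ), HasDerivAt (fun γ : ℝ => g (γ * x)) ((x : ℂ) * dS g (γ * x)) γ := by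
    intro g γ
    have := (hasDerivAt_schwartz g (γ * x)).scomp γ ((hasDerivAt_id γ).mul_const x)
    exact this.congr_deriv (by simp)
  have k2 := norm_taylor_le (h' := fun γ => (x : ℂ) * dS f (γ * x))
    (h'' := fun γ => (x : ℂ) * ((x : ℂ) * dS (dS f) (γ * x))) (k1 f)
    (fun γ => (k1 (dS f) γ).const_mul (x : ℂ)) (convex_Ici (α / 2)) (M := C * ‖invWeight x‖)
    (fun γ hγ => by
      have := hC γ hγ x
      rw [norm_mul, norm_mul, Complex.norm_real, Real.norm_eq_abs]
      calc _ = |x| ^ 2 * ‖dS (dS f) (γ * x)‖ := by ring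
        _ ≤ _ := this) (α := α) (β := β) (by simp; linarith) hβ'
  have hne : (α : ℂ) ≠ 0 := Complex.ofReal_ne_zero.2 hα.ne'
  have : (α : ℂ)⁻¹ * (((α * x : ℝ) : ℂ) * dS f (α * x)) = (x : ℂ) * dS f (α * x) := by
    push_cast; field_simp
  rw [this]
  refine k2.trans (le_of_eq ?_)
  ring

lemma continuousOn_dil (f : 𝓢(ℝ, ℂ)) : ContinuousOn (fun β => toL2 (dil β f)) (Ioi 0) :=
  fun _ hα => (hasDerivAt_dil f hα).continuousAt.continuousWithinAt

/-- The interval of admissible dilation parameters. -/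
abbrev dilI : Set ℝ := Icc (1 / 2) (3 / 2)

lemma pos_of_mem_dilI {α : ℝ} (h : α ∈ dilI) : 0 < α := by linarith [h.1]

lemma exists_norm_dil_le (f : 𝓢(ℝ, ℂ)) : ∃ C, ∀ α ∈ dilI, ‖toL2 (dil α f)‖ ≤ C :=
  isCompact_Icc.exists_bound_of_continuousOn
    ((continuousOn_dil f).mono fun _ h => pos_of_mem_dilI h)

lemma exists_lipschitz_dil (f : 𝓢(ℝ, ℂ)) : ∃ C, 0 ≤ C ∧ ∀ α ∈ dilI, ∀ β ∈ dilI,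
    ‖toL2 (dil α f) - toL2 (dil β f)‖ ≤ C * |α - β| := by
  obtain ⟨C, hC⟩ := exists_norm_dil_le (eulerS f)
  refine ⟨2 * |C|, by positivity, fun α hα β hβ => ?_⟩
  refine (convex_Icc (1 / 2) (3 / 2)).norm_image_sub_le_of_norm_hasDerivWithin_le
    (f := fun β => toL2 (dil β f))
    (fun γ hγ => (hasDerivAt_dil f (pos_of_mem_dilI hγ)).hasDerivWithinAt) (fun γ hγ => ?_) hβ hα
  rw [toL2_smul, norm_smul, norm_inv, Complex.norm_real, Real.norm_of_nonneg (pos_of_mem_dilI hγ).le]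
  have : γ⁻¹ ≤ 2 := by
    rw [inv_le_comm₀ (pos_of_mem_dilI hγ) (by norm_num)]; linarith [hγ.1]
  have h2 := hC γ hγ
  have := le_abs_self C
  gcongr
  linarith

lemma exists_lipschitz_iota_dil (f : 𝓢(ℝ, ℂ)) : ∃ C, 0 ≤ C ∧ ∀ α ∈ dilI, ∀ β ∈ dilI,
    ‖iota (dil α f) - iota (dil β f)‖ ≤ C * |α - β| := by
  obtain ⟨C₁, h1, hC₁⟩ := exists_lipschitz_dil f
  obtain ⟨C₂, h2, hC₂⟩ := exists_lipschitz_dil (dS f)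
  obtain ⟨C₃, hC₃⟩ := exists_norm_dil_le (dS f)
  refine ⟨C₁ + (2 * C₂ + |C₃|), by positivity, fun α hα β hβ => ?_⟩
  rw [← map_sub]
  refine (norm_iota_le _).trans ?_
  rw [add_mul, toL2_sub]
  refine add_le_add (hC₁ α hα β hβ) ?_
  rw [map_sub, dS_dil (pos_of_mem_dilI hα), dS_dil (pos_of_mem_dilI hβ), toL2_sub, toL2_smul,
    toL2_smul]
  have : (α : ℂ) • toL2 (dil α (dS f)) - (β : ℂ) • toL2 (dil β (dS f)) =
      (α : ℂ) • (toL2 (dil α (dS f)) - toL2 (dil β (dS f))) +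
        ((α - β : ℝ) : ℂ) • toL2 (dil β (dS f)) := by
    push_cast; module
  rw [this]
  refine (norm_add_le _ _).trans ?_
  rw [norm_smul, norm_smul, Complex.norm_real, Complex.norm_real, Real.norm_eq_abs, Real.norm_eq_abs,
    abs_of_pos (pos_of_mem_dilI hα), add_mul]
  have e1 := hC₂ α hα β hβ
  have e2 := (hC₃ β hβ).trans (le_abs_self C₃)
  have e3 : α ≤ 2 := by linarith [hα.2]
  have e4 : α * ‖toL2 (dil α (dS f)) - toL2 (dil β (dS f))‖ ≤ 2 * (C₂ * |α - β|) := by gcongr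
  have e5 : |α - β| * ‖toL2 (dil β (dS f))‖ ≤ |α - β| * |C₃| := by gcongr
  linarith

end

/-! ### The soliton family and the derivation of the modulation equations -/

noncomputable section

/-! ### The family `Q_α` -/

/-- The profile of `Q'_α`. -/
def qgS : 𝓢(ℝ, ℂ) := qS + eulerS qS

/-- `Q_α` as a Schwartz function. -/
def QS (α : ℝ) : 𝓢(ℝ, ℂ) := (α : ℂ) • dil α qS

/-- `∂_α Q_α` as a Schwartz function. -/
def QpS (α : ℝ) : 𝓢(ℝ, ℂ) := dil α qgS

/-- `∂_α² Q_α` as a Schwartz function. -/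
def QppS (α : ℝ) : 𝓢(ℝ, ℂ) := (α⁻¹ : ℂ) • dil α (eulerS qgS)

lemma hasDerivAt_QS {α : ℝ} (hα : 0 < α) :
    HasDerivAt (fun β => toL2 (QS β)) (toL2 (QpS α)) α := by
  have h1 : HasDerivAt (fun β : ℝ => (β : ℂ)) 1 α := Complex.ofRealCLM.hasDerivAt
  have h2 := h1.smul (hasDerivAt_dil qS hα)
  have h3 : (fun β => toL2 (QS β)) = fun β : ℝ => (β : ℂ) • toL2 (dil β qS) := by
    ext1 β; rw [QS, toL2_smul]
  rw [h3]
  refine h2.congr_deriv ?_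
  have hne : (α : ℂ) ≠ 0 := Complex.ofReal_ne_zero.2 hα.ne'
  rw [QpS, qgS, map_add, toL2_add, toL2_smul, smul_smul, mul_inv_cancel₀ hne, one_smul, one_smul,
    add_comm]

lemma hasDerivAt_QpS {α : ℝ} (hα : 0 < α) :
    HasDerivAt (fun β => toL2 (QpS β)) (toL2 (QppS α)) α := hasDerivAt_dil qgS hα

lemma QS_apply {α : ℝ} (hα : 0 < α) (x : ℝ) : QS α x = (groundState α x : ℂ) := by
  rw [QS, smul_apply, dil_apply hα, qS_apply, groundState_eq_Q, smul_eq_mul]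
  push_cast; rfl

lemma qgS_apply (x : ℝ) : qgS x = ((Q x + x * dxQ x : ℝ) : ℂ) := by
  rw [qgS, add_apply, eulerS_apply, dS_qS_apply, qS_apply]; push_cast; rfl

lemma groundStateDα_eq (α x : ℝ) : groundStateDα α x = Q (α * x) + (α * x) * dxQ (α * x) := by
  rw [groundStateDα, show (fun β => groundState β x) = fun β => β * Q (β * x) from
    funext fun β => groundState_eq_Q β x]
  have h := (hasDerivAt_id α).mul ((hasDerivAt_Q' (α * x)).comp α ((hasDerivAt_id α).mul_const x))
  refine Eq.trans h.deriv ?_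
  simp; ring

lemma QpS_apply {α : ℝ} (hα : 0 < α) (x : ℝ) : QpS α x = (groundStateDα α x : ℂ) := by
  rw [QpS, dil_apply hα, qgS_apply, groundStateDα_eq]

/-- The soliton equation, rescaled from Q'' = Q - Q³. -/
lemma dS_dS_QS_apply {α : ℝ} (hα : 0 < α) (x : ℝ) :
    dS (dS (QS α)) x = (α : ℂ) ^ 2 * QS α x - QS α x ^ 3 := by
  rw [QS, map_smul, dS_dil hα, map_smul, map_smul, dS_dil hα]
  simp only [smul_apply, dil_apply hα, dS_dS_qS_apply, qS_apply, smul_eq_mul]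
  ring

lemma dS_dS_qgS_apply (x : ℝ) : dS (dS qgS) x =
    qgS x + 2 * Q x - 3 * (Q x : ℂ) ^ 2 * qgS x := by
  have h : dS (dS qgS) = (3 : ℂ) • dS (dS qS) + xS (dS (dS (dS qS))) := by
    rw [qgS, eulerS, map_add, map_add, ContinuousLinearMap.comp_apply, dS_xS, map_add, dS_xS]
    module
  rw [h, add_apply, smul_apply, xS_apply, dS_dS_qS_apply, dS_dS_dS_qS_apply, qgS_apply, smul_eq_mul]
  push_cast
  ring

/-- The α-derivative of the soliton equation. Its term 2αQ_α places Q'_α in the generalized kernel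
rather than in the kernel. -/
lemma dS_dS_QpS_apply {α : ℝ} (hα : 0 < α) (x : ℝ) :
    dS (dS (QpS α)) x = (α : ℂ) ^ 2 * QpS α x + 2 * α * QS α x - 3 * QS α x ^ 2 * QpS α x := by
  rw [QS, QpS, dS_dil hα, map_smul, dS_dil hα]
  simp only [smul_apply, dil_apply hα, dS_dS_qgS_apply, qS_apply, smul_eq_mul]
  ring

/-! ### Real and even functions -/

lemma conj_QS {α : ℝ} (hα : 0 < α) (x : ℝ) : conj (QS α x) = QS α x := by
  rw [QS_apply hα, Complex.conj_ofReal]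

lemma conj_QpS {α : ℝ} (hα : 0 < α) (x : ℝ) : conj (QpS α x) = QpS α x := by
  rw [QpS_apply hα, Complex.conj_ofReal]

lemma groundState_neg (α x : ℝ) : groundState α (-x) = groundState α x := by
  rw [groundState_eq_Q, groundState_eq_Q, mul_neg, Q_neg]

lemma groundStateDα_neg (α x : ℝ) : groundStateDα α (-x) = groundStateDα α x := by
  rw [groundStateDα_eq, groundStateDα_eq, mul_neg, Q_neg, dxQ_neg]; ring

lemma pair_real {f g : 𝓢(ℝ, ℂ)} (hf : ∀ x, conj (f x) = f x) (hg : ∀ x, conj (g x) = g x) :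
    conj (pair (toL2 f) (toL2 g)) = pair (toL2 f) (toL2 g) := by
  rw [← pair_conjL2, conjL2_toL2, conjL2_toL2]
  congr 3
  · ext x; exact hf x
  · ext x; exact hg x

lemma pair_star {g : 𝓢(ℝ, ℂ)} (hg : ∀ x, conj (g x) = g x) (he : ∀ x, g (-x) = g x) (W : L2) :
    pair (J (conjL2 W)) (toL2 g) = conj (pair (J W) (toL2 g)) := by
  rw [J_conjL2]
  have : toL2 g = conjL2 (reflL2 (toL2 g)) := by
    rw [reflL2_toL2, conjL2_toL2]
    congr 1
    ext x
    rw [conjS_apply, reflS_apply, he, hg]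
  nth_rw 1 [this]
  rw [pair_conjL2, pair_reflL2]

/-- `½ ∫ Q²`. -/
def mQ : ℝ := (∫ x, Q x ^ 2) / 2

lemma integrable_Q_sq : Integrable (fun x => Q x ^ 2) := by
  have h := (integrable_mul_schwartz (toL2 qS) qS).re
  refine h.congr ?_
  filter_upwards [toL2_ae qS] with x hx
  rw [hx, qS_apply, ← Complex.ofReal_mul]
  simp [sq]

lemma mQ_pos : 0 < mQ := by
  refine div_pos ?_ two_pos
  have hpos : ∀ x, 0 < Q x ^ 2 := fun x => by
    rw [Q_eq]; have := Real.cosh_pos x; positivity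
  rw [integral_pos_iff_support_of_nonneg (fun x => (hpos x).le) integrable_Q_sq]
  have : Function.support (fun x => Q x ^ 2) = univ := by
    ext x; simpa using (hpos x).ne'
  rw [this]; simp

lemma pair_schwartz (f g : 𝓢(ℝ, ℂ)) : pair (toL2 f) (toL2 g) = ∫ x, f x * g x := by
  rw [pair_toL2]
  apply integral_congr_ae
  filter_upwards [toL2_ae f] with x hx
  rw [hx]

lemma pair_qS_qS : pair (toL2 qS) (toL2 qS) = 2 * mQ := by
  rw [pair_schwartz, mQ]
  push_cast
  rw [mul_div_cancel₀ _ two_ne_zero, ← integral_complex_ofReal]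
  congr 1; ext x; rw [qS_apply]; push_cast; ring

lemma pair_dS (f g : 𝓢(ℝ, ℂ)) : pair (toL2 f) (toL2 (dS g)) = -pair (toL2 (dS f)) (toL2 g) := by
  rw [pair_schwartz, pair_schwartz]
  exact SchwartzMap.integral_mul_deriv_eq_neg_deriv_mul f g

lemma pair_xS (f g : 𝓢(ℝ, ℂ)) : pair (toL2 (xS f)) (toL2 g) = pair (toL2 f) (toL2 (xS g)) := by
  rw [pair_schwartz, pair_schwartz]
  congr 1; ext x; simp only [xS_apply]; ring

/-- Integration by parts: ∫ x Q ∂_xQ = -½ ∫ Q². -/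
lemma pair_xS_qS_dS_qS : pair (toL2 (xS qS)) (toL2 (dS qS)) = -mQ := by
  have h1 := pair_dS (xS qS) qS
  rw [dS_xS, toL2_add, map_add, add_apply, pair_qS_qS, pair_xS,
    pair_comm (toL2 (xS (dS qS)))] at h1
  rw [pair_xS]
  linear_combination h1 / 2

lemma pair_qS_qgS : pair (toL2 qS) (toL2 qgS) = mQ := by
  rw [qgS, toL2_add, map_add, pair_qS_qS, eulerS, ContinuousLinearMap.comp_apply, ← pair_xS,
    pair_xS_qS_dS_qS]
  ring

/-- Independence of α reflects ‖Q_α‖² = α‖Q‖²; the pairing is half the α-derivative of this. -/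
lemma pair_QS_QpS {α : ℝ} (hα : 0 < α) : pair (toL2 (QS α)) (toL2 (QpS α)) = mQ := by
  rw [← pair_qS_qgS, pair_schwartz, pair_schwartz]
  simp only [QS, QpS, smul_apply, dil_apply hα, smul_eq_mul]
  have := Measure.integral_comp_mul_left (fun y => qS y * qgS y) α
  rw [abs_of_pos (inv_pos.2 hα)] at this
  simp only [mul_assoc]
  rw [integral_const_mul, this, Complex.real_smul, ← mul_assoc, ← Complex.ofReal_mul,
    mul_inv_cancel₀ hα.ne', Complex.ofReal_one, one_mul]

/-! ### The nonlinear field -/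

/-- `Q_α` as an element of `H¹`. -/
def qX (α : ℝ) : L2 := iota (QS α)

/-- `Q'_α` as an element of `H¹`. -/
def qpX (α : ℝ) : L2 := iota (QpS α)

/-- The part of `(Q_α + v)² (Q_α + v*) - Q_α³` that is linear in `v`. -/
def linX (α : ℝ) (W : L2) : L2 :=
  (2 : ℂ) • mulX (qX α) (mulX (qX α) W) + mulX (qX α) (mulX (qX α) (conjL2 W))

/-- The part of `(Q_α + v)² (Q_α + v*) - Q_α³` of order at least two in `v`. -/
def nlX (α : ℝ) (W : L2) : L2 :=
  mulX (qX α) (mulX W W + (2 : ℂ) • mulX W (conjL2 W)) + mulX (mulX W W) (conjL2 W)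

/-- The right-hand side of the equation for `v`, with `p = κ + θ̇` and `a = α̇`. -/
def fieldX (p a k α : ℝ) (W : L2) : L2 :=
  (p : ℂ) • qX α + ((p - k : ℝ) : ℂ) • W - (a * Complex.I) • qpX α + (linX α W + nlX α W)

/-- `⟨v ∣ Q'_α⟩`. -/
def xR (α : ℝ) (W : L2) : ℝ := (pair (J W) (toL2 (QpS α))).re

/-- `⟨-iv ∣ Q''_α⟩`. -/
def yR (α : ℝ) (W : L2) : ℝ := (pair (J W) (toL2 (QppS α))).im

/-- `⟨-iv ∣ Q_α⟩`. -/
def zR (α : ℝ) (W : L2) : ℝ := (pair (J W) (toL2 (QS α))).im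

/-- The source term in the first modulation equation. -/
def s₁ (κ : ℝ → ℝ) (α : ℝ) (W : L2) : ℝ :=
  (α ^ 2 - κ α) * xR α W + (pair (J (nlX α W)) (toL2 (QpS α))).re

/-- The source term in the second modulation equation. -/
def s₂ (κ : ℝ → ℝ) (α : ℝ) (W : L2) : ℝ :=
  (α ^ 2 - κ α) * zR α W + (pair (J (nlX α W)) (toL2 (QS α))).im

/-- The determinant of the modulation equations. -/
def modDet (α : ℝ) (W : L2) : ℝ := xR α W ^ 2 - mQ ^ 2 + yR α W * zR α W

/-- The value of `κ + θ̇` determined by the modulation equations. -/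
def pF (κ : ℝ → ℝ) (α : ℝ) (W : L2) : ℝ :=
  (-s₁ κ α W * (xR α W - mQ) - yR α W * s₂ κ α W) * (modDet α W)⁻¹

/-- The value of `α̇` determined by the modulation equations. -/
def aF (κ : ℝ → ℝ) (α : ℝ) (W : L2) : ℝ :=
  (-(mQ + xR α W) * s₂ κ α W + zR α W * s₁ κ α W) * (modDet α W)⁻¹

/-- The closed right-hand side. -/
def PhiX (κ : ℝ → ℝ) (α : ℝ) (W : L2) : L2 := fieldX (pF κ α W) (aF κ α W) (κ α) α W

/-- Each multiplication by Q_α² is moved onto the test function, where Q_α³ = α²Q_α - Q_α''. In the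
imaginary part, 2X + conj X reduces to X, so the term with Q_α'' cancels the Laplacian of the
equation. -/
lemma pair_linX_QS {α : ℝ} (hα : 0 < α) (W : L2) :
    pair (J (linX α W)) (toL2 (QS α)) = 2 * ((α : ℂ) ^ 2 * pair (J W) (toL2 (QS α)) -
      pair (J W) (toL2 (dS (dS (QS α))))) + conj ((α : ℂ) ^ 2 * pair (J W) (toL2 (QS α)) -
      pair (J W) (toL2 (dS (dS (QS α))))) := by
  have key : ∀ W : L2, pair (J (mulX (qX α) (mulX (qX α) W))) (toL2 (QS α)) =
      (α : ℂ) ^ 2 * pair (J W) (toL2 (QS α)) - pair (J W) (toL2 (dS (dS (QS α)))) := by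
    intro W
    rw [← smul_eq_mul, ← map_smul, ← map_sub, ← toL2_smul, ← toL2_sub, pair_toL2, pair_toL2]
    apply integral_congr_ae
    filter_upwards [J_mulX_ae (qX α) (mulX (qX α) W), J_mulX_ae (qX α) W, toL2_ae (QS α)]
      with x h1 h2 h3
    rw [h1, h2, qX, J_iota, h3, sub_apply, smul_apply, dS_dS_QS_apply hα, smul_eq_mul]
    ring
  have h2 := key (conjL2 W)
  have he : ∀ x, QS α (-x) = QS α x := fun x => by rw [QS_apply hα, QS_apply hα, groundState_neg]
  have hc : ∀ f : 𝓢(ℝ, ℂ), (∀ x, conj (f x) = f x) → (∀ x, f (-x) = f x) →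
    pair (J (conjL2 W)) (toL2 f) = conj (pair (J W) (toL2 f)) := fun f hf he => pair_star hf he W
  rw [hc _ (conj_QS hα) he, hc _ (fun x => by
    rw [dS_dS_QS_apply hα]; simp only [map_sub, map_mul, map_pow, conj_QS hα, Complex.conj_ofReal])
    (fun x => by rw [dS_dS_QS_apply hα, dS_dS_QS_apply hα, he])] at h2
  rw [linX, map_add, map_add, add_apply, h2]
  rw [map_smul, map_smul, smul_apply, key, smul_eq_mul]
  simp only [map_sub, map_mul, map_pow, Complex.conj_ofReal]

/-- Same mechanism with 3Q_α²Q'_α from the differentiated soliton equation, whence the factor 3. Now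
the real part of 2X + conj X is 3 Re X. The term 2αQ_α survives and is killed later by the other
orthogonality condition. -/
lemma pair_linX_QpS {α : ℝ} (hα : 0 < α) (W : L2) :
    3 * pair (J (linX α W)) (toL2 (QpS α)) = 2 * ((α : ℂ) ^ 2 * pair (J W) (toL2 (QpS α)) +
      2 * α * pair (J W) (toL2 (QS α)) - pair (J W) (toL2 (dS (dS (QpS α))))) +
      conj ((α : ℂ) ^ 2 * pair (J W) (toL2 (QpS α)) +
      2 * α * pair (J W) (toL2 (QS α)) - pair (J W) (toL2 (dS (dS (QpS α))))) := by
  have key : ∀ W : L2, 3 * pair (J (mulX (qX α) (mulX (qX α) W))) (toL2 (QpS α)) =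
      (α : ℂ) ^ 2 * pair (J W) (toL2 (QpS α)) + 2 * α * pair (J W) (toL2 (QS α)) -
        pair (J W) (toL2 (dS (dS (QpS α)))) := by
    intro W
    have e : (α : ℂ) ^ 2 * pair (J W) (toL2 (QpS α)) + 2 * α * pair (J W) (toL2 (QS α)) -
        pair (J W) (toL2 (dS (dS (QpS α)))) = pair (J W) (toL2 ((α : ℂ) ^ 2 • QpS α +
          (2 * α : ℂ) • QS α - dS (dS (QpS α)))) := by
      simp only [toL2_sub, toL2_add, toL2_smul, map_sub, map_add, map_smul, smul_eq_mul]
    rw [e, pair_toL2, pair_toL2, ← integral_const_mul]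
    apply integral_congr_ae
    filter_upwards [J_mulX_ae (qX α) (mulX (qX α) W), J_mulX_ae (qX α) W, toL2_ae (QS α)]
      with x h1 h2 h3
    rw [h1, h2, qX, J_iota, h3, sub_apply, add_apply, smul_apply, smul_apply,
      dS_dS_QpS_apply hα]
    simp only [smul_eq_mul]
    ring
  have h2 := key (conjL2 W)
  have he : ∀ x, QS α (-x) = QS α x := fun x => by rw [QS_apply hα, QS_apply hα, groundState_neg]
  have he' : ∀ x, QpS α (-x) = QpS α x := fun x => by
    rw [QpS_apply hα, QpS_apply hα, groundStateDα_neg]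
  have hc : ∀ f : 𝓢(ℝ, ℂ), (∀ x, conj (f x) = f x) → (∀ x, f (-x) = f x) →
    pair (J (conjL2 W)) (toL2 f) = conj (pair (J W) (toL2 f)) := fun f hf he => pair_star hf he W
  rw [hc _ (conj_QS hα) he, hc _ (conj_QpS hα) he', hc (dS (dS (QpS α))) (fun x => by
    rw [dS_dS_QpS_apply hα]
    simp only [map_sub, map_add, map_mul, map_pow, conj_QS hα, conj_QpS hα, Complex.conj_ofReal,
      map_ofNat])
    (fun x => by rw [dS_dS_QpS_apply hα, dS_dS_QpS_apply hα, he, he'])] at h2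
  rw [linX, map_add, map_add, add_apply, mul_add, h2]
  rw [map_smul, map_smul, smul_apply, smul_eq_mul, mul_left_comm, key]
  simp only [map_sub, map_add, map_mul, map_pow, Complex.conj_ofReal, map_ofNat]

end

/-! ### Lipschitz bounds and orders of smallness for the closed field -/

noncomputable section

/-! ### Bounded Lipschitz maps and orders of vanishing -/

section Calculus

variable {E F G : Type*} [NormedAddCommGroup E] [NormedAddCommGroup F] [NormedAddCommGroup G]

/-- `f` is bounded and Lipschitz on `S`. -/
def BLip {Z : Type*} [PseudoMetricSpace Z] (S : Set Z) (f : Z → E) : Prop :=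
  ∃ C, 0 ≤ C ∧ (∀ x ∈ S, ‖f x‖ ≤ C) ∧ ∀ x ∈ S, ∀ y ∈ S, ‖f x - f y‖ ≤ C * dist x y

/-- An additive map with a linear bound. -/
structure IsLin (A : E → F) : Prop where
  sub : ∀ x y, A x - A y = A (x - y)
  bound : ∃ K, 0 ≤ K ∧ ∀ x, ‖A x‖ ≤ K * ‖x‖

/-- A biadditive map with a bilinear bound. -/
structure IsBil (B : E → F → G) : Prop where
  sub : ∀ x x' y y', B x y - B x' y' = B (x - x') y + B x' (y - y')
  bound : ∃ K, 0 ≤ K ∧ ∀ x y, ‖B x y‖ ≤ K * ‖x‖ * ‖y‖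

variable {Z : Type*} [PseudoMetricSpace Z] {S : Set Z}

lemma BLip.const (c : E) : BLip S (fun _ => c) :=
  ⟨‖c‖, norm_nonneg _, fun _ _ => le_rfl, fun x _ y _ => by simp; positivity⟩

lemma BLip.add {f g : Z → E} (hf : BLip S f) (hg : BLip S g) : BLip S (fun z => f z + g z) := by
  obtain ⟨C, h0, h1, h2⟩ := hf
  obtain ⟨C', h0', h1', h2'⟩ := hg
  refine ⟨C + C', by positivity, fun x hx => (norm_add_le _ _).trans (add_le_add (h1 x hx) (h1' x hx)),
    fun x hx y hy => ?_⟩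
  rw [add_sub_add_comm, add_mul]
  exact (norm_add_le _ _).trans (add_le_add (h2 x hx y hy) (h2' x hx y hy))

lemma BLip.lin {A : E → F} (hA : IsLin A) {f : Z → E} (hf : BLip S f) : BLip S (fun z => A (f z)) := by
  obtain ⟨C, h0, h1, h2⟩ := hf
  obtain ⟨K, hK, hb⟩ := hA.bound
  refine ⟨K * C, by positivity, fun x hx => (hb _).trans ?_, fun x hx y hy => ?_⟩
  · gcongr; exact h1 x hx
  · rw [hA.sub, mul_assoc]
    refine (hb _).trans ?_
    gcongr
    exact h2 x hx y hy

lemma isLin_neg : IsLin (fun x : E => -x) :=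
  ⟨fun x y => by abel, 1, zero_le_one, fun x => by simp⟩

lemma BLip.neg {f : Z → E} (hf : BLip S f) : BLip S (fun z => -f z) := hf.lin isLin_neg

lemma BLip.sub {f g : Z → E} (hf : BLip S f) (hg : BLip S g) : BLip S (fun z => f z - g z) := by
  simpa only [sub_eq_add_neg] using hf.add hg.neg

/-- Only biadditivity and a norm bound are required, so one rule serves real products, scalar
multiples, the product of H¹ and the L² pairing. The whole field is assembled from these pieces. -/
lemma BLip.bil {B : E → F → G} (hB : IsBil B) {f : Z → E} {g : Z → F} (hf : BLip S f)
    (hg : BLip S g) : BLip S (fun z => B (f z) (g z)) := by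
  obtain ⟨C, h0, h1, h2⟩ := hf
  obtain ⟨C', h0', h1', h2'⟩ := hg
  obtain ⟨K, hK, hb⟩ := hB.bound
  refine ⟨2 * (K * C * C'), by positivity, fun x hx => ?_, fun x hx y hy => ?_⟩
  · have : ‖B (f x) (g x)‖ ≤ K * C * C' := (hb _ _).trans (by
      gcongr
      · exact h1 x hx
      · exact h1' x hx)
    have : 0 ≤ K * C * C' := by positivity
    linarith
  · rw [hB.sub]
    have e1 : ‖B (f x - f y) (g x)‖ ≤ K * (C * dist x y) * C' := (hb _ _).trans (by
      gcongr
      · exact h2 x hx y hy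
      · exact h1' x hx)
    have e2 : ‖B (f y) (g x - g y)‖ ≤ K * C * (C' * dist x y) := (hb _ _).trans (by
      gcongr
      · exact h1 y hy
      · exact h2' x hx y hy)
    refine (norm_add_le _ _).trans ((add_le_add e1 e2).trans (le_of_eq ?_))
    ring

lemma BLip.inv {f : Z → ℝ} (hf : BLip S f) {c : ℝ} (hc : 0 < c) (h : ∀ x ∈ S, c ≤ |f x|) :
    BLip S (fun z => (f z)⁻¹) := by
  obtain ⟨C, h0, h1, h2⟩ := hf
  have hne : ∀ x ∈ S, f x ≠ 0 := fun x hx h' => by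
    have := h x hx; rw [h', abs_zero] at this; linarith
  refine ⟨c⁻¹ + C / c ^ 2, by positivity, fun x hx => ?_, fun x hx y hy => ?_⟩
  · rw [norm_inv, Real.norm_eq_abs]
    have : |f x|⁻¹ ≤ c⁻¹ := inv_anti₀ hc (h x hx)
    have : 0 ≤ C / c ^ 2 := by positivity
    linarith
  · rw [inv_sub_inv (hne x hx) (hne y hy), norm_div, norm_mul, ← norm_neg (f y - f x), neg_sub]
    have e1 : ‖f x - f y‖ / (‖f x‖ * ‖f y‖) ≤ (C * dist x y) / (c * c) := by
      gcongr
      · exact h2 x hx y hy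
      · exact h x hx
      · exact h y hy
    refine e1.trans ?_
    rw [add_mul, ← sq, mul_div_right_comm]
    have : 0 ≤ c⁻¹ * dist x y := by positivity
    linarith

end Calculus

section Order

variable {E F G : Type*} [NormedAddCommGroup E] [NormedAddCommGroup F] [NormedAddCommGroup G]
  {Z : Type*} {S : Set Z}

/-- `f = O(δ ^ n)` on `S`. -/
def OrdOn (δ : Z → ℝ) (n : ℕ) (S : Set Z) (f : Z → E) : Prop :=
  ∃ C, 0 ≤ C ∧ ∀ x ∈ S, ‖f x‖ ≤ C * δ x ^ n

variable {δ : Z → ℝ}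

lemma OrdOn.add {n : ℕ} {f g : Z → E} (hf : OrdOn δ n S f) (hg : OrdOn δ n S g) :
    OrdOn δ n S (fun z => f z + g z) := by
  obtain ⟨C, h0, h1⟩ := hf
  obtain ⟨C', h0', h1'⟩ := hg
  refine ⟨C + C', by positivity, fun x hx => ?_⟩
  rw [add_mul]
  exact (norm_add_le _ _).trans (add_le_add (h1 x hx) (h1' x hx))

lemma OrdOn.lin {n : ℕ} {A : E → F} (hA : IsLin A) {f : Z → E} (hf : OrdOn δ n S f) :
    OrdOn δ n S (fun z => A (f z)) := by
  obtain ⟨C, h0, h1⟩ := hf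
  obtain ⟨K, hK, hb⟩ := hA.bound
  refine ⟨K * C, by positivity, fun x hx => (hb _).trans ?_⟩
  rw [mul_assoc]
  gcongr
  exact h1 x hx

lemma OrdOn.neg {n : ℕ} {f : Z → E} (hf : OrdOn δ n S f) : OrdOn δ n S (fun z => -f z) :=
  hf.lin isLin_neg

lemma OrdOn.sub {n : ℕ} {f g : Z → E} (hf : OrdOn δ n S f) (hg : OrdOn δ n S g) :
    OrdOn δ n S (fun z => f z - g z) := by
  simpa only [sub_eq_add_neg] using hf.add hg.neg

lemma OrdOn.bil {n m : ℕ} {B : E → F → G} (hB : IsBil B) {f : Z → E} {g : Z → F}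
    (hf : OrdOn δ n S f) (hg : OrdOn δ m S g) (hδ : ∀ z, 0 ≤ δ z) :
    OrdOn δ (n + m) S (fun z => B (f z) (g z)) := by
  obtain ⟨C, h0, h1⟩ := hf
  obtain ⟨C', h0', h1'⟩ := hg
  obtain ⟨K, hK, hb⟩ := hB.bound
  refine ⟨K * C * C', by positivity, fun x hx => (hb _ _).trans ?_⟩
  have := hδ x
  calc _ ≤ K * (C * δ x ^ n) * (C' * δ x ^ m) := by
        gcongr
        · exact h1 x hx
        · exact h1' x hx
    _ = _ := by rw [pow_add]; ring

lemma OrdOn.of_BLip [PseudoMetricSpace Z] {f : Z → E} (hf : BLip S f) : OrdOn δ 0 S f := by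
  obtain ⟨C, h0, h1, -⟩ := hf
  exact ⟨C, h0, fun x hx => by simpa using h1 x hx⟩

lemma OrdOn.mono_order {n m : ℕ} {f : Z → E} (hf : OrdOn δ n S f) (hm : m ≤ n) (hδ : ∀ z, 0 ≤ δ z)
    {D : ℝ} (hD : ∀ z ∈ S, δ z ≤ D) : OrdOn δ m S f := by
  obtain ⟨C, h0, h1⟩ := hf
  refine ⟨C * |D| ^ (n - m), by positivity, fun x hx => (h1 x hx).trans ?_⟩
  have e : δ x ^ n = δ x ^ (n - m) * δ x ^ m := by rw [← pow_add, Nat.sub_add_cancel hm]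
  have := hδ x
  rw [e, mul_assoc]
  gcongr
  exact (hD x hx).trans (le_abs_self D)

end Order

/-! ### Linear and bilinear building blocks -/

lemma isLin_clm {E F : Type*} [NormedAddCommGroup E] [NormedAddCommGroup F] [NormedSpace ℝ E]
    [NormedSpace ℝ F] (A : E →L[ℝ] F) : IsLin A :=
  ⟨fun x y => (map_sub A x y).symm, ‖A‖, norm_nonneg _, A.le_opNorm⟩

lemma isLin_smul (c : ℂ) : IsLin (fun W : L2 => c • W) :=
  ⟨fun x y => (smul_sub c x y).symm, ‖c‖, norm_nonneg _, fun x => (norm_smul c x).le⟩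

lemma isLin_re : IsLin Complex.re := ⟨fun _ _ => rfl, 1, zero_le_one, fun x => by
  rw [one_mul]; exact Complex.abs_re_le_norm x⟩

lemma isLin_im : IsLin Complex.im := ⟨fun _ _ => rfl, 1, zero_le_one, fun x => by
  rw [one_mul]; exact Complex.abs_im_le_norm x⟩

lemma isBil_mul : IsBil (fun x y : ℝ => x * y) :=
  ⟨fun x x' y y' => by ring, 1, zero_le_one, fun x y => by rw [norm_mul, one_mul]⟩

lemma isBil_mulX : IsBil (fun f g => mulX f g) where
  sub x x' y y' := by simp only [map_sub, sub_apply]; abel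
  bound := ⟨‖mulX‖, mulX.opNorm_nonneg, fun x y => mulX.le_opNorm₂ x y⟩

lemma isBil_pair : IsBil (fun W g => pair (J W) g) where
  sub x x' y y' := by simp only [map_sub, sub_apply]; abel
  bound := ⟨‖pair‖, pair.opNorm_nonneg, fun x y => (pair.le_opNorm₂ (J x) y).trans (by
    gcongr; exact norm_J_le x)⟩

lemma isBil_smul : IsBil (fun (c : ℝ) (W : L2) => (c : ℂ) • W) where
  sub x x' y y' := by push_cast; module
  bound := ⟨1, zero_le_one, fun x y => by rw [norm_smul, Complex.norm_real, one_mul]⟩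

lemma isBil_smul_I : IsBil (fun (c : ℝ) (W : L2) => (c * Complex.I) • W) where
  sub x x' y y' := by push_cast; module
  bound := ⟨1, zero_le_one, fun x y => by
    rw [norm_smul, norm_mul, Complex.norm_real, Complex.norm_I, one_mul, mul_one]⟩

/-! ### Estimates for the field -/

/-- The region `α ∈ [1/2, 3/2]`, `‖v‖ ≤ ρ`. -/
def reg (ρ : ℝ) : Set (ℝ × L2) := {z | z.1 ∈ dilI ∧ ‖z.2‖ ≤ ρ}

lemma reg_mono {ρ ρ' : ℝ} (h : ρ ≤ ρ') : reg ρ ⊆ reg ρ' := fun _ hz => ⟨hz.1, hz.2.trans h⟩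

lemma BLip.of_fst {E : Type*} [NormedAddCommGroup E] {f : ℝ → E} {ρ : ℝ}
    (hf : ∃ C, 0 ≤ C ∧ ∀ α ∈ dilI, ∀ β ∈ dilI, ‖f α - f β‖ ≤ C * |α - β|) :
    BLip (reg ρ) (fun z => f z.1) := by
  obtain ⟨C, h0, h⟩ := hf
  refine ⟨C + ‖f 1‖, by positivity, fun x hx => ?_, fun x hx y hy => ?_⟩
  · have e1 := h x.1 hx.1 1 (by constructor <;> norm_num)
    have e2 : |x.1 - 1| ≤ 1 := by
      rw [abs_le]; constructor <;> linarith [hx.1.1, hx.1.2]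
    have e3 : C * |x.1 - 1| ≤ C * 1 := by gcongr
    have := norm_sub_norm_le (f x.1) (f 1)
    linarith
  · have e1 : |x.1 - y.1| ≤ dist x y := by
      rw [← Real.dist_eq, Prod.dist_eq]; exact le_max_left _ _
    have e2 : C * |x.1 - y.1| ≤ C * dist x y := by gcongr
    have e3 := h x.1 hx.1 y.1 hy.1
    have : 0 ≤ ‖f 1‖ * dist x y := by positivity
    linarith

lemma BLip.fst {ρ : ℝ} : BLip (reg ρ) (fun z => z.1) :=
  BLip.of_fst (f := fun x => x) ⟨1, zero_le_one, fun _ _ _ _ => by simp⟩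

lemma BLip.snd {ρ : ℝ} (hρ : 0 ≤ ρ) : BLip (reg ρ) (fun z => z.2) := by
  refine ⟨ρ + 1, by positivity, fun x hx => by linarith [hx.2], fun x _ y _ => ?_⟩
  have : ‖x.2 - y.2‖ ≤ dist x y := by
    rw [← dist_eq_norm, Prod.dist_eq]; exact le_max_right _ _
  nlinarith [dist_nonneg (x := x) (y := y)]

lemma blip_dil {ρ : ℝ} (f : 𝓢(ℝ, ℂ)) : BLip (reg ρ) (fun z => toL2 (dil z.1 f)) :=
  BLip.of_fst (exists_lipschitz_dil f)

lemma blip_iota_dil {ρ : ℝ} (f : 𝓢(ℝ, ℂ)) : BLip (reg ρ) (fun z => iota (dil z.1 f)) :=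
  BLip.of_fst (exists_lipschitz_iota_dil f)

lemma blip_QS {ρ : ℝ} : BLip (reg ρ) (fun z => toL2 (QS z.1)) := by
  simp only [QS, toL2_smul]
  exact BLip.fst.bil isBil_smul (blip_dil _)

lemma blip_QpS {ρ : ℝ} : BLip (reg ρ) (fun z => toL2 (QpS z.1)) := blip_dil _

lemma blip_QppS {ρ : ℝ} : BLip (reg ρ) (fun z => toL2 (QppS z.1)) := by
  simp only [QppS, toL2_smul, ← Complex.ofReal_inv]
  exact (BLip.fst.inv (c := 1 / 2) (by norm_num) fun x hx => hx.1.1.trans (le_abs_self _)).bil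
    isBil_smul (blip_dil _)

lemma blip_qX {ρ : ℝ} : BLip (reg ρ) (fun z => qX z.1) := by
  simp only [qX, QS, map_smul]
  exact BLip.fst.bil isBil_smul (blip_iota_dil _)

lemma blip_qpX {ρ : ℝ} : BLip (reg ρ) (fun z => qpX z.1) := blip_iota_dil _

lemma blip_linX {ρ : ℝ} (hρ : 0 ≤ ρ) : BLip (reg ρ) (fun z => linX z.1 z.2) :=
  ((blip_qX.bil isBil_mulX (blip_qX.bil isBil_mulX (BLip.snd hρ))).lin (isLin_smul 2)).add
    (blip_qX.bil isBil_mulX (blip_qX.bil isBil_mulX ((BLip.snd hρ).lin (isLin_clm conjL2))))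

lemma blip_nlX {ρ : ℝ} (hρ : 0 ≤ ρ) : BLip (reg ρ) (fun z => nlX z.1 z.2) :=
  have h := BLip.snd hρ
  have h' := h.lin (isLin_clm conjL2)
  (blip_qX.bil isBil_mulX ((h.bil isBil_mulX h).add ((h.bil isBil_mulX h').lin (isLin_smul 2)))).add
    ((h.bil isBil_mulX h).bil isBil_mulX h')

lemma blip_xR {ρ : ℝ} (hρ : 0 ≤ ρ) : BLip (reg ρ) (fun z => xR z.1 z.2) :=
  ((BLip.snd hρ).bil isBil_pair blip_QpS).lin isLin_re

lemma blip_yR {ρ : ℝ} (hρ : 0 ≤ ρ) : BLip (reg ρ) (fun z => yR z.1 z.2) :=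
  ((BLip.snd hρ).bil isBil_pair blip_QppS).lin isLin_im

lemma blip_zR {ρ : ℝ} (hρ : 0 ≤ ρ) : BLip (reg ρ) (fun z => zR z.1 z.2) :=
  ((BLip.snd hρ).bil isBil_pair blip_QS).lin isLin_im

/-- The two properties of `κ` that are used. -/
structure IsKappa (κ : ℝ → ℝ) : Prop where
  one : κ 1 = 1
  lip : ∃ C, 0 ≤ C ∧ ∀ α ∈ dilI, ∀ β ∈ dilI, ‖κ α - κ β‖ ≤ C * |α - β|

lemma isKappa_of {κ : ℝ → ℝ} (hκ : (∀ a : ℝ, κ a = 1) ∨ (∀ a : ℝ, κ a = a ^ 2)) : IsKappa κ := by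
  rcases hκ with h | h
  · exact ⟨h 1, 0, le_rfl, fun α _ β _ => by simp [h]⟩
  · refine ⟨by rw [h]; norm_num, 3, by norm_num, fun α hα β hβ => ?_⟩
    rw [h, h, show α ^ 2 - β ^ 2 = (α + β) * (α - β) by ring, norm_mul, Real.norm_eq_abs,
      Real.norm_eq_abs, abs_of_pos (add_pos (pos_of_mem_dilI hα) (pos_of_mem_dilI hβ))]
    have : α + β ≤ 3 := by linarith [hα.2, hβ.2]
    gcongr

variable {κ : ℝ → ℝ}

lemma IsKappa.blip (h : IsKappa κ) {ρ : ℝ} : BLip (reg ρ) (fun z => κ z.1) := BLip.of_fst h.lip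

lemma blip_s₁ (hk : IsKappa κ) {ρ : ℝ} (hρ : 0 ≤ ρ) : BLip (reg ρ) (fun z => s₁ κ z.1 z.2) := by
  have := ((((BLip.fst.bil isBil_mul BLip.fst).sub (hk.blip (ρ := ρ))).bil isBil_mul (blip_xR hρ))).add
    (((blip_nlX hρ).bil isBil_pair blip_QpS).lin isLin_re)
  simp only [← sq] at this
  exact this

lemma blip_s₂ (hk : IsKappa κ) {ρ : ℝ} (hρ : 0 ≤ ρ) : BLip (reg ρ) (fun z => s₂ κ z.1 z.2) := by
  have := ((((BLip.fst.bil isBil_mul BLip.fst).sub (hk.blip (ρ := ρ))).bil isBil_mul (blip_zR hρ))).add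
    (((blip_nlX hρ).bil isBil_pair blip_QS).lin isLin_im)
  simp only [← sq] at this
  exact this

lemma blip_modDet {ρ : ℝ} (hρ : 0 ≤ ρ) : BLip (reg ρ) (fun z => modDet z.1 z.2) := by
  have := (((blip_xR hρ).bil isBil_mul (blip_xR hρ)).sub (BLip.const (mQ ^ 2))).add
    ((blip_yR hρ).bil isBil_mul (blip_zR hρ))
  simp only [← sq] at this
  exact this

/-- `|α - 1| + ‖v‖`. -/
def dev (z : ℝ × L2) : ℝ := |z.1 - 1| + ‖z.2‖

lemma dev_nonneg (z : ℝ × L2) : 0 ≤ dev z := by unfold dev; positivity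

lemma dev_le {ρ : ℝ} (hρ : ρ ≤ 1) : ∀ z ∈ reg ρ, dev z ≤ 2 := fun z hz => by
  have e2 : |z.1 - 1| ≤ 1 := by
    rw [abs_le]; constructor <;> linarith [hz.1.1, hz.1.2]
  unfold dev; linarith [hz.2]

lemma ord_snd {ρ : ℝ} : OrdOn dev 1 (reg ρ) (fun z => z.2) :=
  ⟨1, zero_le_one, fun z _ => by unfold dev; linarith [abs_nonneg (z.1 - 1)]⟩

lemma ord_of_fst {E : Type*} [NormedAddCommGroup E] {f : ℝ → E} {ρ : ℝ}
    (hf : ∃ C, 0 ≤ C ∧ ∀ α ∈ dilI, ∀ β ∈ dilI, ‖f α - f β‖ ≤ C * |α - β|) :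
    OrdOn dev 1 (reg ρ) (fun z => f z.1 - f 1) := by
  obtain ⟨C, h0, h⟩ := hf
  refine ⟨C, h0, fun z hz => (h z.1 hz.1 1 (by constructor <;> norm_num)).trans ?_⟩
  rw [pow_one]; unfold dev
  gcongr
  linarith [norm_nonneg z.2]

lemma ord_xR {ρ : ℝ} : OrdOn dev 1 (reg ρ) (fun z => xR z.1 z.2) :=
  (ord_snd.bil isBil_pair (OrdOn.of_BLip blip_QpS) dev_nonneg).lin isLin_re

lemma ord_zR {ρ : ℝ} : OrdOn dev 1 (reg ρ) (fun z => zR z.1 z.2) :=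
  (ord_snd.bil isBil_pair (OrdOn.of_BLip blip_QS) dev_nonneg).lin isLin_im

lemma ord_nlX {ρ : ℝ} (hρ : ρ ≤ 1) : OrdOn dev 2 (reg ρ) (fun z => nlX z.1 z.2) := by
  have h := ord_snd (ρ := ρ)
  have h' := h.lin (isLin_clm conjL2)
  have h2 := (h.bil isBil_mulX h dev_nonneg).add
    ((h.bil isBil_mulX h' dev_nonneg).lin (isLin_smul 2))
  have h3 := (OrdOn.of_BLip (blip_qX (ρ := ρ))).bil isBil_mulX h2 dev_nonneg
  have h4 := ((h.bil isBil_mulX h dev_nonneg).bil isBil_mulX h' dev_nonneg).mono_order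
    (m := 2) (by norm_num) dev_nonneg (dev_le hρ)
  exact h3.add h4

/-- Both α² and κ equal 1 at α = 1. This makes the two choices of κ equivalent at the order needed.
-/
lemma ord_sq_sub_kappa (hk : IsKappa κ) {ρ : ℝ} : OrdOn dev 1 (reg ρ) (fun z => z.1 ^ 2 - κ z.1) := by
  have h1 := ord_of_fst (ρ := ρ) (isKappa_of (κ := fun a => a ^ 2) (Or.inr fun _ => rfl)).lip
  have h2 := h1.sub (ord_of_fst hk.lip)
  simpa [hk.one] using h2

lemma ord_s₁ (hk : IsKappa κ) {ρ : ℝ} (hρ : ρ ≤ 1) : OrdOn dev 2 (reg ρ) (fun z => s₁ κ z.1 z.2) :=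
  ((ord_sq_sub_kappa hk).bil isBil_mul ord_xR dev_nonneg).add
    (((ord_nlX hρ).bil isBil_pair (OrdOn.of_BLip blip_QpS) dev_nonneg).lin isLin_re)

lemma ord_s₂ (hk : IsKappa κ) {ρ : ℝ} (hρ : ρ ≤ 1) : OrdOn dev 2 (reg ρ) (fun z => s₂ κ z.1 z.2) :=
  ((ord_sq_sub_kappa hk).bil isBil_mul ord_zR dev_nonneg).add
    (((ord_nlX hρ).bil isBil_pair (OrdOn.of_BLip blip_QS) dev_nonneg).lin isLin_im)

/-- Radii on which the modulation equations are solvable. -/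
structure IsAdm (ρ : ℝ) : Prop where
  pos : 0 < ρ
  le_half : ρ ≤ 1 / 2
  det : ∀ z ∈ reg ρ, mQ ^ 2 / 2 ≤ |modDet z.1 z.2|

lemma IsAdm.le_one {ρ : ℝ} (hρ : IsAdm ρ) : ρ ≤ 1 := hρ.le_half.trans (by norm_num)

/-- At v = 0 the determinant equals -m² with m = `mQ` > 0, and its other entries are O(‖v‖)
uniformly for α in `dilI`. -/
lemma exists_isAdm : ∃ ρ, IsAdm ρ := by
  have hm := mQ_pos
  have key : ∀ (A : ℂ → ℝ), IsLin A → ∀ f : ℝ → L2, BLip (reg 1) (fun z => f z.1) →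
      ∃ C, 0 ≤ C ∧ ∀ z ∈ reg 1, |A (pair (J z.2) (f z.1))| ≤ C * ‖z.2‖ := by
    rintro A ⟨-, K, hK, hA⟩ f ⟨C, h0, h1, -⟩
    obtain ⟨K', hK', hb⟩ := isBil_pair.bound
    refine ⟨K * (K' * C), by positivity, fun z hz => (hA _).trans ?_⟩
    rw [mul_assoc]
    gcongr
    refine (hb _ _).trans ?_
    have := h1 z hz
    calc _ ≤ K' * ‖z.2‖ * C := by gcongr
      _ = _ := by ring
  obtain ⟨Cx, hx0, hx⟩ := key _ isLin_re (fun α => toL2 (QpS α)) blip_QpS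
  obtain ⟨Cy, hy0, hy⟩ := key _ isLin_im (fun α => toL2 (QppS α)) blip_QppS
  obtain ⟨Cz, hz0, hz⟩ := key _ isLin_im (fun α => toL2 (QS α)) blip_QS
  have hS : 0 < Cx + Cy + Cz + 1 := by positivity
  -- The second bound makes each of |xR|, |yR|, |zR| at most m/2, so the determinant is at most m²/4
  -- - m² + m²/4 = -m²/2.
  refine ⟨min (1 / 2) (mQ / 2 / (Cx + Cy + Cz + 1)), by positivity, min_le_left _ _, fun z hzr => ?_⟩
  have hz1 : z ∈ reg 1 := reg_mono ((min_le_left _ _).trans (by norm_num)) hzr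
  have hn : (Cx + Cy + Cz + 1) * ‖z.2‖ ≤ mQ / 2 := by
    have := hzr.2.trans (min_le_right _ _)
    rw [le_div_iff₀ hS] at this
    linarith
  have hn0 := norm_nonneg z.2
  have b1 : |xR z.1 z.2| ≤ mQ / 2 := (hx z hz1).trans (by nlinarith)
  have b2 : |yR z.1 z.2| ≤ mQ / 2 := (hy z hz1).trans (by nlinarith)
  have b3 : |zR z.1 z.2| ≤ mQ / 2 := (hz z hz1).trans (by nlinarith)
  have b4 : |yR z.1 z.2 * zR z.1 z.2| ≤ (mQ / 2) * (mQ / 2) := by rw [abs_mul]; gcongr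
  have b5 : xR z.1 z.2 ^ 2 ≤ (mQ / 2) ^ 2 := by rw [← sq_abs]; gcongr
  have b6 : modDet z.1 z.2 ≤ -(mQ ^ 2 / 2) := by
    unfold modDet
    nlinarith [le_abs_self (yR z.1 z.2 * zR z.1 z.2)]
  rw [abs_of_nonpos (by nlinarith [sq_nonneg mQ])]
  linarith

variable {ρ : ℝ}

lemma blip_pF (hk : IsKappa κ) (hρ : IsAdm ρ) : BLip (reg ρ) (fun z => pF κ z.1 z.2) :=
  have h0 := hρ.pos.le
  have hm := mQ_pos
  (((blip_s₁ hk h0).neg.bil isBil_mul ((blip_xR h0).sub (BLip.const mQ))).sub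
    ((blip_yR h0).bil isBil_mul (blip_s₂ hk h0))).bil isBil_mul
      ((blip_modDet h0).inv (by positivity) hρ.det)

lemma blip_aF (hk : IsKappa κ) (hρ : IsAdm ρ) : BLip (reg ρ) (fun z => aF κ z.1 z.2) :=
  have h0 := hρ.pos.le
  have hm := mQ_pos
  ((((BLip.const mQ).add (blip_xR h0)).neg.bil isBil_mul (blip_s₂ hk h0)).add
    ((blip_zR h0).bil isBil_mul (blip_s₁ hk h0))).bil isBil_mul
      ((blip_modDet h0).inv (by positivity) hρ.det)

/-- Every term of Cramer's numerator contains one of the sources s₁, s₂, each already of order two.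
-/
lemma ord_pF (hk : IsKappa κ) (hρ : IsAdm ρ) : OrdOn dev 2 (reg ρ) (fun z => pF κ z.1 z.2) :=
  have h0 := hρ.pos.le
  have hm := mQ_pos
  (((ord_s₁ hk hρ.le_one).neg.bil isBil_mul
      (OrdOn.of_BLip ((blip_xR h0).sub (BLip.const mQ))) dev_nonneg).sub
    ((OrdOn.of_BLip (blip_yR h0)).bil isBil_mul (ord_s₂ hk hρ.le_one) dev_nonneg)).bil isBil_mul
      (OrdOn.of_BLip ((blip_modDet h0).inv (by positivity) hρ.det)) dev_nonneg

lemma ord_aF (hk : IsKappa κ) (hρ : IsAdm ρ) : OrdOn dev 2 (reg ρ) (fun z => aF κ z.1 z.2) :=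
  have h0 := hρ.pos.le
  have hm := mQ_pos
  (((OrdOn.of_BLip ((BLip.const mQ).add (blip_xR h0)).neg).bil isBil_mul
      (ord_s₂ hk hρ.le_one) dev_nonneg).add
    ((OrdOn.of_BLip (blip_zR h0)).bil isBil_mul (ord_s₁ hk hρ.le_one) dev_nonneg)).bil isBil_mul
      (OrdOn.of_BLip ((blip_modDet h0).inv (by positivity) hρ.det)) dev_nonneg

lemma blip_PhiX (hk : IsKappa κ) (hρ : IsAdm ρ) : BLip (reg ρ) (fun z => PhiX κ z.1 z.2) :=
  have h0 := hρ.pos.le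
  ((((blip_pF hk hρ).bil isBil_smul blip_qX).add
    (((blip_pF hk hρ).sub hk.blip).bil isBil_smul (BLip.snd h0))).sub
      ((blip_aF hk hρ).bil isBil_smul_I blip_qpX)).add ((blip_linX h0).add (blip_nlX h0))

/-- The linearization at `α = 1`, `v = 0`. -/
def LamX (W : L2) : L2 := linX 1 W - W

lemma ord_linX_sub : OrdOn dev 2 (reg ρ) (fun z => linX z.1 z.2 - linX 1 z.2) := by
  have hq : OrdOn dev 1 (reg ρ) (fun z => qX z.1 - qX 1) := by
    refine ord_of_fst (f := qX) ?_
    obtain ⟨C, h0, -, h2⟩ := blip_qX (ρ := 0)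
    refine ⟨C, h0, fun α hα β hβ => (h2 (α, 0) ⟨hα, by simp⟩ (β, 0) ⟨hβ, by simp⟩).trans (le_of_eq ?_)⟩
    simp [Prod.dist_eq, Real.dist_eq]
  have key : ∀ g : ℝ × L2 → L2, OrdOn dev 1 (reg ρ) g → OrdOn dev 2 (reg ρ) (fun z =>
      mulX (qX z.1) (mulX (qX z.1) (g z)) - mulX (qX 1) (mulX (qX 1) (g z))) := by
    intro g hg
    have h1 := (OrdOn.of_BLip (blip_qX (ρ := ρ))).bil isBil_mulX (hq.bil isBil_mulX hg dev_nonneg)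
      dev_nonneg
    have h2 := hq.bil isBil_mulX ((OrdOn.of_BLip (BLip.const (S := reg ρ) (qX 1))).bil isBil_mulX hg
      dev_nonneg) dev_nonneg
    convert h1.add h2 using 2 with z
    simp only [map_sub, sub_apply]
    abel
  have h1 := (key _ ord_snd).lin (isLin_smul 2)
  have h2 := key _ (ord_snd.lin (isLin_clm conjL2))
  convert h1.add h2 using 2 with z
  simp only [linX, smul_sub]
  abel

/-- Everything but the linear potential at α = 1 and the term -κ(1)v is of order two: p and a are,
the variation of Q_α² and of κ multiplies v, and the rest is nonlinear. -/
lemma ord_PhiX_sub (hk : IsKappa κ) (hρ : IsAdm ρ) :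
    OrdOn dev 2 (reg ρ) (fun z => PhiX κ z.1 z.2 - LamX z.2) := by
  have h0 := hρ.pos.le
  have hone : OrdOn dev 1 (reg ρ) (fun z => κ z.1 - κ 1) := ord_of_fst hk.lip
  have h1 := (ord_pF hk hρ).bil isBil_smul (OrdOn.of_BLip blip_qX) dev_nonneg
  have h2 := (ord_pF hk hρ).bil isBil_smul (OrdOn.of_BLip (BLip.snd h0)) dev_nonneg
  have h3 := hone.bil isBil_smul ord_snd dev_nonneg
  have h4 := (ord_aF hk hρ).bil isBil_smul_I (OrdOn.of_BLip blip_qpX) dev_nonneg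
  have h5 := (((h1.add (h2.sub h3)).sub h4).add ord_linX_sub).add (ord_nlX hρ.le_one)
  convert h5 using 2 with z
  simp only [PhiX, fieldX, LamX, hk.one]
  push_cast
  module

lemma LamX_sub (W W' : L2) : LamX W - LamX W' = LamX (W - W') := by
  simp only [LamX, linX, map_sub]; module

lemma exists_norm_LamX_le : ∃ C, 0 ≤ C ∧ ∀ W, ‖LamX W‖ ≤ C * ‖W‖ := by
  obtain ⟨K, hK, hb⟩ := isBil_mulX.bound
  set q := ‖qX 1‖
  refine ⟨2 * (K * q * (K * q)) + K * q * (K * q) + 1, by positivity, fun W => ?_⟩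
  have e : ∀ W : L2, ‖mulX (qX 1) (mulX (qX 1) W)‖ ≤ K * q * (K * q) * ‖W‖ := fun W => by
    refine (hb _ _).trans ?_
    have := hb (qX 1) W
    calc _ ≤ K * q * (K * q * ‖W‖) := by gcongr
      _ = _ := by ring
  have e2 := e (conjL2 W)
  rw [norm_conjL2] at e2
  unfold LamX linX
  refine (norm_sub_le _ _).trans ?_
  have e3 := norm_add_le ((2 : ℂ) • mulX (qX 1) (mulX (qX 1) W))
    (mulX (qX 1) (mulX (qX 1) (conjL2 W)))
  rw [norm_smul, Complex.norm_ofNat] at e3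
  linarith [e W]

end

/-! ### Truncated dynamics, the stationary mode and the bootstrap -/

noncomputable section

/-! ### Continuity arguments -/

lemma lt_of_bootstrap {T r : ℝ} {g : ℝ → ℝ} (hg : ContinuousOn g (Icc (-T) T)) (h0 : g 0 < r)
    (h : ∀ τ, 0 < τ → τ ≤ T → (∀ t ∈ Icc (-τ) τ, g t ≤ r) → ∀ t ∈ Icc (-τ) τ, g t < r) :
    ∀ t ∈ Icc (-T) T, g t < r := by
  by_contra! hcon
  obtain ⟨t₁, ht₁, hr⟩ := hcon
  set f : ℝ → ℝ := fun τ => max (g τ) (g (-τ)) with hf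
  have hfc : ContinuousOn f (Icc 0 T) := by
    refine (hg.mono fun x hx => ⟨by linarith [hx.1, hx.2], hx.2⟩).sup (hg.comp continuousOn_neg ?_)
    exact fun x hx => ⟨by linarith [hx.2], by linarith [hx.1, hx.2]⟩
  have hA : IsCompact (Icc 0 T ∩ f ⁻¹' Ici r) :=
    isCompact_Icc.of_isClosed_subset (hfc.preimage_isClosed_of_isClosed isClosed_Icc isClosed_Ici)
      inter_subset_left
  have hne : (Icc 0 T ∩ f ⁻¹' Ici r).Nonempty := by
    refine ⟨|t₁|, ⟨abs_nonneg _, abs_le.2 ht₁⟩, ?_⟩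
    rcases abs_choice t₁ with h1 | h1 <;> simp [hf, h1, hr]
  -- The first radius at which g reaches r at either end. Up to it g ≤ r holds by continuity, and
  -- the hypothesis then gives the strict inequality at ±τ, a contradiction.
  obtain ⟨τ, ⟨⟨hτ0, hτT⟩, hτr⟩, hmin⟩ := hA.exists_isLeast hne
  have hlt : ∀ s, 0 ≤ s → s < τ → f s < r := fun s hs0 hs => by
    by_contra! hc
    exact absurd (hmin ⟨⟨hs0, by linarith⟩, hc⟩) (by linarith)
  have hτpos : 0 < τ := by
    rcases hτ0.lt_or_eq with h1 | h1
    · exact h1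
    · rw [← h1] at hτr
      simp only [hf, mem_preimage, mem_Ici, neg_zero, max_self] at hτr
      linarith
  have hle : f τ ≤ r := by
    have hcw : ContinuousWithinAt f (Ico 0 τ) τ :=
      (hfc τ ⟨hτ0, hτT⟩).mono fun x hx => ⟨hx.1, by linarith [hx.2]⟩
    have : (𝓝[Ico 0 τ] τ).NeBot := by
      rw [← mem_closure_iff_nhdsWithin_neBot, closure_Ico hτpos.ne]
      exact ⟨hτ0, le_rfl⟩
    exact le_of_tendsto hcw (eventually_nhdsWithin_of_forall fun s hs => (hlt s hs.1 hs.2).le)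
  have hall : ∀ t ∈ Icc (-τ) τ, g t ≤ r := by
    intro t ht
    have h1 : f |t| ≤ r := by
      rcases (abs_le.2 ht).lt_or_eq with h2 | h2
      · exact (hlt _ (abs_nonneg _) h2).le
      · rw [h2]; exact hle
    rcases abs_choice t with h2 | h2 <;> rw [h2] at h1
    · exact (le_max_left _ _).trans h1
    · have := (le_max_right _ _).trans h1
      rwa [neg_neg] at this
  have := h τ hτpos hτT hall
  have h1 := this τ ⟨by linarith, le_rfl⟩
  have h2 := this (-τ) ⟨le_rfl, by linarith⟩
  exact absurd (hτr : r ≤ f τ) (not_le.2 (max_lt h1 h2))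

lemma norm_le_of_gronwall {E : Type*} [NormedAddCommGroup E] [NormedSpace ℝ E] {τ K δ η : ℝ}
    (hK : 1 ≤ K) (hδ : 0 ≤ δ) (hη : 0 ≤ η) {D D' : ℝ → E}
    (hD : ∀ t ∈ Icc (-τ) τ, HasDerivWithinAt D (D' t) (Icc (-τ) τ) t)
    (h0 : ‖D 0‖ ≤ δ) (hD' : ∀ t ∈ Icc (-τ) τ, ‖D' t‖ ≤ K * ‖D t‖ + η) :
    ∀ t ∈ Icc (-τ) τ, ‖D t‖ ≤ (δ + η) * Real.exp (K * τ) := by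
  have key : ∀ D D' : ℝ → E, (∀ t ∈ Icc 0 τ, HasDerivWithinAt D (D' t) (Icc 0 τ) t) →
      ‖D 0‖ ≤ δ → (∀ t ∈ Icc 0 τ, ‖D' t‖ ≤ K * ‖D t‖ + η) →
      ∀ t ∈ Icc 0 τ, ‖D t‖ ≤ (δ + η) * Real.exp (K * τ) := by
    intro D D' hD h0 hD' t ht
    have h1 := norm_le_gronwallBound_of_norm_deriv_right_le (f := D) (f' := D') (a := 0) (b := τ)
      (fun t ht => (hD t ht).continuousWithinAt)
      (fun t ht => (hD t ⟨ht.1, ht.2.le⟩).mono_of_mem_nhdsWithin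
        (mem_of_superset (Icc_mem_nhdsGE ht.2) (Icc_subset_Icc_left ht.1)))
      h0 (fun t ht => hD' t ⟨ht.1, ht.2.le⟩) t ht
    refine h1.trans ?_
    rw [sub_zero, gronwallBound_of_K_ne_0 (by linarith)]
    have h2 : Real.exp (K * t) ≤ Real.exp (K * τ) := by
      apply Real.exp_le_exp.2; have := ht.2; gcongr
    -- The assumption 1 ≤ K serves to replace the sharp constant η / K by η.
    have h3 : η / K ≤ η := div_le_self hη hK
    have h4 : 0 ≤ η / K := by positivity
    have h5 : 0 < Real.exp (K * t) := Real.exp_pos _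
    calc δ * Real.exp (K * t) + η / K * (Real.exp (K * t) - 1)
        ≤ δ * Real.exp (K * t) + η / K * Real.exp (K * t) := by gcongr; linarith
      _ = (δ + η / K) * Real.exp (K * t) := by ring
      _ ≤ (δ + η) * Real.exp (K * τ) := by gcongr
  intro t ht
  have hτ : 0 ≤ τ := by linarith [ht.1, ht.2]
  rcases le_total 0 t with h | h
  · exact key D D' (fun s hs => (hD s ⟨by linarith [hs.1], hs.2⟩).mono
      (Icc_subset_Icc_left (by linarith))) h0 (fun s hs => hD' s ⟨by linarith [hs.1], hs.2⟩) t ⟨h, ht.2⟩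
  -- Negative times follow from the forward estimate by time reversal.
  · have := key (fun s => D (-s)) (fun s => -D' (-s)) (fun s hs => by
        have h1 : HasDerivWithinAt D (D' (-s)) (Icc (-τ) τ) (-s) :=
          hD (-s) ⟨by linarith [hs.2], by linarith [hs.1]⟩
        have h2 := h1.scomp (h := fun s => -s) (s := Icc 0 τ) s (hasDerivAt_neg s).hasDerivWithinAt
          (fun r hr => ⟨by linarith [hr.2], by linarith [hr.1]⟩)
        rw [neg_one_smul] at h2
        exact h2)
      (by simpa using h0) (fun s hs => by
        rw [norm_neg]; exact hD' (-s) ⟨by linarith [hs.2], by linarith [hs.1]⟩) (-t)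
      ⟨by linarith, by linarith [ht.1]⟩
    simpa using this

/-! ### The truncated system -/

/-- The radial retraction onto the ball of radius `ρ`. -/
def rad (ρ : ℝ) (W : L2) : L2 := (ρ / max ρ ‖W‖) • W

lemma norm_rad_le {ρ : ℝ} (hρ : 0 < ρ) (W : L2) : ‖rad ρ W‖ ≤ ρ := by
  have h : 0 < max ρ ‖W‖ := lt_max_of_lt_left hρ
  rw [rad, norm_smul, Real.norm_of_nonneg (by positivity), div_mul_eq_mul_div, div_le_iff₀ h]
  gcongr
  exact le_max_right _ _

lemma rad_of_le {ρ : ℝ} (hρ : 0 < ρ) {W : L2} (h : ‖W‖ ≤ ρ) : rad ρ W = W := by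
  rw [rad, max_eq_left h, div_self hρ.ne', one_smul]

lemma norm_rad_sub_le {ρ : ℝ} (hρ : 0 < ρ) (W W' : L2) : ‖rad ρ W - rad ρ W'‖ ≤ 2 * ‖W - W'‖ := by
  have ha : 0 < max ρ ‖W‖ := lt_max_of_lt_left hρ
  have hb : 0 < max ρ ‖W'‖ := lt_max_of_lt_left hρ
  have e : rad ρ W - rad ρ W' = (ρ / max ρ ‖W‖) • (W - W') +
      (ρ / max ρ ‖W‖ - ρ / max ρ ‖W'‖) • W' := by
    rw [rad, rad]; module
  rw [e]
  refine (norm_add_le _ _).trans ?_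
  rw [norm_smul, norm_smul, Real.norm_of_nonneg (by positivity), Real.norm_eq_abs]
  have h1 : ρ / max ρ ‖W‖ ≤ 1 := (div_le_one ha).2 (le_max_left _ _)
  have h2 : |ρ / max ρ ‖W‖ - ρ / max ρ ‖W'‖| * ‖W'‖ ≤ ‖W - W'‖ := by
    rw [div_sub_div _ _ ha.ne' hb.ne', abs_div, abs_of_pos (mul_pos ha hb), div_mul_eq_mul_div,
      div_le_iff₀ (mul_pos ha hb), mul_comm (max ρ ‖W‖) ρ, ← mul_sub, abs_mul, abs_of_pos hρ]
    have h3 : |max ρ ‖W'‖ - max ρ ‖W‖| ≤ ‖W - W'‖ := by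
      refine (abs_max_sub_max_le_max _ _ _ _).trans ?_
      rw [sub_self, abs_zero, max_eq_right (abs_nonneg _), norm_sub_rev]
      exact abs_norm_sub_norm_le _ _
    have h4 : ρ ≤ max ρ ‖W‖ := le_max_left _ _
    have h5 : ‖W'‖ ≤ max ρ ‖W'‖ := le_max_right _ _
    calc ρ * |max ρ ‖W'‖ - max ρ ‖W‖| * ‖W'‖
        ≤ max ρ ‖W‖ * ‖W - W'‖ * max ρ ‖W'‖ := by gcongr
      _ = _ := by ring
  have h3 : ρ / max ρ ‖W‖ * ‖W - W'‖ ≤ 1 * ‖W - W'‖ := by gcongr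
  linarith

/-- The truncation of the parameter. -/
def clampI (α : ℝ) : ℝ := max (1 / 2) (min (3 / 2) α)

lemma clampI_mem (α : ℝ) : clampI α ∈ dilI :=
  ⟨le_max_left _ _, max_le (by norm_num) (min_le_left _ _)⟩

lemma clampI_of_mem {α : ℝ} (h : α ∈ dilI) : clampI α = α := by
  rw [clampI, min_eq_right h.2, max_eq_right h.1]

lemma abs_clampI_sub_le (α β : ℝ) : |clampI α - clampI β| ≤ |α - β| := by
  have h1 : |clampI α - clampI β| ≤ |min (3 / 2) α - min (3 / 2) β| :=
    (abs_max_sub_max_le_max _ _ _ _).trans (by simp)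
  exact h1.trans ((abs_min_sub_min_le_max _ _ _ _).trans (by simp))

/-- The truncated point `(α, v)` of a state `(z, α, θ)`, with `v = U t z`. -/
def trunc (ρ t : ℝ) (s : L2 × ℝ × ℝ) : ℝ × L2 := (clampI s.2.1, rad ρ (U t s.1))

lemma trunc_mem {ρ : ℝ} (hρ : 0 < ρ) (t : ℝ) (s : L2 × ℝ × ℝ) : trunc ρ t s ∈ reg ρ :=
  ⟨clampI_mem _, norm_rad_le hρ _⟩

lemma trunc_of_mem {ρ : ℝ} (hρ : 0 < ρ) {t : ℝ} {s : L2 × ℝ × ℝ} (h1 : s.2.1 ∈ dilI)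
    (h2 : ‖s.1‖ ≤ ρ) : trunc ρ t s = (s.2.1, U t s.1) := by
  rw [trunc, clampI_of_mem h1, rad_of_le hρ (by rwa [norm_U])]

lemma dist_trunc_le {ρ : ℝ} (hρ : 0 < ρ) (t : ℝ) (s s' : L2 × ℝ × ℝ) :
    dist (trunc ρ t s) (trunc ρ t s') ≤ 2 * dist s s' := by
  rw [Prod.dist_eq]
  have h0 := dist_nonneg (x := s) (y := s')
  have h1 : dist s.1 s'.1 ≤ dist s s' := by rw [Prod.dist_eq (x := s)]; exact le_max_left _ _
  have h2 : dist s.2.1 s'.2.1 ≤ dist s s' := by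
    rw [Prod.dist_eq (x := s), Prod.dist_eq (x := s.2)]
    exact (le_max_left _ _).trans (le_max_right _ _)
  refine max_le ?_ ?_
  · have := abs_clampI_sub_le s.2.1 s'.2.1
    rw [← Real.dist_eq, ← Real.dist_eq] at this
    simp only [trunc]
    linarith
  · have := norm_rad_sub_le hρ (U t s.1) (U t s'.1)
    rw [← map_sub, norm_U, ← dist_eq_norm, ← dist_eq_norm] at this
    simp only [trunc]
    linarith

/-- The truncated field in the interaction picture. -/
def truncField (κ : ℝ → ℝ) (ρ t : ℝ) (s : L2 × ℝ × ℝ) : L2 × ℝ × ℝ :=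
  (U (-t) (-Complex.I • PhiX κ (trunc ρ t s).1 (trunc ρ t s).2),
    aF κ (trunc ρ t s).1 (trunc ρ t s).2,
    pF κ (trunc ρ t s).1 (trunc ρ t s).2 - κ (trunc ρ t s).1)

variable {κ : ℝ → ℝ} {ρ : ℝ}

lemma norm_neg_I_smul (W : L2) : ‖-Complex.I • W‖ = ‖W‖ := by
  rw [norm_smul, norm_neg, Complex.norm_I, one_mul]

/-- The truncation keeps its argument in `reg ρ` and is 2-Lipschitz, and the propagator is
isometric. So the local bounds of the field become global and uniform in t. -/
lemma exists_truncField_bound (hk : IsKappa κ) (hρ : IsAdm ρ) : ∃ C, 0 ≤ C ∧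
    (∀ t s, ‖truncField κ ρ t s‖ ≤ C) ∧
    ∀ t s s', dist (truncField κ ρ t s) (truncField κ ρ t s') ≤ C * dist s s' := by
  obtain ⟨C₁, h0, h1, h2⟩ := blip_PhiX hk hρ
  obtain ⟨C₂, h0', h1', h2'⟩ := blip_aF hk hρ
  obtain ⟨C₃, h0'', h1'', h2''⟩ := (blip_pF hk hρ).sub hk.blip
  have hm := fun t s => trunc_mem hρ.pos t s
  refine ⟨2 * (C₁ + C₂ + C₃), by positivity, fun t s => ?_, fun t s s' => ?_⟩
  · have e1 := h1 _ (hm t s)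
    have e2 := h1' _ (hm t s)
    have e3 := h1'' _ (hm t s)
    rw [Prod.norm_def, Prod.norm_def]
    refine max_le ?_ (max_le ?_ ?_)
    · rw [truncField, norm_U, norm_neg_I_smul]; linarith
    · simp only [truncField]; linarith
    · simp only [truncField]; linarith
  · have hd := dist_trunc_le hρ.pos t s s'
    have e1 := h2 _ (hm t s) _ (hm t s')
    have e2 := h2' _ (hm t s) _ (hm t s')
    have e3 := h2'' _ (hm t s) _ (hm t s')
    have f : ∀ C, 0 ≤ C → C ≤ C₁ + C₂ + C₃ → C * dist (trunc ρ t s) (trunc ρ t s') ≤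
        2 * (C₁ + C₂ + C₃) * dist s s' := fun C hC hC' => by
      calc _ ≤ (C₁ + C₂ + C₃) * (2 * dist s s') := by gcongr
        _ = _ := by ring
    rw [Prod.dist_eq, Prod.dist_eq]
    refine max_le ?_ (max_le ?_ ?_)
    · simp only [truncField]
      rw [dist_eq_norm, ← map_sub, norm_U, ← smul_sub, norm_neg_I_smul]
      exact e1.trans (f _ h0 (by linarith))
    · rw [dist_eq_norm]; exact e2.trans (f _ h0' (by linarith))
    · rw [dist_eq_norm]; exact e3.trans (f _ h0'' (by linarith))

lemma BLip.continuousOn {E : Type*} [NormedAddCommGroup E] {Z : Type*} [PseudoMetricSpace Z]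
    {S : Set Z} {f : Z → E} (hf : BLip S f) : ContinuousOn f S := by
  obtain ⟨C, h0, -, h2⟩ := hf
  have hl : LipschitzOnWith ⟨C, h0⟩ f S := LipschitzOnWith.of_dist_le_mul fun x hx y hy => by
    rw [dist_eq_norm]; exact h2 x hx y hy
  exact hl.continuousOn

lemma BLip.continuous_comp {E Y : Type*} [NormedAddCommGroup E] [TopologicalSpace Y]
    {Z : Type*} [PseudoMetricSpace Z] {S : Set Z} {f : Z → E} (hf : BLip S f) {g : Y → Z}
    (hg : Continuous g) (hS : ∀ y, g y ∈ S) : Continuous (fun y => f (g y)) :=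
  hf.continuousOn.comp_continuous hg hS

lemma continuous_rad (hρ : 0 < ρ) : Continuous (rad ρ) := by
  unfold rad
  refine Continuous.smul (Continuous.div continuous_const (continuous_const.max continuous_norm) fun W => ?_) continuous_id
  exact (lt_max_of_lt_left hρ).ne'

lemma continuous_truncField (hk : IsKappa κ) (hρ : IsAdm ρ) (s : L2 × ℝ × ℝ) :
    Continuous (fun t => truncField κ ρ t s) := by
  have hg : Continuous (fun t => trunc ρ t s) :=
    continuous_const.prodMk ((continuous_rad hρ.pos).comp (continuous_U_apply s.1))
  have hS := fun t => trunc_mem hρ.pos t s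
  exact (continuous_U.comp (continuous_neg.prodMk
    (((blip_PhiX hk hρ).continuous_comp hg hS).const_smul (-Complex.I)))).prodMk
      (((blip_aF hk hρ).continuous_comp hg hS).prodMk
        (((blip_pF hk hρ).sub hk.blip).continuous_comp hg hS))

/-- Trajectories of the truncated system. -/
def IsTraj (κ : ℝ → ℝ) (ρ T : ℝ) (s : ℝ → L2 × ℝ × ℝ) : Prop :=
  ∀ t ∈ Icc (-T) T, HasDerivWithinAt s (truncField κ ρ t (s t)) (Icc (-T) T) t

lemma exists_isTraj (hk : IsKappa κ) (hρ : IsAdm ρ) {T : ℝ} (hT : 0 < T) (s₀ : L2 × ℝ × ℝ) :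
    ∃ s, s 0 = s₀ ∧ IsTraj κ ρ T s := by
  obtain ⟨C, h0, h1, h2⟩ := exists_truncField_bound hk hρ
  -- The ball of radius C·T cannot be left within time T at speed at most C, so T is arbitrary.
  have hP : IsPicardLindelof (truncField κ ρ) (tmin := -T) (tmax := T)
      ⟨0, by constructor <;> linarith⟩ s₀ (⟨C, h0⟩ * ⟨T, hT.le⟩) 0 ⟨C, h0⟩ ⟨C, h0⟩ := {
    lipschitzOnWith := fun t _ => LipschitzOnWith.of_dist_le_mul fun x _ y _ => h2 t x y
    continuousOn := fun x _ => (continuous_truncField hk hρ x).continuousOn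
    norm_le := fun t _ x _ => h1 t x
    mul_max_le := by simp; exact le_rfl }
  exact hP.exists_eq_forall_mem_Icc_hasDerivWithinAt₀

lemma isTraj_unique (hk : IsKappa κ) (hρ : IsAdm ρ) {T : ℝ} (hT : 0 < T) {s s' : ℝ → L2 × ℝ × ℝ}
    (hs : IsTraj κ ρ T s) (hs' : IsTraj κ ρ T s') (h : s 0 = s' 0) : EqOn s s' (Icc (-T) T) := by
  obtain ⟨C, h0, -, h2⟩ := exists_truncField_bound hk hρ
  refine ODE_solution_unique_of_mem_Icc (v := truncField κ ρ) (s := fun _ => univ) (K := ⟨C, h0⟩)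
    (t₀ := 0) (fun t _ => LipschitzOnWith.of_dist_le_mul fun x _ y _ => h2 t x y)
    ⟨by linarith, hT⟩ (fun t ht => (hs t ht).continuousWithinAt)
    (fun t ht => (hs t ⟨ht.1.le, ht.2.le⟩).hasDerivAt (Icc_mem_nhds ht.1 ht.2)) (fun _ _ => mem_univ _)
    (fun t ht => (hs' t ht).continuousWithinAt)
    (fun t ht => (hs' t ⟨ht.1.le, ht.2.le⟩).hasDerivAt (Icc_mem_nhds ht.1 ht.2)) (fun _ _ => mem_univ _) h

lemma IsTraj.mono {T τ : ℝ} (hτ : τ ≤ T) {s : ℝ → L2 × ℝ × ℝ} (hs : IsTraj κ ρ T s) :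
    IsTraj κ ρ τ s := fun t ht =>
  have hsub : Icc (-τ) τ ⊆ Icc (-T) T := Icc_subset_Icc (by linarith) hτ
  (hs t (hsub ht)).mono hsub

/-! ### The stationary mode `i ∂_x Q` -/

/-- The mode `a i ∂_x Q`. -/
def modeX (a : ℝ) : L2 := (a * Complex.I) • iota (dS qS)

lemma J_modeX_ae (a : ℝ) : J (modeX a) =ᵐ[volume] fun x => a * (Complex.I * dxQ x) := by
  rw [modeX, map_smul, J_iota]
  filter_upwards [Lp.coeFn_smul (a * Complex.I) (toL2 (dS qS)), toL2_ae (dS qS)] with x h1 h2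
  rw [h1, Pi.smul_apply, h2, dS_qS_apply, smul_eq_mul, mul_assoc]

lemma QS_one : QS 1 = qS := by rw [QS, dil_one, Complex.ofReal_one, one_smul]

lemma QpS_one : QpS 1 = qgS := dil_one _

lemma J_qX_one_ae : J (qX 1) =ᵐ[volume] fun x => (Q x : ℂ) := by
  rw [qX, QS_one, J_iota]
  filter_upwards [toL2_ae qS] with x h
  rw [h, qS_apply]

lemma J_linX_one_ae (W : L2) : J (linX 1 W) =ᵐ[volume] fun x =>
    2 * (Q x : ℂ) ^ 2 * J W x + (Q x : ℂ) ^ 2 * conj (J W (-x)) := by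
  rw [linX, map_add, map_smul]
  filter_upwards [Lp.coeFn_add ((2 : ℂ) • J (mulX (qX 1) (mulX (qX 1) W)))
      (J (mulX (qX 1) (mulX (qX 1) (conjL2 W)))),
    Lp.coeFn_smul (2 : ℂ) (J (mulX (qX 1) (mulX (qX 1) W))),
    J_mulX_ae (qX 1) (mulX (qX 1) W), J_mulX_ae (qX 1) W,
    J_mulX_ae (qX 1) (mulX (qX 1) (conjL2 W)), J_mulX_ae (qX 1) (conjL2 W), J_conjL2_ae W,
    J_qX_one_ae] with x h1 h2 h3 h4 h5 h6 h7 h8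
  rw [h1, Pi.add_apply, h2, Pi.smul_apply, h3, h4, h5, h6, h7, h8, smul_eq_mul]
  ring

/-- The function v = i∂_xQ satisfies v* = v, as oddness and conjugation each contribute a sign.
Hence the potential acts as 3Q², and (3Q² - 1)∂_xQ = -∂_x³Q. -/
lemma LamX_modeX (a : ℝ) : LamX (modeX a) = -((a * Complex.I) • iota (dS (dS (dS qS)))) := by
  apply J_injective
  rw [LamX, map_sub, map_neg, map_smul, J_iota]
  apply Lp.ext
  filter_upwards [Lp.coeFn_sub (J (linX 1 (modeX a))) (J (modeX a)), J_linX_one_ae (modeX a),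
    J_modeX_ae a, ae_neg (J_modeX_ae a), Lp.coeFn_neg ((a * Complex.I) • toL2 (dS (dS (dS qS)))),
    Lp.coeFn_smul (a * Complex.I) (toL2 (dS (dS (dS qS)))), toL2_ae (dS (dS (dS qS)))]
    with x h1 h2 h3 h4 h5 h6 h7
  rw [h1, Pi.sub_apply, h2, h3, h4, h5, Pi.neg_apply, h6, Pi.smul_apply, h7, dS_dS_dS_qS_apply,
    dxQ_neg, smul_eq_mul]
  simp only [map_mul, Complex.conj_ofReal, Complex.conj_I, Complex.ofReal_neg, map_neg]
  ring

/-- The constant curve solves the linearized equation weakly, its two sides cancelling after two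
integrations by parts; passing to the interaction picture gives the derivative. -/
lemma hasDerivWithinAt_modeX (a : ℝ) {τ : ℝ} (hτ : 0 < τ) : ∀ t ∈ Icc (-τ) τ,
    HasDerivWithinAt (fun s => U (-s) (modeX a)) (U (-t) (-Complex.I • LamX (modeX a)))
      (Icc (-τ) τ) t := by
  refine hasDerivWithinAt_of_weakSol (W := fun _ => modeX a) (F := fun _ => LamX (modeX a)) hτ
    continuousOn_const continuousOn_const fun φ t _ => ?_
  refine (hasDerivWithinAt_const _ _ _).congr_deriv ?_
  rw [LamX_modeX, modeX, map_neg, map_smul, map_smul, J_iota, J_iota]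
  simp only [map_neg, map_smul, neg_apply, smul_apply]
  rw [pair_dS, pair_dS]
  ring

/-! ### A priori bounds -/

/-- The time bound gives e^{kT} ≤ ε^{-1/2}, so the left side is at most B ε^{1/2}, which is at most
1 for ε ≤ B⁻². -/
lemma exists_mul_exp_le {k B M ρ : ℝ} (hk : 0 < k) (hB : 0 < B) (hM : 0 < M) (hρ : 0 < ρ) :
    ∃ ε₀ : ℝ, 0 < ε₀ ∧ ε₀ < 1 ∧ M * ε₀ ≤ ρ ∧ ∀ ε, 0 < ε → ε ≤ ε₀ → ∀ T,
      T ≤ 1 / (2 * k) * Real.log (1 / ε) → B * ε * Real.exp (k * T) ≤ 1 := by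
  have hB2 : 0 < 1 / B ^ 2 := by positivity
  have hρM : 0 < ρ / M := by positivity
  refine ⟨min (1 / 2) (min (1 / B ^ 2) (ρ / M)), lt_min (by norm_num) (lt_min hB2 hρM),
    (min_le_left _ _).trans_lt (by norm_num), ?_, fun ε hε hεle T hT => ?_⟩
  · rw [mul_comm, ← le_div_iff₀ hM]
    exact (min_le_right _ _).trans (min_le_right _ _)
  · have hεB : ε * B ^ 2 ≤ 1 := by
      rw [← le_div_iff₀ (by positivity)]
      exact hεle.trans ((min_le_right _ _).trans (min_le_left _ _))
    have h1 : Real.exp (k * T) ^ 2 ≤ 1 / ε := by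
      rw [← Real.exp_nat_mul]
      conv_rhs => rw [← Real.exp_log (show 0 < 1 / ε by positivity)]
      apply Real.exp_le_exp.2
      calc ((2 : ℕ) : ℝ) * (k * T) = 2 * k * T := by push_cast; ring
        _ ≤ 2 * k * (1 / (2 * k) * Real.log (1 / ε)) := by gcongr
        _ = Real.log (1 / ε) := by field_simp
    have h2 : Real.exp (k * T) ^ 2 * ε ≤ 1 := by rwa [← le_div_iff₀ hε]
    have h3 : (B * ε * Real.exp (k * T)) ^ 2 ≤ 1 := by
      calc (B * ε * Real.exp (k * T)) ^ 2 = (ε * B ^ 2) * (Real.exp (k * T) ^ 2 * ε) := by ring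
        _ ≤ 1 * 1 := by gcongr
        _ = 1 := one_mul 1
    exact (sq_le_one_iff₀ (by positivity)).1 h3

lemma trunc_of_small (hρ : IsAdm ρ) {t : ℝ} {s : L2 × ℝ × ℝ} (h1 : ‖s.1‖ ≤ ρ)
    (h2 : |s.2.1 - 1| ≤ ρ) : s.2.1 ∈ dilI ∧ trunc ρ t s = (s.2.1, U t s.1) ∧
      (s.2.1, U t s.1) ∈ reg ρ := by
  have h3 := abs_le.1 (h2.trans hρ.le_half)
  have h4 : s.2.1 ∈ dilI := ⟨by linarith, by linarith⟩
  have h5 := trunc_of_mem hρ.pos (t := t) h4 h1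
  exact ⟨h4, h5, h5 ▸ trunc_mem hρ.pos t s⟩

lemma truncField_of_small (hρ : IsAdm ρ) {t : ℝ} {s : L2 × ℝ × ℝ} (h1 : ‖s.1‖ ≤ ρ)
    (h2 : |s.2.1 - 1| ≤ ρ) : truncField κ ρ t s =
      (U (-t) (-Complex.I • PhiX κ s.2.1 (U t s.1)), aF κ s.2.1 (U t s.1),
        pF κ s.2.1 (U t s.1) - κ s.2.1) := by
  rw [truncField, (trunc_of_small hρ h1 h2).2.1]

/-- Under smallness r, the error D = z - U(-t)(mode) has ‖D'‖ ≤ CL ‖D‖ + O(r²), since the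
linearization is bounded and the mode solves it exactly. Gronwall then suffices; no spectral
information is used. -/
lemma exists_traj_bounds (hk : IsKappa κ) (hρ : IsAdm ρ) :
    ∃ C k : ℝ, 0 < C ∧ 1 ≤ k ∧
      (∀ (t r : ℝ) (s : L2 × ℝ × ℝ), r ≤ ρ → ‖s.1‖ ≤ r → |s.2.1 - 1| ≤ r →
        |pF κ s.2.1 (U t s.1)| + |aF κ s.2.1 (U t s.1)| ≤ C * r ^ 2) ∧
      ∀ (τ r a δ : ℝ) (s : ℝ → L2 × ℝ × ℝ), 0 < τ → 0 ≤ δ → r ≤ ρ → IsTraj κ ρ τ s →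
        ‖(s 0).1 - modeX a‖ ≤ δ → (∀ t ∈ Icc (-τ) τ, ‖(s t).1‖ ≤ r ∧ |(s t).2.1 - 1| ≤ r) →
        ∀ t ∈ Icc (-τ) τ, ‖(s t).1 - U (-t) (modeX a)‖ ≤ (δ + C * r ^ 2) * Real.exp (k * τ) ∧
          |(s t).2.1 - (s 0).2.1| ≤ C * r ^ 2 * |t| := by
  obtain ⟨Cp, hp0, hp⟩ := ord_pF hk hρ
  obtain ⟨Ca, ha0, ha⟩ := ord_aF hk hρ
  obtain ⟨Cf, hf0, hf⟩ := ord_PhiX_sub hk hρ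
  obtain ⟨CL, hL0, hL⟩ := exists_norm_LamX_le
  have hdev : ∀ (t r : ℝ) (s : L2 × ℝ × ℝ), ‖s.1‖ ≤ r → |s.2.1 - 1| ≤ r →
      dev (s.2.1, U t s.1) ^ 2 ≤ 4 * r ^ 2 := fun t r s h1 h2 => by
    have h3 : dev (s.2.1, U t s.1) ≤ 2 * r := by simp only [dev, norm_U]; linarith
    have h4 := dev_nonneg (s.2.1, U t s.1)
    calc _ ≤ (2 * r) ^ 2 := by gcongr
      _ = _ := by ring
  refine ⟨4 * (Cp + Ca + Cf) + 1, CL + 1, by positivity, by linarith, ?_, ?_⟩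
  · intro t r s hr h1 h2
    have h3 := (trunc_of_small hρ (t := t) (h1.trans hr) (h2.trans hr)).2.2
    have h4 := (hp _ h3).trans (mul_le_mul_of_nonneg_left (hdev t r s h1 h2) hp0)
    have h5 := (ha _ h3).trans (mul_le_mul_of_nonneg_left (hdev t r s h1 h2) ha0)
    rw [Real.norm_eq_abs] at h4 h5
    have h6 : 0 ≤ Cf * r ^ 2 := by positivity
    have h7 := sq_nonneg r
    simp only at h4 h5
    linarith
  · intro τ r a δ s hτ hδ hr hs h0 hle
    have h0τ : (0 : ℝ) ∈ Icc (-τ) τ := ⟨by linarith, hτ.le⟩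
    have hC : Cf * (4 * r ^ 2) ≤ (4 * (Cp + Ca + Cf) + 1) * r ^ 2 := by
      have h6 : 0 ≤ (4 * (Cp + Ca) + 1) * r ^ 2 := by positivity
      linarith
    have hC' : Ca * (4 * r ^ 2) ≤ (4 * (Cp + Ca + Cf) + 1) * r ^ 2 := by
      have h6 : 0 ≤ (4 * (Cp + Cf) + 1) * r ^ 2 := by positivity
      linarith
    have hreg : ∀ t ∈ Icc (-τ) τ, ((s t).2.1, U t (s t).1) ∈ reg ρ := fun t ht =>
      (trunc_of_small hρ ((hle t ht).1.trans hr) ((hle t ht).2.trans hr)).2.2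
    have hder : ∀ t ∈ Icc (-τ) τ, HasDerivWithinAt s (U (-t) (-Complex.I • PhiX κ (s t).2.1
        (U t (s t).1)), aF κ (s t).2.1 (U t (s t).1), pF κ (s t).2.1 (U t (s t).1) - κ (s t).2.1)
        (Icc (-τ) τ) t := fun t ht => by
      rw [← truncField_of_small hρ ((hle t ht).1.trans hr) ((hle t ht).2.trans hr)]
      exact hs t ht
    intro t ht
    constructor
    · refine norm_le_of_gronwall (D := fun t => (s t).1 - U (-t) (modeX a)) (D' := fun t =>
        U (-t) (-Complex.I • (PhiX κ (s t).2.1 (U t (s t).1) - LamX (modeX a))))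
        (by linarith) hδ (by positivity) (fun t ht => ?_) (by
          rw [neg_zero, U_zero]; exact h0) (fun t ht => ?_) t ht
      · have h1 : HasDerivWithinAt (fun q => (s q).1) _ _ t := (hder t ht).fst
        rw [smul_sub, map_sub]
        exact h1.sub (hasDerivWithinAt_modeX a hτ t ht)
      · rw [norm_U, norm_neg_I_smul]
        have h1 := hf _ (hreg t ht)
        have h2 := hL (U t (s t).1 - modeX a)
        rw [← LamX_sub] at h2
        have h3 : ‖U t (s t).1 - modeX a‖ = ‖(s t).1 - U (-t) (modeX a)‖ := by
          rw [← norm_U (-t), map_sub, U_neg_U]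
        rw [h3] at h2
        have h4 := mul_le_mul_of_nonneg_left (hdev t r (s t) (hle t ht).1 (hle t ht).2) hf0
        have h5 := norm_add_le (PhiX κ (s t).2.1 (U t (s t).1) - LamX (U t (s t).1))
          (LamX (U t (s t).1) - LamX (modeX a))
        rw [sub_add_sub_cancel] at h5
        have h6 := norm_nonneg ((s t).1 - U (-t) (modeX a))
        simp only at h1
        linarith
    · have h1 : ∀ q ∈ Icc (-τ) τ, ‖aF κ (s q).2.1 (U q (s q).1)‖ ≤ Ca * (4 * r ^ 2) :=
        fun q hq => (ha _ (hreg q hq)).trans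
          (mul_le_mul_of_nonneg_left (hdev q r (s q) (hle q hq).1 (hle q hq).2) ha0)
      have h3 := (convex_Icc (-τ) τ).norm_image_sub_le_of_norm_hasDerivWithin_le
        (f := fun q => (s q).2.1) (fun q hq => (hder q hq).snd.fst) h1 h0τ ht
      rw [Real.norm_eq_abs, Real.norm_eq_abs, sub_zero] at h3
      exact h3.trans (by gcongr)

lemma norm_modeX (a : ℝ) : ‖modeX a‖ = |a| * ‖iota (dS qS)‖ := by
  rw [modeX, norm_smul, norm_mul, Complex.norm_I, Complex.norm_real, mul_one, Real.norm_eq_abs]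

lemma exists_apriori (hk : IsKappa κ) (hρ : IsAdm ρ) {K : ℝ} (hK : 0 < K) :
    ∃ c M C ε₀ : ℝ, 0 < c ∧ 0 < M ∧ 0 < C ∧ 0 < ε₀ ∧ ε₀ < 1 ∧ M * ε₀ ≤ ρ ∧
      ∀ ε, 0 < ε → ε ≤ ε₀ → ∀ (T a : ℝ) (s : ℝ → L2 × ℝ × ℝ), T ≤ c * Real.log (1 / ε) →
        0 < T → IsTraj κ ρ T s → |a| ≤ K * ε → ‖(s 0).1 - modeX a‖ ≤ K * ε ^ 2 →
        |(s 0).2.1 - 1| ≤ K * ε →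
        ∀ t ∈ Icc (-T) T, ‖(s t).1‖ < M * ε ∧ |(s t).2.1 - 1| < M * ε ∧
          |pF κ (s t).2.1 (U t (s t).1)| + |aF κ (s t).2.1 (U t (s t).1)| ≤ C * ε ^ 2 := by
  obtain ⟨C, k, hC, hk1, hsmall, htraj⟩ := exists_traj_bounds hk hρ
  have hk0 : 0 < k := by linarith
  set n := ‖iota (dS qS)‖ with hn
  have hn0 : 0 ≤ n := norm_nonneg _
  -- K·n bounds the mode and K the initial value of α - 1. The growth over [-T, T] costs at most one
  -- ε, and the remaining ε makes the bootstrap inequality strict.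
  obtain ⟨M, hM⟩ : ∃ M, M = K * n + K + 2 := ⟨_, rfl⟩
  have hM0 : 0 < M := by rw [hM]; positivity
  obtain ⟨ε₀, h0, h1, hMρ, hexp⟩ := exists_mul_exp_le (B := K + C * M ^ 2) hk0 (by positivity)
    hM0 hρ.pos
  refine ⟨1 / (2 * k), M, C * M ^ 2, ε₀, by positivity, hM0, by positivity, h0, h1, hMρ, ?_⟩
  intro ε hε hεle T a s hTc hT hs haε hs1 hs2
  have hMε : M * ε ≤ ρ := (by gcongr : M * ε ≤ M * ε₀).trans hMρ
  have hBE := hexp ε hε hεle T hTc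
  have hE1 : 1 ≤ Real.exp (k * T) := Real.one_le_exp (by positivity)
  have hTE : T ≤ Real.exp (k * T) := by
    have e1 := Real.add_one_le_exp (k * T)
    have e2 : 1 * T ≤ k * T := by gcongr
    linarith
  have hmode : ‖modeX a‖ ≤ K * n * ε := by
    rw [norm_modeX]
    calc _ ≤ K * ε * n := by gcongr
      _ = _ := by ring
  have hMe : M * ε = K * n * ε + K * ε + 2 * ε := by rw [hM]; ring
  have hKε0 : 0 < K * ε := by positivity
  have hKn : 0 ≤ K * n * ε := by positivity
  -- This quadratic quantity times e^{kT} controls the error of v, the drift of α (because T ≤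
  -- e^{kT}), and the initial error.
  have hgrow : (K * ε ^ 2 + C * (M * ε) ^ 2) * Real.exp (k * T) ≤ ε := by
    calc _ = ε * ((K + C * M ^ 2) * ε * Real.exp (k * T)) := by ring
      _ ≤ ε * 1 := by gcongr
      _ = ε := mul_one _
  have hKε : K * ε ^ 2 ≤ ε := by
    refine le_trans ?_ hgrow
    calc K * ε ^ 2 ≤ K * ε ^ 2 + C * (M * ε) ^ 2 := le_add_of_nonneg_right (by positivity)
      _ ≤ _ := le_mul_of_one_le_right (by positivity) hE1
  have main : ∀ t ∈ Icc (-T) T, max ‖(s t).1‖ |(s t).2.1 - 1| < M * ε := by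
    have hcont : ContinuousOn s (Icc (-T) T) := fun t ht => (hs t ht).continuousWithinAt
    refine lt_of_bootstrap ?_ ?_ ?_
    · exact (hcont.fst.norm).sup ((hcont.snd.fst.sub continuousOn_const).abs)
    · refine max_lt ?_ (by linarith)
      have := norm_add_le ((s 0).1 - modeX a) (modeX a)
      rw [sub_add_cancel] at this
      linarith
    · intro τ hτ0 hτT hle t ht
      have hE : Real.exp (k * τ) ≤ Real.exp (k * T) := Real.exp_le_exp.2 (by gcongr)
      obtain ⟨e1, e2⟩ := htraj τ (M * ε) a (K * ε ^ 2) s hτ0 (by positivity) hMε (hs.mono hτT) hs1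
        (fun t ht => ⟨(le_max_left _ _).trans (hle t ht), (le_max_right _ _).trans (hle t ht)⟩) t ht
      refine max_lt ?_ ?_
      · have e3 : (K * ε ^ 2 + C * (M * ε) ^ 2) * Real.exp (k * τ) ≤ ε :=
          le_trans (by gcongr) hgrow
        have e4 := norm_add_le ((s t).1 - U (-t) (modeX a)) (U (-t) (modeX a))
        rw [sub_add_cancel, norm_U] at e4
        linarith
      · have e3 : |t| ≤ Real.exp (k * T) := (abs_le.2 ht).trans (hτT.trans hTE)
        have e4 : C * (M * ε) ^ 2 * |t| ≤ ε := by
          refine le_trans ?_ hgrow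
          calc C * (M * ε) ^ 2 * |t| ≤ C * (M * ε) ^ 2 * Real.exp (k * T) := by gcongr
            _ ≤ _ := by gcongr; exact le_add_of_nonneg_left (by positivity)
        have e5 := abs_sub_le (s t).2.1 (s 0).2.1 1
        linarith
  intro t ht
  have e1 := main t ht
  have e2 := (le_max_left _ _).trans_lt e1
  have e3 := (le_max_right _ _).trans_lt e1
  refine ⟨e2, e3, (hsmall t (M * ε) (s t) hMε e2.le e3.le).trans (le_of_eq (by ring))⟩

end

/-! ### Orthogonality conditions and modulation equations imply each other -/

noncomputable section

/-! ### The modulation equations and the orthogonality conditions -/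

variable {κ : ℝ → ℝ} {ρ : ℝ}

lemma modulation_eqs {α : ℝ} {W : L2} (h : modDet α W ≠ 0) :
    pF κ α W * (mQ + xR α W) - aF κ α W * yR α W + s₁ κ α W = 0 ∧
      pF κ α W * zR α W + aF κ α W * (xR α W - mQ) + s₂ κ α W = 0 := by
  constructor
  · rw [pF, aF]
    field_simp
    rw [modDet]; ring
  · rw [pF, aF]
    field_simp
    rw [modDet]; ring

lemma eq_of_modulation_eqs {α p a : ℝ} {W : L2} (h : modDet α W ≠ 0)
    (h1 : p * (mQ + xR α W) - a * yR α W + s₁ κ α W = 0)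
    (h2 : p * zR α W + a * (xR α W - mQ) + s₂ κ α W = 0) : p = pF κ α W ∧ a = aF κ α W := by
  constructor
  · rw [pF, eq_mul_inv_iff_mul_eq₀ h, modDet]
    linear_combination (xR α W - mQ) * h1 + yR α W * h2
  · rw [aF, eq_mul_inv_iff_mul_eq₀ h, modDet]
    linear_combination (mQ + xR α W) * h2 - zR α W * h1

lemma pair_fieldX (p a k α : ℝ) (W g : L2) : pair (J (fieldX p a k α W)) g =
    p * pair (toL2 (QS α)) g + ((p - k : ℝ) : ℂ) * pair (J W) g -
      a * Complex.I * pair (toL2 (QpS α)) g + (pair (J (linX α W)) g + pair (J (nlX α W)) g) := by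
  simp only [fieldX, map_add, map_sub, map_smul, add_apply, sub_apply, smul_apply, smul_eq_mul, qX,
    qpX, J_iota]

lemma pair_real_smul (g h : L2) (a : ℝ) : pair g (a • h) = a * pair g h := by
  rw [ContinuousLinearMap.map_smul_of_tower, Complex.real_smul]

lemma hasDerivWithinAt_pair_QS {T k : ℝ} {W F : ℝ → L2} {α : ℝ → ℝ} {p a t : ℝ}
    (hW : ContinuousOn W (Icc (-T) T)) (h : WeakSol T W F) (ht : t ∈ Icc (-T) T)
    (hF : F t = fieldX p a k (α t) (W t)) (hα : 0 < α t)
    (hα' : HasDerivWithinAt α a (Icc (-T) T) t) :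
    HasDerivWithinAt (fun s => (pair (J (W s)) (toL2 (QS (α s)))).re)
      (p * zR (α t) (W t) + a * (xR (α t) (W t) - mQ) + (((α t) ^ 2 - k) * zR (α t) (W t) +
        (pair (J (nlX (α t) (W t))) (toL2 (QS (α t)))).im)) (Icc (-T) T) t := by
  have h1 := hasDerivWithinAt_pair (A := fun s => J (W s)) (B := fun s => toL2 (QS (α s)))
    (h (QS (α t)) t ht) (J.continuous.continuousAt.comp_continuousWithinAt (hW t ht))
    ((hasDerivAt_QS hα).scomp_hasDerivWithinAt t hα')
  have h2 := Complex.reCLM.hasFDerivAt.comp_hasDerivWithinAt t h1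
  refine h2.congr_deriv ?_
  have hq := pair_real (conj_QS hα) (conj_QS hα)
  have hq' : (pair (toL2 (QS (α t))) (toL2 (QS (α t)))).im = 0 := Complex.conj_eq_iff_im.1 hq
  rw [hF, pair_fieldX, pair_comm (toL2 (QpS _)), pair_QS_QpS hα, pair_linX_QS hα, pair_real_smul]
  simp only [zR, xR, Complex.reCLM_apply]
  simp [hq', ← Complex.ofReal_pow]
  ring

/-- The Laplacian is gone by `pair_linX_QpS`. The last term is a multiple of the other orthogonality
quantity. -/
lemma hasDerivWithinAt_pair_QpS {T k : ℝ} {W F : ℝ → L2} {α : ℝ → ℝ} {p a t : ℝ}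
    (hW : ContinuousOn W (Icc (-T) T)) (h : WeakSol T W F) (ht : t ∈ Icc (-T) T)
    (hF : F t = fieldX p a k (α t) (W t)) (hα : 0 < α t)
    (hα' : HasDerivWithinAt α a (Icc (-T) T) t) :
    HasDerivWithinAt (fun s => (pair (J (W s)) (toL2 (QpS (α s)))).im)
      (-(p * (mQ + xR (α t) (W t)) - a * yR (α t) (W t) + (((α t) ^ 2 - k) * xR (α t) (W t) +
        (pair (J (nlX (α t) (W t))) (toL2 (QpS (α t)))).re)) -
        2 * α t * (pair (J (W t)) (toL2 (QS (α t)))).re) (Icc (-T) T) t := by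
  have h1 := hasDerivWithinAt_pair (A := fun s => J (W s)) (B := fun s => toL2 (QpS (α s)))
    (h (QpS (α t)) t ht) (J.continuous.continuousAt.comp_continuousWithinAt (hW t ht))
    ((hasDerivAt_QpS hα).scomp_hasDerivWithinAt t hα')
  have h2 := Complex.imCLM.hasFDerivAt.comp_hasDerivWithinAt t h1
  refine h2.congr_deriv ?_
  have hq := pair_real (conj_QpS hα) (conj_QpS hα)
  have hq' : (pair (toL2 (QpS (α t))) (toL2 (QpS (α t)))).im = 0 := Complex.conj_eq_iff_im.1 hq
  have hl := congrArg Complex.re (pair_linX_QpS hα (W t))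
  rw [hF, pair_fieldX, pair_QS_QpS hα, pair_real_smul]
  simp only [yR, xR, Complex.imCLM_apply]
  simp [hq', ← Complex.ofReal_pow] at hl ⊢
  linarith

/-- The orthogonality conditions for `v = J W`. -/
def Orth (α : ℝ) (W : L2) : Prop :=
  (pair (J W) (toL2 (QpS α))).im = 0 ∧ (pair (J W) (toL2 (QS α))).re = 0

lemma eq_zero_of_deriv_eq_zero {T : ℝ} {g : ℝ → ℝ} (h : ∀ t ∈ Icc (-T) T,
    HasDerivWithinAt g 0 (Icc (-T) T) t) (h0 : g 0 = 0) : ∀ t ∈ Icc (-T) T, g t = 0 := by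
  intro t ht
  have h1 := (convex_Icc (-T) T).norm_image_sub_le_of_norm_hasDerivWithin_le h (C := 0)
    (fun _ _ => by simp) (show (0 : ℝ) ∈ Icc (-T) T from
      ⟨by linarith [ht.1, ht.2], by linarith [ht.1, ht.2]⟩) ht
  rw [zero_mul, h0, sub_zero, norm_le_zero_iff] at h1
  exact h1

/-- The condition against Q_α has to be propagated first, since it enters the derivative of the
condition against Q'_α. -/
lemma orth_of_weakSol {T : ℝ} {W : ℝ → L2} {α : ℝ → ℝ} (hW : ContinuousOn W (Icc (-T) T))
    (h : WeakSol T W (fun t => PhiX κ (α t) (W t))) (hα : ∀ t ∈ Icc (-T) T, 0 < α t)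
    (hα' : ∀ t ∈ Icc (-T) T, HasDerivWithinAt α (aF κ (α t) (W t)) (Icc (-T) T) t)
    (hdet : ∀ t ∈ Icc (-T) T, modDet (α t) (W t) ≠ 0) (h0 : Orth (α 0) (W 0)) :
    ∀ t ∈ Icc (-T) T, Orth (α t) (W t) := by
  have h2 : ∀ t ∈ Icc (-T) T, (pair (J (W t)) (toL2 (QS (α t)))).re = 0 := by
    refine eq_zero_of_deriv_eq_zero (fun t ht => ?_) h0.2
    refine (hasDerivWithinAt_pair_QS hW h ht rfl (hα t ht) (hα' t ht)).congr_deriv ?_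
    exact (modulation_eqs (hdet t ht)).2
  have h1 : ∀ t ∈ Icc (-T) T, (pair (J (W t)) (toL2 (QpS (α t)))).im = 0 := by
    refine eq_zero_of_deriv_eq_zero (fun t ht => ?_) h0.1
    refine (hasDerivWithinAt_pair_QpS hW h ht rfl (hα t ht) (hα' t ht)).congr_deriv ?_
    rw [h2 t ht, mul_zero, sub_zero, neg_eq_zero]
    exact (modulation_eqs (hdet t ht)).1
  exact fun t ht => ⟨h1 t ht, h2 t ht⟩

/-- Both orthogonality quantities vanish identically, so their derivatives do; invertibility of the
modulation system then determines p and a. -/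
lemma eq_of_orth {T : ℝ} (hT : 0 < T) {W F : ℝ → L2} {α : ℝ → ℝ} {p a t : ℝ}
    (hW : ContinuousOn W (Icc (-T) T)) (h : WeakSol T W F) (ht : t ∈ Icc (-T) T)
    (hF : F t = fieldX p a (κ (α t)) (α t) (W t)) (hα : 0 < α t)
    (hα' : HasDerivWithinAt α a (Icc (-T) T) t) (hdet : modDet (α t) (W t) ≠ 0)
    (ho : ∀ s ∈ Icc (-T) T, Orth (α s) (W s)) :
    p = pF κ (α t) (W t) ∧ a = aF κ (α t) (W t) := by
  have hu : UniqueDiffWithinAt ℝ (Icc (-T) T) t := uniqueDiffOn_Icc (by linarith) t ht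
  have hz : HasDerivWithinAt (fun _ : ℝ => (0 : ℝ)) 0 (Icc (-T) T) t := hasDerivWithinAt_const _ _ _
  have h1 := hu.eq_deriv _ (hasDerivWithinAt_pair_QpS hW h ht hF hα hα')
    (hz.congr (fun s hs => (ho s hs).1) (ho t ht).1)
  have h2 := hu.eq_deriv _ (hasDerivWithinAt_pair_QS hW h ht hF hα hα')
    (hz.congr (fun s hs => (ho s hs).2) (ho t ht).2)
  rw [(ho t ht).2, mul_zero, sub_zero, neg_eq_zero] at h1
  exact eq_of_modulation_eqs hdet h1 h2

lemma IsAdm.modDet_ne (hρ : IsAdm ρ) {α : ℝ} {W : L2} (h : (α, W) ∈ reg ρ) : modDet α W ≠ 0 := by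
  have h1 := hρ.det _ h
  have h2 := mQ_pos
  intro h3
  simp only [h3, abs_zero] at h1
  have : 0 < mQ ^ 2 / 2 := by positivity
  linarith

/-! ### The pairing `⟨f ∣ g⟩` -/

lemma rip_eq {f g : ℝ → ℂ} {h : L2} {φ : 𝓢(ℝ, ℂ)} (hf : f =ᵐ[volume] h)
    (hg : ∀ x, φ x = conj (g x)) : rip f g = (pair h (toL2 φ)).re := by
  rw [rip, pair_toL2]
  congr 1
  apply integral_congr_ae
  filter_upwards [hf] with x hx
  rw [hx, hg]

lemma rip_I_eq {f g : ℝ → ℂ} {h : L2} {φ : 𝓢(ℝ, ℂ)} (hf : f =ᵐ[volume] h)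
    (hg : ∀ x, φ x = conj (g x)) : rip (fun x => Complex.I * f x) g = -(pair h (toL2 φ)).im := by
  have : rip (fun x => Complex.I * f x) g = (pair (Complex.I • h) (toL2 φ)).re := by
    refine rip_eq ?_ hg
    filter_upwards [hf, Lp.coeFn_smul Complex.I h] with x h1 h2
    rw [h2, Pi.smul_apply, h1, smul_eq_mul]
  rw [this, map_smul, smul_apply, smul_eq_mul]
  simp

lemma constraint_iff {α : ℝ} (hα : 0 < α) {ve vo : ℝ → ℂ} {W : L2}
    (h : (fun x => ve x + vo x) =ᵐ[volume] J W) : Constraint α ve vo ↔ Orth α W := by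
  rw [Constraint, rip_I_eq h (φ := QpS α) fun x => by rw [Complex.conj_ofReal, QpS_apply hα],
    rip_eq h (φ := QS α) fun x => by rw [Complex.conj_ofReal, QS_apply hα], neg_eq_zero, Orth]

end

/-! ### Splitting one equation into its even and odd components -/

noncomputable section

/-! ### Even and odd parts -/

/-- The even part. -/
def evenP : L2 →L[ℂ] L2 := (1 / 2 : ℂ) • (ContinuousLinearMap.id ℂ L2 + reflL2)

/-- The odd part. -/
def oddP : L2 →L[ℂ] L2 := (1 / 2 : ℂ) • (ContinuousLinearMap.id ℂ L2 - reflL2)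

lemma evenP_apply (W : L2) : evenP W = (1 / 2 : ℂ) • (W + reflL2 W) := rfl

lemma oddP_apply (W : L2) : oddP W = (1 / 2 : ℂ) • (W - reflL2 W) := rfl

lemma evenP_add_oddP (W : L2) : evenP W + oddP W = W := by
  rw [evenP_apply, oddP_apply]; module

lemma norm_evenP_le (W : L2) : ‖evenP W‖ ≤ ‖W‖ := by
  have := norm_add_le W (reflL2 W)
  rw [norm_reflL2] at this
  rw [evenP_apply, norm_smul]
  norm_num
  linarith

lemma norm_oddP_le (W : L2) : ‖oddP W‖ ≤ ‖W‖ := by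
  have := norm_sub_le W (reflL2 W)
  rw [norm_reflL2] at this
  rw [oddP_apply, norm_smul]
  norm_num
  linarith

lemma U_evenP (t : ℝ) (W : L2) : U t (evenP W) = evenP (U t W) := by
  rw [evenP_apply, evenP_apply, map_smul, map_add, U_reflL2]

lemma U_oddP (t : ℝ) (W : L2) : U t (oddP W) = oddP (U t W) := by
  rw [oddP_apply, oddP_apply, map_smul, map_sub, U_reflL2]

lemma J_evenP_ae (W : L2) : J (evenP W) =ᵐ[volume] fun x => (J W x + J W (-x)) / 2 := by
  rw [evenP_apply, map_smul, map_add]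
  filter_upwards [Lp.coeFn_smul (1 / 2 : ℂ) (J W + J (reflL2 W)), Lp.coeFn_add (J W) (J (reflL2 W)),
    J_reflL2_ae W] with x h1 h2 h3
  rw [h1, Pi.smul_apply, h2, Pi.add_apply, h3, smul_eq_mul]
  ring

lemma J_oddP_ae (W : L2) : J (oddP W) =ᵐ[volume] fun x => (J W x - J W (-x)) / 2 := by
  rw [oddP_apply, map_smul, map_sub]
  filter_upwards [Lp.coeFn_smul (1 / 2 : ℂ) (J W - J (reflL2 W)), Lp.coeFn_sub (J W) (J (reflL2 W)),
    J_reflL2_ae W] with x h1 h2 h3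
  rw [h1, Pi.smul_apply, h2, Pi.sub_apply, h3, smul_eq_mul]
  ring

lemma isEven_J_evenP (W : L2) : IsEven (J (evenP W)) := by
  filter_upwards [J_evenP_ae W, ae_neg (J_evenP_ae W)] with x h1 h2
  rw [h1, h2, neg_neg, add_comm]

lemma isOdd_J_oddP (W : L2) : IsOdd (J (oddP W)) := by
  filter_upwards [J_oddP_ae W, ae_neg (J_oddP_ae W)] with x h1 h2
  rw [h1, h2, neg_neg]; ring

lemma reflL2_of_isEven {W : L2} (h : IsEven (J W)) : reflL2 W = W := by
  apply J_injective
  apply Lp.ext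
  filter_upwards [J_reflL2_ae W, h] with x h1 h2
  rw [h1, h2]

lemma reflL2_of_isOdd {W : L2} (h : IsOdd (J W)) : reflL2 W = -W := by
  apply J_injective
  rw [map_neg]
  apply Lp.ext
  filter_upwards [J_reflL2_ae W, h, Lp.coeFn_neg (J W)] with x h1 h2 h3
  rw [h1, h2, h3, Pi.neg_apply]

lemma evenP_add_eq {We Wo : L2} (he : IsEven (J We)) (ho : IsOdd (J Wo)) :
    evenP (We + Wo) = We := by
  rw [evenP_apply, map_add, reflL2_of_isEven he, reflL2_of_isOdd ho]; module

lemma oddP_add_eq {We Wo : L2} (he : IsEven (J We)) (ho : IsOdd (J Wo)) :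
    oddP (We + Wo) = Wo := by
  rw [oddP_apply, map_add, reflL2_of_isEven he, reflL2_of_isOdd ho]; module

/-! ### The right-hand sides -/

lemma J_fieldX_ae (p a k : ℝ) {α : ℝ} (hα : 0 < α) (W : L2) :
    J (fieldX p a k α W) =ᵐ[volume] fun x => (p : ℂ) * groundState α x + ((p - k : ℝ) : ℂ) * J W x -
      a * Complex.I * groundStateDα α x + (2 * (groundState α x : ℂ) ^ 2 * J W x +
        (groundState α x : ℂ) ^ 2 * conj (J W (-x)) + nonlin (groundState α x) (J W x)
          (conj (J W (-x)))) := by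
  have hq : J (qX α) =ᵐ[volume] fun x => (groundState α x : ℂ) := by
    rw [qX, J_iota]
    filter_upwards [toL2_ae (QS α)] with x h
    rw [h, QS_apply hα]
  have hq' : J (qpX α) =ᵐ[volume] fun x => (groundStateDα α x : ℂ) := by
    rw [qpX, J_iota]
    filter_upwards [toL2_ae (QpS α)] with x h
    rw [h, QpS_apply hα]
  set V := conjL2 W with hV
  have e : J (fieldX p a k α W) = (p : ℂ) • J (qX α) + ((p - k : ℝ) : ℂ) • J W -
      (a * Complex.I) • J (qpX α) + (((2 : ℂ) • J (mulX (qX α) (mulX (qX α) W)) +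
        J (mulX (qX α) (mulX (qX α) V))) + (J (mulX (qX α) (mulX W W + (2 : ℂ) • mulX W V)) +
          J (mulX (mulX W W) V))) := by
    simp only [fieldX, linX, nlX, map_add, map_sub, map_smul, hV]
  rw [e]
  have hm1 := J_mulX_ae W W
  have hm2 := J_mulX_ae W V
  have hs : J (mulX W W + (2 : ℂ) • mulX W V) =ᵐ[volume] fun x =>
      J W x * J W x + 2 * (J W x * J V x) := by
    rw [map_add, map_smul]
    filter_upwards [Lp.coeFn_add (J (mulX W W)) ((2 : ℂ) • J (mulX W V)),
      Lp.coeFn_smul (2 : ℂ) (J (mulX W V)), hm1, hm2] with x h1 h2 h3 h4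
    rw [h1, Pi.add_apply, h2, Pi.smul_apply, h3, h4, smul_eq_mul]
  filter_upwards [Lp.coeFn_add ((p : ℂ) • J (qX α) + ((p - k : ℝ) : ℂ) • J W -
      (a * Complex.I) • J (qpX α)) (((2 : ℂ) • J (mulX (qX α) (mulX (qX α) W)) +
        J (mulX (qX α) (mulX (qX α) V))) + (J (mulX (qX α) (mulX W W + (2 : ℂ) • mulX W V)) +
          J (mulX (mulX W W) V))),
    Lp.coeFn_sub ((p : ℂ) • J (qX α) + ((p - k : ℝ) : ℂ) • J W) ((a * Complex.I) • J (qpX α)),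
    Lp.coeFn_add ((p : ℂ) • J (qX α)) (((p - k : ℝ) : ℂ) • J W),
    Lp.coeFn_smul (p : ℂ) (J (qX α)), Lp.coeFn_smul ((p - k : ℝ) : ℂ) (J W),
    Lp.coeFn_smul (a * Complex.I) (J (qpX α)),
    Lp.coeFn_add ((2 : ℂ) • J (mulX (qX α) (mulX (qX α) W)) +
        J (mulX (qX α) (mulX (qX α) V))) (J (mulX (qX α) (mulX W W + (2 : ℂ) • mulX W V)) +
          J (mulX (mulX W W) V)),
    Lp.coeFn_add ((2 : ℂ) • J (mulX (qX α) (mulX (qX α) W))) (J (mulX (qX α) (mulX (qX α) V))),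
    Lp.coeFn_add (J (mulX (qX α) (mulX W W + (2 : ℂ) • mulX W V))) (J (mulX (mulX W W) V)),
    Lp.coeFn_smul (2 : ℂ) (J (mulX (qX α) (mulX (qX α) W))),
    J_mulX_ae (qX α) (mulX (qX α) W), J_mulX_ae (qX α) W, J_mulX_ae (qX α) (mulX (qX α) V),
    J_mulX_ae (qX α) V, J_mulX_ae (qX α) (mulX W W + (2 : ℂ) • mulX W V), hs,
    J_mulX_ae (mulX W W) V, hm1, hq, hq', J_conjL2_ae W]
    with x e1 e2 e3 e4 e5 e6 e7 e8 e9 e10 e11 e12 e13 e14 e15 e16 e17 e18 e19 e20 e21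
  rw [e1, Pi.add_apply, e2, Pi.sub_apply, e3, Pi.add_apply, e4, Pi.smul_apply, e5, Pi.smul_apply,
    e6, Pi.smul_apply, e7, Pi.add_apply, e8, Pi.add_apply, e9, Pi.add_apply, e10, Pi.smul_apply,
    e11, e12, e13, e14, e15, e16, e17, e18, e19, e20, hV, e21, nonlin]
  simp only [smul_eq_mul]
  ring

/-- On even functions v* is conj v, so the involution in the field becomes the conjugation of 𝓛_-.
The extra terms on the right are the zero-order part of 𝓛_-, which appears on both sides of the
equation. -/
lemma rhsE_ae (p a k : ℝ) {α : ℝ} (hα : 0 < α) (W : L2) :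
    rhsE k (p - k) a α (J (evenP W)) (J (oddP W)) =ᵐ[volume] fun x =>
      J (evenP (fieldX p a k α W)) x + (J (evenP W) x - 2 * (Q x : ℂ) ^ 2 * J (evenP W) x
        + ((-1 : ℝ) : ℂ) * (Q x : ℂ) ^ 2 * conj (J (evenP W) x)) := by
  filter_upwards [J_evenP_ae W, J_oddP_ae W, J_evenP_ae (fieldX p a k α W),
    J_fieldX_ae p a k hα W, ae_neg (J_fieldX_ae p a k hα W)] with x h1 h2 h3 h4 h5
  rw [rhsE, nonlinE, h1, h2, h3, h4, h5, neg_neg, groundState_neg, groundStateDα_neg, nonlin, nonlin,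
    nonlin, nonlin]
  generalize J W x = u
  generalize J W (-x) = v
  simp only [map_div₀, map_add, map_sub, map_ofNat]
  push_cast
  ring

/-- On odd functions v* is -conj v, which turns the sign of the conjugate term into that of 𝓛_+. The
terms in Q_α and Q'_α are even and drop out. -/
lemma rhsO_ae (p a k : ℝ) {α : ℝ} (hα : 0 < α) (W : L2) :
    rhsO (p - k) α (J (evenP W)) (J (oddP W)) =ᵐ[volume] fun x =>
      J (oddP (fieldX p a k α W)) x + (J (oddP W) x - 2 * (Q x : ℂ) ^ 2 * J (oddP W) x
        + ((1 : ℝ) : ℂ) * (Q x : ℂ) ^ 2 * conj (J (oddP W) x)) := by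
  filter_upwards [J_evenP_ae W, J_oddP_ae W, J_oddP_ae (fieldX p a k α W),
    J_fieldX_ae p a k hα W, ae_neg (J_fieldX_ae p a k hα W)] with x h1 h2 h3 h4 h5
  rw [rhsO, nonlinO, h1, h2, h3, h4, h5, neg_neg, groundState_neg, groundStateDα_neg, nonlin, nonlin,
    nonlin, nonlin]
  generalize J W x = u
  generalize J W (-x) = v
  simp only [map_div₀, map_add, map_sub, map_ofNat]
  push_cast
  ring

/-! ### Weak solutions -/

lemma integrable_potential (σ : ℝ) (w : L2) (φ : 𝓢(ℝ, ℂ)) : Integrable fun x : ℝ =>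
    (w x - 2 * (Q x : ℂ) ^ 2 * w x + σ * (Q x : ℂ) ^ 2 * conj (w x)) * φ x := by
  have h1 := integrable_mul_schwartz w (φ - (2 : ℂ) • mulS qS (mulS qS φ))
  have h2 := integrable_mul_schwartz (conjL2 w) ((σ : ℂ) • mulS qS (mulS qS φ))
  refine (h1.add h2).congr ?_
  filter_upwards [conjL2_ae w] with x h
  rw [Pi.add_apply, h]
  simp only [sub_apply, smul_apply, mulS_apply, qS_apply, smul_eq_mul]
  ring

lemma iteratedDeriv_two_schwartz (φ : 𝓢(ℝ, ℂ)) : iteratedDeriv 2 φ = dS (dS φ) := by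
  rw [iteratedDeriv_succ, iteratedDeriv_one]; rfl

/-- The zero-order part of 𝓛_σ is integrable against φ and cancels from both sides, leaving the free
equation with forcing. -/
lemma solvesLinearized_iff {σ T : ℝ} {w W F : ℝ → L2} {R : ℝ → ℝ → ℂ}
    (hw : ∀ t ∈ Icc (-T) T, w t = J (W t))
    (hR : ∀ t ∈ Icc (-T) T, R t =ᵐ[volume] fun x => J (F t) x +
      (J (W t) x - 2 * (Q x : ℂ) ^ 2 * J (W t) x + σ * (Q x : ℂ) ^ 2 * conj (J (W t) x))) :
    SolvesLinearized σ T w R ↔ WeakSol T W F := by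
  refine forall_congr' fun φ => forall₂_congr fun t ht => ?_
  have e1 : ∫ x : ℝ, R t x * φ x = pair (J (F t)) (toL2 φ) + ∫ x : ℝ, (w t x -
      2 * (Q x : ℂ) ^ 2 * w t x + σ * (Q x : ℂ) ^ 2 * conj (w t x)) * φ x := by
    rw [hw t ht, pair_toL2, ← integral_add (integrable_mul_schwartz _ φ)
      (integrable_potential σ _ φ)]
    apply integral_congr_ae
    filter_upwards [hR t ht] with x hx
    rw [hx, add_mul]
  have e2 : ∫ x : ℝ, -(w t x * iteratedDeriv 2 φ x) = -pair (J (W t)) (toL2 (dS (dS φ))) := by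
    rw [integral_neg, hw t ht, pair_toL2, iteratedDeriv_two_schwartz]
  have e3 : ∀ s ∈ Icc (-T) T, ∫ x : ℝ, w s x * φ x = pair (J (W s)) (toL2 φ) := fun s hs => by
    rw [pair_toL2, hw s hs]
  have e4 : ∀ D, HasDerivWithinAt (fun s => ∫ x : ℝ, w s x * φ x) D (Icc (-T) T) t ↔
      HasDerivWithinAt (fun s => pair (J (W s)) (toL2 φ)) D (Icc (-T) T) t := fun D =>
    ⟨fun h => h.congr (fun s hs => (e3 s hs).symm) (e3 t ht).symm, fun h => h.congr e3 (e3 t ht)⟩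
  have hI := Complex.I_mul_I
  constructor
  · rintro ⟨D, h1, h2⟩
    rw [e1, e2] at h2
    have : D = -Complex.I * (pair (J (F t)) (toL2 φ) + pair (J (W t)) (toL2 (dS (dS φ)))) := by
      linear_combination -Complex.I * h2 + D * hI
    rw [← this]
    exact (e4 D).1 h1
  · intro h
    refine ⟨_, (e4 _).2 h, ?_⟩
    rw [e1, e2]
    linear_combination -(pair (J (F t)) (toL2 φ) + pair (J (W t)) (toL2 (dS (dS φ)))) * hI

lemma WeakSol.add {T : ℝ} {W F W' F' : ℝ → L2} (h : WeakSol T W F) (h' : WeakSol T W' F') :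
    WeakSol T (fun t => W t + W' t) (fun t => F t + F' t) := by
  intro φ t ht
  simp only [map_add, add_apply]
  exact ((h φ t ht).add (h' φ t ht)).congr_deriv (by ring)

lemma weakSol_evenP {T : ℝ} {z F : ℝ → L2}
    (h : ∀ t ∈ Icc (-T) T, HasDerivWithinAt z (U (-t) (-Complex.I • F t)) (Icc (-T) T) t) :
    WeakSol T (fun t => evenP (U t (z t))) (fun t => evenP (F t)) := by
  simp only [← U_evenP]
  refine weakSol_of_hasDerivWithinAt fun t ht => ?_
  rw [← map_smul, U_evenP]
  exact (evenP.hasFDerivAt.restrictScalars ℝ).comp_hasDerivWithinAt t (h t ht)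

lemma weakSol_oddP {T : ℝ} {z F : ℝ → L2}
    (h : ∀ t ∈ Icc (-T) T, HasDerivWithinAt z (U (-t) (-Complex.I • F t)) (Icc (-T) T) t) :
    WeakSol T (fun t => oddP (U t (z t))) (fun t => oddP (F t)) := by
  simp only [← U_oddP]
  refine weakSol_of_hasDerivWithinAt fun t ht => ?_
  rw [← map_smul, U_oddP]
  exact (oddP.hasFDerivAt.restrictScalars ℝ).comp_hasDerivWithinAt t (h t ht)

lemma continuousInH1_J {T : ℝ} {W : ℝ → L2} (h : ContinuousOn W (Icc (-T) T)) :
    ContinuousInH1 T (fun t => J (W t)) := by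
  refine ⟨fun t _ => memH1_J _, fun t ht => ?_⟩
  simp only [← map_sub, normH1_J]
  exact tendsto_iff_norm_sub_tendsto_zero.1 (h t ht)

lemma exists_continuousOn_of_continuousInH1 {T : ℝ} {w : ℝ → L2} (h : ContinuousInH1 T w) :
    ∃ W : ℝ → L2, (∀ t ∈ Icc (-T) T, J (W t) = w t) ∧ ContinuousOn W (Icc (-T) T) := by
  choose! W hW using fun t ht => exists_J_eq (h.1 t ht)
  refine ⟨W, hW, fun t ht => tendsto_iff_norm_sub_tendsto_zero.2 ?_⟩
  refine (h.2 t ht).congr' (eventually_nhdsWithin_of_forall fun s hs => ?_)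
  rw [← hW s hs, ← hW t ht, ← map_sub, normH1_J]

end

/-! ### Root-space coefficients and the reduction of the initial data to the stationary mode -/

noncomputable section

/-! ### The root-space decomposition -/

lemma norm_pair_J_le (W g : L2) : ‖pair (J W) g‖ ≤ ‖pair‖ * ‖g‖ * ‖W‖ := by
  refine (pair.le_opNorm₂ (J W) g).trans ?_
  have := norm_J_le W
  calc ‖pair‖ * ‖J W‖ * ‖g‖ ≤ ‖pair‖ * ‖W‖ * ‖g‖ := by gcongr
    _ = _ := by ring

lemma abs_re_pair_J_le (W g : L2) : |(pair (J W) g).re| ≤ ‖pair‖ * ‖g‖ * ‖W‖ :=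
  (Complex.abs_re_le_norm _).trans (norm_pair_J_le W g)

lemma abs_im_pair_J_le (W g : L2) : |(pair (J W) g).im| ≤ ‖pair‖ * ‖g‖ * ‖W‖ :=
  (Complex.abs_im_le_norm _).trans (norm_pair_J_le W g)

lemma qgS_apply' (x : ℝ) : qgS x = (Q' x : ℂ) := by
  rw [← QpS_one, QpS_apply one_pos, Q']

lemma conj_qS (x : ℝ) : conj (qS x) = qS x := by rw [qS_apply, Complex.conj_ofReal]

lemma conj_qgS (x : ℝ) : conj (qgS x) = qgS x := by rw [qgS_apply', Complex.conj_ofReal]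

lemma conj_dS_qS (x : ℝ) : conj (dS qS x) = dS qS x := by rw [dS_qS_apply, Complex.conj_ofReal]

lemma conj_xS_qS (x : ℝ) : conj (xS qS x) = xS qS x := by
  rw [xS_apply, map_mul, conj_qS, Complex.conj_ofReal]

lemma pair_dS_qS_qgS : pair (toL2 (dS qS)) (toL2 qgS) = 0 := by
  have h := pair_reflL2 (toL2 (dS qS)) (toL2 qgS)
  have h1 : reflS (dS qS) = (-1 : ℂ) • dS qS := by
    ext x
    rw [reflS_apply, smul_apply, dS_qS_apply, dS_qS_apply, dxQ_neg]
    simp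
  have h2 : reflS qgS = qgS := by
    ext x
    rw [reflS_apply, qgS_apply', qgS_apply', Q', groundStateDα_neg, ← Q']
  rw [reflL2_toL2, reflL2_toL2, h1, h2, toL2_smul, map_smul, smul_apply, smul_eq_mul] at h
  linear_combination -h / 2

/-- The even part of the generalized kernel. -/
def modeE (a b : ℝ) : L2 := (a * Complex.I) • iota qS + (b : ℂ) • iota qgS

/-- The odd part of the generalized kernel. -/
def modeO (a b : ℝ) : L2 := modeX a + (b : ℂ) • iota (xS qS)

lemma J_modeE_ae (a b : ℝ) :
    J (modeE a b) =ᵐ[volume] fun x => a * (Complex.I * Q x) + b * Q' x := by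
  rw [modeE, map_add, map_smul, map_smul, J_iota, J_iota]
  filter_upwards [Lp.coeFn_add ((a * Complex.I) • toL2 qS) ((b : ℂ) • toL2 qgS),
    Lp.coeFn_smul (a * Complex.I) (toL2 qS), Lp.coeFn_smul (b : ℂ) (toL2 qgS), toL2_ae qS,
    toL2_ae qgS] with x h1 h2 h3 h4 h5
  rw [h1, Pi.add_apply, h2, Pi.smul_apply, h3, Pi.smul_apply, h4, h5, qS_apply, qgS_apply',
    smul_eq_mul, smul_eq_mul, mul_assoc]

lemma J_modeO_ae (a b : ℝ) :
    J (modeO a b) =ᵐ[volume] fun x => a * (Complex.I * dxQ x) + b * (x * Q x) := by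
  rw [modeO, map_add, map_smul, J_iota]
  filter_upwards [Lp.coeFn_add (J (modeX a)) ((b : ℂ) • toL2 (xS qS)),
    J_modeX_ae a, Lp.coeFn_smul (b : ℂ) (toL2 (xS qS)), toL2_ae (xS qS)] with x h1 h2 h3 h4
  rw [h1, Pi.add_apply, h2, h3, Pi.smul_apply, h4, xS_apply, qS_apply, smul_eq_mul]

lemma norm_modeE_le (a b : ℝ) : ‖modeE a b‖ ≤ |a| * ‖iota qS‖ + |b| * ‖iota qgS‖ := by
  refine (norm_add_le _ _).trans (le_of_eq ?_)
  rw [norm_smul, norm_smul, norm_mul, Complex.norm_I, Complex.norm_real, Complex.norm_real, mul_one]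
  rfl

lemma norm_modeO_le (a b : ℝ) :
    ‖modeO a b‖ ≤ |a| * ‖iota (dS qS)‖ + |b| * ‖iota (xS qS)‖ := by
  refine (norm_add_le _ _).trans (le_of_eq ?_)
  rw [norm_modeX, norm_smul, Complex.norm_real]
  rfl

lemma pair_modeE (a b : ℝ) (g : L2) : pair (J (modeE a b)) g =
    a * Complex.I * pair (toL2 qS) g + b * pair (toL2 qgS) g := by
  simp only [modeE, map_add, map_smul, J_iota, add_apply, smul_apply, smul_eq_mul]

lemma pair_modeX (a : ℝ) (g : L2) : pair (J (modeX a)) g =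
    a * Complex.I * pair (toL2 (dS qS)) g := by
  simp only [modeX, map_smul, J_iota, smul_apply, smul_eq_mul]

lemma pair_modeO (a b : ℝ) (g : L2) : pair (J (modeO a b)) g =
    a * Complex.I * pair (toL2 (dS qS)) g + b * pair (toL2 (xS qS)) g := by
  simp only [modeO, map_add, map_smul, pair_modeX, J_iota, add_apply, smul_apply, smul_eq_mul]

lemma pair_qgS_qS : pair (toL2 qgS) (toL2 qS) = mQ := by rw [pair_comm, pair_qS_qgS]

lemma im_pair_eq_zero {f g : 𝓢(ℝ, ℂ)} (hf : ∀ x, conj (f x) = f x) (hg : ∀ x, conj (g x) = g x) :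
    (pair (toL2 f) (toL2 g)).im = 0 := Complex.conj_eq_iff_im.1 (pair_real hf hg)

lemma re_pair_modeE (a b : ℝ) : (pair (J (modeE a b)) (toL2 qS)).re = b * mQ := by
  rw [pair_modeE, pair_qS_qS, pair_qgS_qS]
  simp

lemma im_pair_modeE (a b : ℝ) : (pair (J (modeE a b)) (toL2 qgS)).im = a * mQ := by
  rw [pair_modeE, pair_qS_qgS]
  simp [im_pair_eq_zero conj_qgS conj_qgS]

lemma re_pair_modeO (a b : ℝ) : (pair (J (modeO a b)) (toL2 (dS qS))).re = -(b * mQ) := by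
  rw [pair_modeO, pair_xS_qS_dS_qS]
  simp [im_pair_eq_zero conj_dS_qS conj_dS_qS]

lemma im_pair_modeO (a b : ℝ) : (pair (J (modeO a b)) (toL2 (xS qS))).im = -(a * mQ) := by
  rw [pair_modeO, pair_comm, pair_xS_qS_dS_qS]
  simp [im_pair_eq_zero conj_xS_qS conj_xS_qS]

lemma re_pair_modeX (a : ℝ) : (pair (J (modeX a)) (toL2 qS)).re = 0 := by
  rw [pair_modeX]
  simp [im_pair_eq_zero conj_dS_qS conj_qS]

lemma im_pair_modeX (a : ℝ) : (pair (J (modeX a)) (toL2 qgS)).im = 0 := by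
  rw [pair_modeX, pair_dS_qS_qgS]
  simp

/-- The pairings ⟨Q', Q⟩ = m and ⟨xQ, ∂_xQ⟩ = -m are nonzero, and the factor i separates the two
members of each pair between real and imaginary parts. So the orthogonality conditions on η
determine the coefficients. -/
lemma isRootDecomposition_sub (We Wo : L2) :
    IsRootDecomposition (J We) (J Wo) ((pair (J We) (toL2 qgS)).im / mQ)
      ((pair (J We) (toL2 qS)).re / mQ) (-((pair (J Wo) (toL2 (xS qS))).im / mQ))
      (-((pair (J Wo) (toL2 (dS qS))).re / mQ))
      (J (We - modeE ((pair (J We) (toL2 qgS)).im / mQ) ((pair (J We) (toL2 qS)).re / mQ)))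
      (J (Wo - modeO (-((pair (J Wo) (toL2 (xS qS))).im / mQ))
        (-((pair (J Wo) (toL2 (dS qS))).re / mQ)))) := by
  have hm := mQ_pos.ne'
  constructor
  · rw [map_sub]
    filter_upwards [Lp.coeFn_sub (J We) (J (modeE ((pair (J We) (toL2 qgS)).im / mQ)
      ((pair (J We) (toL2 qS)).re / mQ))), J_modeE_ae ((pair (J We) (toL2 qgS)).im / mQ)
      ((pair (J We) (toL2 qS)).re / mQ)] with x h1 h2
    rw [h1, Pi.sub_apply, h2]; ring
  · rw [map_sub]
    filter_upwards [Lp.coeFn_sub (J Wo) (J (modeO (-((pair (J Wo) (toL2 (xS qS))).im / mQ))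
      (-((pair (J Wo) (toL2 (dS qS))).re / mQ)))), J_modeO_ae
      (-((pair (J Wo) (toL2 (xS qS))).im / mQ)) (-((pair (J Wo) (toL2 (dS qS))).re / mQ))]
      with x h1 h2
    rw [h1, Pi.sub_apply, h2]; ring
  · exact memH1_J _
  · exact memH1_J _
  · rw [rip_eq (ae_eq_refl _) (φ := qS) fun x => by rw [qS_apply, Complex.conj_ofReal], map_sub,
      map_sub, sub_apply, Complex.sub_re, re_pair_modeE, div_mul_cancel₀ _ hm, sub_self]
  · rw [rip_I_eq (ae_eq_refl _) (φ := qgS) fun x => by rw [qgS_apply', Complex.conj_ofReal], map_sub,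
      map_sub, sub_apply, Complex.sub_im, im_pair_modeE, div_mul_cancel₀ _ hm, sub_self, neg_zero]
  · rw [rip_eq (ae_eq_refl _) (φ := dS qS) fun x => by rw [dS_qS_apply, Complex.conj_ofReal], map_sub,
      map_sub, sub_apply, Complex.sub_re, re_pair_modeO, neg_mul, neg_neg, div_mul_cancel₀ _ hm,
      sub_self]
  · rw [rip_I_eq (ae_eq_refl _) (φ := xS qS) fun x => by
        rw [xS_apply, qS_apply, map_mul, Complex.conj_ofReal, Complex.conj_ofReal],
      map_sub, map_sub, sub_apply, Complex.sub_im, im_pair_modeO, neg_mul, neg_neg,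
      div_mul_cancel₀ _ hm, sub_self, neg_zero]

lemma exists_isRootDecomposition : ∃ D, 0 ≤ D ∧ ∀ W : L2, ∃ (ae be ao bo : ℝ) (ηe ηo : L2),
    IsRootDecomposition (J (evenP W)) (J (oddP W)) ae be ao bo (J ηe) (J ηo) ∧
      |ae| + |be| + |ao| + |bo| + ‖ηe‖ + ‖ηo‖ ≤ D * ‖W‖ := by
  have hm := mQ_pos
  have key : ∀ (g V W : L2), ‖V‖ ≤ ‖W‖ → |(pair (J V) g).re / mQ| ≤ ‖pair‖ * ‖g‖ / mQ * ‖W‖ ∧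
      |(pair (J V) g).im / mQ| ≤ ‖pair‖ * ‖g‖ / mQ * ‖W‖ := fun g V W hVW => by
    rw [abs_div, abs_div, abs_of_pos hm, div_mul_eq_mul_div]
    have h1 := abs_re_pair_J_le V g
    have h2 := abs_im_pair_J_le V g
    have h3 : ‖pair‖ * ‖g‖ * ‖V‖ ≤ ‖pair‖ * ‖g‖ * ‖W‖ := by gcongr
    exact ⟨by gcongr; exact h1.trans h3, by gcongr; exact h2.trans h3⟩
  set c₁ := ‖pair‖ * ‖toL2 qgS‖ / mQ
  set c₂ := ‖pair‖ * ‖toL2 qS‖ / mQ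
  set c₃ := ‖pair‖ * ‖toL2 (xS qS)‖ / mQ
  set c₄ := ‖pair‖ * ‖toL2 (dS qS)‖ / mQ
  refine ⟨c₁ + c₂ + c₃ + c₄ + (1 + c₁ * ‖iota qS‖ + c₂ * ‖iota qgS‖) +
    (1 + c₃ * ‖iota (dS qS)‖ + c₄ * ‖iota (xS qS)‖), by positivity, fun W =>
      ⟨_, _, _, _, _, _, isRootDecomposition_sub _ _, ?_⟩⟩
  have he := norm_evenP_le W
  have ho := norm_oddP_le W
  have h1 := (key (toL2 qgS) _ W he).2
  have h2 := (key (toL2 qS) _ W he).1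
  have h3 := (key (toL2 (xS qS)) _ W ho).2
  have h4 := (key (toL2 (dS qS)) _ W ho).1
  rw [← abs_neg] at h3 h4
  generalize (pair (J (evenP W)) (toL2 qgS)).im / mQ = ae at *
  generalize (pair (J (evenP W)) (toL2 qS)).re / mQ = be at *
  generalize -((pair (J (oddP W)) (toL2 (xS qS))).im / mQ) = ao at *
  generalize -((pair (J (oddP W)) (toL2 (dS qS))).re / mQ) = bo at *
  have h5 : ‖evenP W - modeE ae be‖ ≤ ‖W‖ + (c₁ * ‖W‖ * ‖iota qS‖ + c₂ * ‖W‖ * ‖iota qgS‖) :=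
    (norm_sub_le _ _).trans (add_le_add he ((norm_modeE_le _ _).trans (by gcongr)))
  have h6 : ‖oddP W - modeO ao bo‖ ≤
      ‖W‖ + (c₃ * ‖W‖ * ‖iota (dS qS)‖ + c₄ * ‖W‖ * ‖iota (xS qS)‖) :=
    (norm_sub_le _ _).trans (add_le_add ho ((norm_modeO_le _ _).trans (by gcongr)))
  linarith

/-! ### The initial data -/

/-- Pairing v with Q and Q' isolates b and a up to the remainder R: the mode i∂_xQ drops out, being
imaginary against Q and odd against Q'. By orthogonality these pairings see only Q_α - Q and Q'_α -
Q', which are O(|α - 1|). -/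
lemma exists_abs_coeff_le : ∃ C, 0 ≤ C ∧ ∀ (a b a' α : ℝ) (R : L2), α ∈ dilI →
    Orth α (modeE a b + modeX a' + R) →
      |a| ≤ C * (‖modeE a b + modeX a' + R‖ * |α - 1| + ‖R‖) ∧
      |b| ≤ C * (‖modeE a b + modeX a' + R‖ * |α - 1| + ‖R‖) := by
  have hm := mQ_pos
  obtain ⟨L₁, hL₁, -, h1⟩ := blip_QS (ρ := 0)
  obtain ⟨L₂, hL₂, -, h2⟩ := blip_QpS (ρ := 0)
  set P := ‖pair‖
  set g₁ := ‖toL2 qS‖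
  set g₂ := ‖toL2 qgS‖
  have hP : 0 ≤ P := pair.opNorm_nonneg
  refine ⟨P * (L₁ + L₂ + g₁ + g₂) / mQ, by positivity, fun a b a' α R hα ho => ?_⟩
  have h0 : ((1 : ℝ), (0 : L2)) ∈ reg 0 := ⟨by constructor <;> norm_num, by simp⟩
  have hd : dist (α, (0 : L2)) (1, 0) = |α - 1| := by simp [Prod.dist_eq, Real.dist_eq]
  have h1 := h1 (α, 0) ⟨hα, by simp⟩ _ h0
  have h2 := h2 (α, 0) ⟨hα, by simp⟩ _ h0
  rw [hd] at h1 h2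
  simp only [QS_one, QpS_one] at h1 h2
  set W := modeE a b + modeX a' + R with hW
  have e1 : b * mQ = -(pair (J W) (toL2 (QS α) - toL2 qS)).re - (pair (J R) (toL2 qS)).re := by
    rw [map_sub, Complex.sub_re, ho.2, hW]
    simp only [map_add, add_apply, Complex.add_re, re_pair_modeE, re_pair_modeX]
    ring
  have e2 : a * mQ = -(pair (J W) (toL2 (QpS α) - toL2 qgS)).im - (pair (J R) (toL2 qgS)).im := by
    rw [map_sub, Complex.sub_im, ho.1, hW]
    simp only [map_add, add_apply, Complex.add_im, im_pair_modeE, im_pair_modeX]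
    ring
  have b1 := abs_re_pair_J_le W (toL2 (QS α) - toL2 qS)
  have b2 := abs_im_pair_J_le W (toL2 (QpS α) - toL2 qgS)
  have b3 := abs_re_pair_J_le R (toL2 qS)
  have b4 := abs_im_pair_J_le R (toL2 qgS)
  have k1 : P * ‖toL2 (QS α) - toL2 qS‖ * ‖W‖ ≤ P * (L₁ + L₂ + g₁ + g₂) * (‖W‖ * |α - 1|) := by
    calc _ ≤ P * ((L₁ + L₂ + g₁ + g₂) * |α - 1|) * ‖W‖ := by
          gcongr
          refine h1.trans ?_
          gcongr
          have : 0 ≤ g₁ := norm_nonneg _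
          have : 0 ≤ g₂ := norm_nonneg _
          linarith
      _ = _ := by ring
  have k2 : P * ‖toL2 (QpS α) - toL2 qgS‖ * ‖W‖ ≤ P * (L₁ + L₂ + g₁ + g₂) * (‖W‖ * |α - 1|) := by
    calc _ ≤ P * ((L₁ + L₂ + g₁ + g₂) * |α - 1|) * ‖W‖ := by
          gcongr
          refine h2.trans ?_
          gcongr
          have : 0 ≤ g₁ := norm_nonneg _
          have : 0 ≤ g₂ := norm_nonneg _
          linarith
      _ = _ := by ring
  have k3 : P * g₁ * ‖R‖ ≤ P * (L₁ + L₂ + g₁ + g₂) * ‖R‖ := by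
    gcongr
    have : 0 ≤ g₂ := norm_nonneg _
    linarith
  have k4 : P * g₂ * ‖R‖ ≤ P * (L₁ + L₂ + g₁ + g₂) * ‖R‖ := by
    gcongr
    have : 0 ≤ g₁ := norm_nonneg _
    linarith
  have f : ∀ x y z : ℝ, x * mQ = -y - z → |x| * mQ ≤ |y| + |z| := fun x y z hx => by
    have h : |x| * mQ = |x * mQ| := by rw [abs_mul, abs_of_pos hm]
    rw [h, hx, ← abs_neg y, sub_eq_add_neg, ← abs_neg z]
    exact abs_add_le _ _
  rw [div_mul_eq_mul_div, le_div_iff₀ hm, le_div_iff₀ hm]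
  have f1 := f _ _ _ e1
  have f2 := f _ _ _ e2
  constructor <;> linarith

lemma exists_norm_mode_le : ∃ n, 0 ≤ n ∧ (∀ a b, ‖modeE a b‖ ≤ n * (|a| + |b|)) ∧
    (∀ a, ‖modeX a‖ ≤ n * |a|) ∧ ∀ b : ℝ, ‖(b : ℂ) • iota (xS qS)‖ ≤ n * |b| := by
  have p1 := norm_nonneg (iota qS)
  have p2 := norm_nonneg (iota qgS)
  have p3 := norm_nonneg (iota (dS qS))
  have p4 := norm_nonneg (iota (xS qS))
  refine ⟨‖iota qS‖ + ‖iota qgS‖ + ‖iota (dS qS)‖ + ‖iota (xS qS)‖, by positivity, fun a b => ?_,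
    fun a => ?_, fun b => ?_⟩
  · refine (norm_modeE_le a b).trans ?_
    rw [mul_add, mul_comm |a|, mul_comm |b|]
    gcongr <;> linarith
  · rw [norm_modeX, mul_comm]
    gcongr
    linarith
  · rw [norm_smul, Complex.norm_real, Real.norm_eq_abs, mul_comm]
    gcongr
    linarith

/-- With ‖v‖ and |α - 1| both O(ε), the previous estimate improves a and b from O(ε) to O(ε²). -/
lemma exists_norm_modeE_add_le {K r : ℝ} (hK : 0 ≤ K) (hr : 0 ≤ r) : ∃ K', 0 ≤ K' ∧
    ∀ (ε : ℝ), 0 < ε → ε ≤ 1 → ∀ (a b a' α : ℝ) (R : L2), α ∈ dilI →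
      Orth α (modeE a b + modeX a' + R) → |α - 1| ≤ K * ε → |a| + |b| + |a'| ≤ K * ε →
      ‖R‖ ≤ r * ε ^ 2 → ‖modeE a b + R‖ ≤ K' * ε ^ 2 := by
  obtain ⟨C, hC, hcoef⟩ := exists_abs_coeff_le
  obtain ⟨n, hn, hE, hX, -⟩ := exists_norm_mode_le
  refine ⟨n * (2 * (C * ((n * K + r) * K + r))) + r, by positivity, ?_⟩
  intro ε hε hε1 a b a' α R hα ho h1 h2 h3
  have hW : ‖modeE a b + modeX a' + R‖ ≤ (n * K + r) * ε := by
    have e1 := norm_add₃_le (a := modeE a b) (b := modeX a') (c := R)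
    have e2 : n * (|a| + |b| + |a'|) ≤ n * (K * ε) := by gcongr
    have e3 : r * ε ^ 2 ≤ r * ε := by
      have : ε ^ 2 ≤ ε := by rw [sq]; exact mul_le_of_le_one_left hε.le hε1
      gcongr
    have e4 := hE a b
    have e5 := hX a'
    linarith
  obtain ⟨c1, c2⟩ := hcoef a b a' α R hα ho
  have hB : C * (‖modeE a b + modeX a' + R‖ * |α - 1| + ‖R‖) ≤
      C * ((n * K + r) * K + r) * ε ^ 2 := by
    calc _ ≤ C * ((n * K + r) * ε * (K * ε) + r * ε ^ 2) := by gcongr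
      _ = _ := by ring
  have e1 : n * (|a| + |b|) ≤ n * (C * ((n * K + r) * K + r) * ε ^ 2 +
      C * ((n * K + r) * K + r) * ε ^ 2) := by
    gcongr
    · exact c1.trans hB
    · exact c2.trans hB
  have e2 := norm_add_le (modeE a b) R
  have e3 := hE a b
  linarith

lemma exists_initial {K : ℝ} (hK : 0 < K) : ∃ K', K ≤ K' ∧ ∀ ε, 0 < ε → ε ≤ 1 → K * ε ≤ 1 / 2 →
    ∀ (ve vo ηe ηo : L2) (ae be ao bo α : ℝ), IsRootDecomposition ve vo ae be ao bo ηe ηo →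
      Constraint α ve vo → |α - 1| ≤ K * ε → |ae| + |be| + |ao| ≤ K * ε →
      |bo| + normH1 ηe + normH1 ηo ≤ K * ε ^ 2 →
      ∃ We Wo : L2, J We = ve ∧ J Wo = vo ∧ Orth α (We + Wo) ∧
        ‖We + Wo - modeX ao‖ ≤ K' * ε ^ 2 := by
  obtain ⟨n, hn, -, -, hB⟩ := exists_norm_mode_le
  obtain ⟨K', hK', hmain⟩ := exists_norm_modeE_add_le (r := (n + 1) * K) hK.le (by positivity)
  refine ⟨K' + K, by linarith, ?_⟩
  intro ε hε hε1 hKε ve vo ηe ηo ae be ao bo α hdec hcon h1 h2 h3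
  obtain ⟨Ne, rfl⟩ := exists_J_eq hdec.memH1_e
  obtain ⟨No, rfl⟩ := exists_J_eq hdec.memH1_o
  rw [normH1_J, normH1_J] at h3
  have hα := abs_le.1 (h1.trans hKε)
  have hαI : α ∈ dilI := ⟨by linarith, by linarith⟩
  have eqe : J (modeE ae be + Ne) = ve := by
    rw [map_add]
    apply Lp.ext
    filter_upwards [Lp.coeFn_add (J (modeE ae be)) (J Ne), J_modeE_ae ae be, hdec.eq_e]
      with x e1 e2 e3
    rw [e1, Pi.add_apply, e2, e3]
  have eqo : J (modeO ao bo + No) = vo := by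
    rw [map_add]
    apply Lp.ext
    filter_upwards [Lp.coeFn_add (J (modeO ao bo)) (J No), J_modeO_ae ao bo, hdec.eq_o]
      with x e1 e2 e3
    rw [e1, Pi.add_apply, e2, e3]
  -- R collects the components assumed O(ε²). Outside it and the even mode, only the stationary mode
  -- i∂_xQ remains.
  obtain ⟨R, hR⟩ : ∃ R, R = (bo : ℂ) • iota (xS qS) + Ne + No := ⟨_, rfl⟩
  have hsum : modeE ae be + Ne + (modeO ao bo + No) = modeE ae be + modeX ao + R := by
    rw [modeO, hR]; abel
  have ho : Orth α (modeE ae be + Ne + (modeO ao bo + No)) := by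
    refine (constraint_iff (pos_of_mem_dilI hαI) ?_).1 hcon
    rw [map_add, eqe, eqo]
    exact (Lp.coeFn_add ve vo).symm
  refine ⟨_, _, eqe, eqo, ho, ?_⟩
  rw [hsum] at ho ⊢
  have hRn : ‖R‖ ≤ (n + 1) * K * ε ^ 2 := by
    have e1 := norm_add₃_le (a := (bo : ℂ) • iota (xS qS)) (b := Ne) (c := No)
    rw [← hR] at e1
    have e2 : n * |bo| ≤ n * (K * ε ^ 2) := by
      gcongr; linarith [norm_nonneg Ne, norm_nonneg No]
    have e3 := hB bo
    linarith [abs_nonneg bo]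
  have hfin := hmain ε hε hε1 ae be ao α R hαI ho h1 h2 hRn
  rw [show modeE ae be + modeX ao + R - modeX ao = modeE ae be + R by abel]
  have : 0 ≤ K * ε ^ 2 := by positivity
  linarith

end

/-! ### Correspondence between solutions and trajectories, and uniqueness -/

noncomputable section

/-! ### Solutions of the modulated system as trajectories -/

variable {κ : ℝ → ℝ} {ρ : ℝ}

lemma continuousOn_U {S : Set ℝ} {z : ℝ → L2} (hz : ContinuousOn z S) :
    ContinuousOn (fun t => U t (z t)) S := by
  have h : ContinuousOn (fun t => (t, z t)) S := continuousOn_id.prodMk hz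
  exact Continuous.comp_continuousOn (f := fun t => (t, z t)) continuous_U h

lemma mem_reg_of_small (hρ : IsAdm ρ) {α : ℝ} {W : L2} (h1 : ‖W‖ ≤ ρ) (h2 : |α - 1| ≤ ρ) :
    (α, W) ∈ reg ρ := by
  have h3 := abs_le.1 (h2.trans hρ.le_half)
  exact ⟨⟨by linarith, by linarith⟩, h1⟩

lemma continuousOn_field (hk : IsKappa κ) (hρ : IsAdm ρ) {S : Set ℝ} {f : ℝ → ℝ × L2}
    (hf : ContinuousOn f S) (hS : MapsTo f S (reg ρ)) :
    ContinuousOn (fun t => pF κ (f t).1 (f t).2 - κ (f t).1) S ∧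
      ContinuousOn (fun t => aF κ (f t).1 (f t).2) S ∧
      ContinuousOn (fun t => PhiX κ (f t).1 (f t).2) S :=
  ⟨((blip_pF hk hρ).sub hk.blip).continuousOn.comp hf hS, (blip_aF hk hρ).continuousOn.comp hf hS,
    (blip_PhiX hk hρ).continuousOn.comp hf hS⟩

lemma contDiffOn_one_of_hasDerivWithinAt {T : ℝ} (hT : 0 < T) {f f' : ℝ → ℝ}
    (h : ∀ t ∈ Icc (-T) T, HasDerivWithinAt f (f' t) (Icc (-T) T) t)
    (h' : ContinuousOn f' (Icc (-T) T)) : ContDiffOn ℝ 1 f (Icc (-T) T) := by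
  have hu : UniqueDiffOn ℝ (Icc (-T) T) := uniqueDiffOn_Icc (by linarith)
  rw [contDiffOn_one_iff_derivWithin hu]
  exact ⟨fun t ht => (h t ht).differentiableWithinAt,
    h'.congr fun t ht => (h t ht).derivWithin (hu t ht)⟩

/-- Smallness makes the truncation inactive. The orthogonality conditions hold initially and are
preserved, and the even and odd parts of the single equation are the two required ones. -/
lemma isModulatedSolution_of_isTraj (hk : IsKappa κ) (hρ : IsAdm ρ) {T : ℝ} (hT : 0 < T)
    {s : ℝ → L2 × ℝ × ℝ} (hs : IsTraj κ ρ T s)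
    (hsm : ∀ t ∈ Icc (-T) T, ‖(s t).1‖ ≤ ρ ∧ |(s t).2.1 - 1| ≤ ρ)
    (h0 : Orth (s 0).2.1 (s 0).1) :
    IsModulatedSolution κ T (fun t => J (evenP (U t (s t).1))) (fun t => J (oddP (U t (s t).1)))
        (fun t => (s t).2.2) (fun t => (s t).2.1) ∧
      ∀ t ∈ Icc (-T) T,
        derivWithin (fun t => (s t).2.2) (Icc (-T) T) t =
          pF κ (s t).2.1 (U t (s t).1) - κ (s t).2.1 ∧
        derivWithin (fun t => (s t).2.1) (Icc (-T) T) t = aF κ (s t).2.1 (U t (s t).1) := by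
  have hu : UniqueDiffOn ℝ (Icc (-T) T) := uniqueDiffOn_Icc (by linarith)
  have hcont : ContinuousOn s (Icc (-T) T) := fun t ht => (hs t ht).continuousWithinAt
  have hW : ContinuousOn (fun t => U t (s t).1) (Icc (-T) T) := continuousOn_U hcont.fst
  have hreg : MapsTo (fun t => ((s t).2.1, U t (s t).1)) (Icc (-T) T) (reg ρ) := fun t ht =>
    mem_reg_of_small hρ ((norm_U _ _).trans_le (hsm t ht).1) (hsm t ht).2
  have hg : ContinuousOn (fun t => ((s t).2.1, U t (s t).1)) (Icc (-T) T) := hcont.snd.fst.prodMk hW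
  have hF := continuousOn_field hk hρ hg hreg
  have hder : ∀ t ∈ Icc (-T) T, HasDerivWithinAt s (U (-t) (-Complex.I • PhiX κ (s t).2.1
      (U t (s t).1)), aF κ (s t).2.1 (U t (s t).1), pF κ (s t).2.1 (U t (s t).1) - κ (s t).2.1)
      (Icc (-T) T) t := fun t ht => by
    rw [← truncField_of_small hρ (hsm t ht).1 (hsm t ht).2]
    exact hs t ht
  have hz : ∀ t ∈ Icc (-T) T, HasDerivWithinAt (fun t => (s t).1)
      (U (-t) (-Complex.I • PhiX κ (s t).2.1 (U t (s t).1))) (Icc (-T) T) t :=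
    fun t ht => (hder t ht).fst
  have ha : ∀ t ∈ Icc (-T) T, HasDerivWithinAt (fun t => (s t).2.1)
      (aF κ (s t).2.1 (U t (s t).1)) (Icc (-T) T) t := fun t ht => (hder t ht).snd.fst
  have hθ : ∀ t ∈ Icc (-T) T, HasDerivWithinAt (fun t => (s t).2.2)
      (pF κ (s t).2.1 (U t (s t).1) - κ (s t).2.1) (Icc (-T) T) t := fun t ht => (hder t ht).snd.snd
  have hpos : ∀ t ∈ Icc (-T) T, 0 < (s t).2.1 := fun t ht => pos_of_mem_dilI (hreg ht).1
  have horth := orth_of_weakSol hW (weakSol_of_hasDerivWithinAt hz) hpos ha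
    (fun t ht => hρ.modDet_ne (hreg ht)) (by rwa [U_zero])
  have hdθ : ∀ t ∈ Icc (-T) T, derivWithin (fun t => (s t).2.2) (Icc (-T) T) t =
      pF κ (s t).2.1 (U t (s t).1) - κ (s t).2.1 := fun t ht => (hθ t ht).derivWithin (hu t ht)
  have hdα : ∀ t ∈ Icc (-T) T, derivWithin (fun t => (s t).2.1) (Icc (-T) T) t =
      aF κ (s t).2.1 (U t (s t).1) := fun t ht => (ha t ht).derivWithin (hu t ht)
  refine ⟨?_, fun t ht => ⟨hdθ t ht, hdα t ht⟩⟩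
  constructor
  · exact continuousInH1_J (evenP.continuous.comp_continuousOn hW)
  · exact continuousInH1_J (oddP.continuous.comp_continuousOn hW)
  · exact fun t _ => isEven_J_evenP _
  · exact fun t _ => isOdd_J_oddP _
  · exact contDiffOn_one_of_hasDerivWithinAt hT hθ
      hF.1
  · exact contDiffOn_one_of_hasDerivWithinAt hT ha hF.2.1
  · intro t ht
    refine (constraint_iff (hpos t ht) ?_).2 (horth t ht)
    conv_rhs => rw [← evenP_add_oddP (U t (s t).1), map_add]
    exact (Lp.coeFn_add _ _).symm
  · refine (solvesLinearized_iff (fun _ _ => rfl) fun t ht => ?_).2 (weakSol_evenP hz)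
    rw [hdθ t ht, hdα t ht]
    exact rhsE_ae _ _ _ (hpos t ht) _
  · refine (solvesLinearized_iff (fun _ _ => rfl) fun t ht => ?_).2 (weakSol_oddP hz)
    rw [hdθ t ht]
    exact rhsO_ae _ _ _ (hpos t ht) _

lemma SolvesLinearized.mono {σ T τ : ℝ} (hτ : τ ≤ T) {w : ℝ → L2} {R : ℝ → ℝ → ℂ}
    (h : SolvesLinearized σ T w R) : SolvesLinearized σ τ w R := fun φ t ht => by
  have hsub : Icc (-τ) τ ⊆ Icc (-T) T := Icc_subset_Icc (by linarith) hτ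
  obtain ⟨D, h1, h2⟩ := h φ t (hsub ht)
  exact ⟨D, h1.mono hsub, h2⟩

lemma IsModulatedSolution.weakSol {T τ : ℝ} {ve vo : ℝ → L2}
    {θ α : ℝ → ℝ} (h : IsModulatedSolution κ T ve vo θ α) (hτT : τ ≤ T) {W F : ℝ → L2}
    (he : ∀ t ∈ Icc (-T) T, ve t = J (evenP (W t)))
    (ho : ∀ t ∈ Icc (-T) T, vo t = J (oddP (W t))) (hpos : ∀ t ∈ Icc (-τ) τ, 0 < α t)
    (hF : ∀ t, F t = fieldX (κ (α t) + derivWithin θ (Icc (-T) T) t)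
      (derivWithin α (Icc (-T) T) t) (κ (α t)) (α t) (W t)) : WeakSol τ W F := by
  have hsub : Icc (-τ) τ ⊆ Icc (-T) T := Icc_subset_Icc (by linarith) hτT
  have hwe : WeakSol τ (fun t => evenP (W t)) (fun t => evenP (F t)) := by
    refine (solvesLinearized_iff (fun t ht => he t (hsub ht)) fun t ht => ?_).1 (h.eq_e.mono hτT)
    have := rhsE_ae (κ (α t) + derivWithin θ (Icc (-T) T) t)
      (derivWithin α (Icc (-T) T) t) (κ (α t)) (hpos t ht) (W t)
    rw [add_sub_cancel_left, ← hF] at this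
    rw [he t (hsub ht), ho t (hsub ht)]
    exact this
  have hwo : WeakSol τ (fun t => oddP (W t)) (fun t => oddP (F t)) := by
    refine (solvesLinearized_iff (fun t ht => ho t (hsub ht)) fun t ht => ?_).1 (h.eq_o.mono hτT)
    have := rhsO_ae (κ (α t) + derivWithin θ (Icc (-T) T) t)
      (derivWithin α (Icc (-T) T) t) (κ (α t)) (hpos t ht) (W t)
    rw [add_sub_cancel_left, ← hF] at this
    rw [he t (hsub ht), ho t (hsub ht)]
    exact this
  have := hwe.add hwo
  simpa only [evenP_add_oddP] using this

lemma IsModulatedSolution.orth {T : ℝ} {ve vo : ℝ → L2} {θ α : ℝ → ℝ}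
    (h : IsModulatedSolution κ T ve vo θ α) {W : L2} {t : ℝ} (ht : t ∈ Icc (-T) T)
    (he : ve t = J (evenP W)) (ho : vo t = J (oddP W)) (hpos : 0 < α t) : Orth (α t) W := by
  refine (constraint_iff hpos ?_).1 (h.constraint t ht)
  rw [he, ho]
  conv_rhs => rw [← evenP_add_oddP W, map_add]
  exact (Lp.coeFn_add _ _).symm

/-- The orthogonality conditions identify θ̇ and α̇ pointwise. Then F is `PhiX` along the curve,
hence continuous, and the weak equation can be upgraded to the interaction picture. -/
lemma isTraj_of_weakSol (hk : IsKappa κ) (hρ : IsAdm ρ) {τ : ℝ} (hτ : 0 < τ) {W F : ℝ → L2}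
    {θ α dθ dα : ℝ → ℝ} (hW : ContinuousOn W (Icc (-τ) τ)) (hw : WeakSol τ W F)
    (hF : ∀ t, F t = fieldX (κ (α t) + dθ t) (dα t) (κ (α t)) (α t) (W t))
    (hα : ∀ t ∈ Icc (-τ) τ, HasDerivWithinAt α (dα t) (Icc (-τ) τ) t)
    (hθ : ∀ t ∈ Icc (-τ) τ, HasDerivWithinAt θ (dθ t) (Icc (-τ) τ) t)
    (hsm : ∀ t ∈ Icc (-τ) τ, ‖W t‖ ≤ ρ ∧ |α t - 1| ≤ ρ)
    (horth : ∀ t ∈ Icc (-τ) τ, Orth (α t) (W t)) :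
    IsTraj κ ρ τ (fun t => (U (-t) (W t), α t, θ t)) := by
  have hreg : MapsTo (fun t => (α t, W t)) (Icc (-τ) τ) (reg ρ) := fun t ht =>
    mem_reg_of_small hρ (hsm t ht).1 (hsm t ht).2
  have heq : ∀ t ∈ Icc (-τ) τ, κ (α t) + dθ t = pF κ (α t) (W t) ∧ dα t = aF κ (α t) (W t) :=
    fun t ht => eq_of_orth hτ hW hw ht (hF t) (pos_of_mem_dilI (hreg ht).1) (hα t ht)
      (hρ.modDet_ne (hreg ht)) horth
  have hFΦ : EqOn F (fun t => PhiX κ (α t) (W t)) (Icc (-τ) τ) := fun t ht => by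
    simp only [PhiX]
    rw [hF t, (heq t ht).1, (heq t ht).2]
  have hg : ContinuousOn (fun t => (α t, W t)) (Icc (-τ) τ) :=
    ContinuousOn.prodMk (fun t ht => (hα t ht).continuousWithinAt) hW
  have hFc : ContinuousOn F (Icc (-τ) τ) := (continuousOn_field hk hρ hg hreg).2.2.congr hFΦ
  intro t ht
  have e : truncField κ ρ t (U (-t) (W t), α t, θ t) = (U (-t) (-Complex.I • PhiX κ (α t) (W t)),
      aF κ (α t) (W t), pF κ (α t) (W t) - κ (α t)) := by
    have h1 := truncField_of_small (κ := κ) hρ (t := t) (s := (U (-t) (W t), α t, θ t))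
      ((norm_U _ _).trans_le (hsm t ht).1) (hsm t ht).2
    simpa only [U_U_neg] using h1
  have h1 := hasDerivWithinAt_of_weakSol hτ hW hFc hw t ht
  rw [hFΦ ht] at h1
  have h2 : HasDerivWithinAt α (aF κ (α t) (W t)) (Icc (-τ) τ) t := (heq t ht).2 ▸ hα t ht
  have h3 : HasDerivWithinAt θ (pF κ (α t) (W t) - κ (α t)) (Icc (-τ) τ) t := by
    rw [← (heq t ht).1, add_sub_cancel_left]
    exact hθ t ht
  exact (h1.prodMk (h2.prodMk h3)).congr_deriv e.symm

lemma IsModulatedSolution.isTraj (hk : IsKappa κ) (hρ : IsAdm ρ) {T τ : ℝ} {ve vo : ℝ → L2}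
    {θ α : ℝ → ℝ} (h : IsModulatedSolution κ T ve vo θ α) (hτ : 0 < τ) (hτT : τ ≤ T) {W : ℝ → L2}
    (hW : ContinuousOn W (Icc (-T) T)) (he : ∀ t ∈ Icc (-T) T, ve t = J (evenP (W t)))
    (ho : ∀ t ∈ Icc (-T) T, vo t = J (oddP (W t)))
    (hsm : ∀ t ∈ Icc (-τ) τ, ‖W t‖ ≤ ρ ∧ |α t - 1| ≤ ρ) :
    IsTraj κ ρ τ (fun t => (U (-t) (W t), α t, θ t)) := by
  have hsub : Icc (-τ) τ ⊆ Icc (-T) T := Icc_subset_Icc (by linarith) hτT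
  have hpos : ∀ t ∈ Icc (-τ) τ, 0 < α t := fun t ht =>
    pos_of_mem_dilI (mem_reg_of_small hρ (hsm t ht).1 (hsm t ht).2).1
  exact isTraj_of_weakSol hk hρ hτ (hW.mono hsub) (h.weakSol hτT he ho hpos fun _ => rfl)
    (fun _ => rfl)
    (fun t ht => ((h.contDiff_α.differentiableOn one_ne_zero t (hsub ht)).hasDerivWithinAt).mono hsub)
    (fun t ht => ((h.contDiff_θ.differentiableOn one_ne_zero t (hsub ht)).hasDerivWithinAt).mono hsub)
    hsm fun t ht => h.orth (hsub ht) (he t (hsub ht)) (ho t (hsub ht)) (hpos t ht)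

/-- No smallness of the competing solution is assumed. While it is at most r it is a trajectory of
the truncated system, so it equals s, which is strictly below r; continuity extends this to all of
[-T, T]. -/
lemma IsModulatedSolution.eq_of_isTraj (hk : IsKappa κ) (hρ : IsAdm ρ) {T r : ℝ} (hT : 0 < T)
    {ve vo : ℝ → L2} {θ α : ℝ → ℝ} (h : IsModulatedSolution κ T ve vo θ α) {s : ℝ → L2 × ℝ × ℝ}
    (hs : IsTraj κ ρ T s) (hr : r ≤ ρ)
    (hsm : ∀ t ∈ Icc (-T) T, ‖(s t).1‖ < r ∧ |(s t).2.1 - 1| < r)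
    (he : ve 0 = J (evenP (s 0).1)) (ho : vo 0 = J (oddP (s 0).1)) (hα : α 0 = (s 0).2.1)
    (hθ : θ 0 = (s 0).2.2) : ∀ t ∈ Icc (-T) T,
      ve t = J (evenP (U t (s t).1)) ∧ vo t = J (oddP (U t (s t).1)) ∧ θ t = (s t).2.2 ∧
        α t = (s t).2.1 := by
  obtain ⟨We, hWe, hWec⟩ := exists_continuousOn_of_continuousInH1 h.continuous_e
  obtain ⟨Wo, hWo, hWoc⟩ := exists_continuousOn_of_continuousInH1 h.continuous_o
  have h0T : (0 : ℝ) ∈ Icc (-T) T := ⟨by linarith, hT.le⟩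
  have hev : ∀ t ∈ Icc (-T) T, IsEven (J (We t)) := fun t ht => by rw [hWe t ht]; exact h.even t ht
  have hod : ∀ t ∈ Icc (-T) T, IsOdd (J (Wo t)) := fun t ht => by rw [hWo t ht]; exact h.odd t ht
  set W := fun t => We t + Wo t with hW
  have hWc : ContinuousOn W (Icc (-T) T) := hWec.add hWoc
  have he' : ∀ t ∈ Icc (-T) T, ve t = J (evenP (W t)) := fun t ht => by
    rw [hW, evenP_add_eq (hev t ht) (hod t ht), hWe t ht]
  have ho' : ∀ t ∈ Icc (-T) T, vo t = J (oddP (W t)) := fun t ht => by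
    rw [hW, oddP_add_eq (hev t ht) (hod t ht), hWo t ht]
  have hW0 : W 0 = (s 0).1 := by
    rw [← evenP_add_oddP (W 0), ← evenP_add_oddP (s 0).1,
      J_injective ((he' 0 h0T).symm.trans he), J_injective ((ho' 0 h0T).symm.trans ho)]
  have hs0 : (fun t => (U (-t) (W t), α t, θ t)) 0 = s 0 := by
    simp only [neg_zero, U_zero, hW0, hα, hθ]
  have heqs : ∀ τ, 0 < τ → τ ≤ T → (∀ t ∈ Icc (-τ) τ, max ‖W t‖ |α t - 1| ≤ r) →
      ∀ t ∈ Icc (-τ) τ, (U (-t) (W t), α t, θ t) = s t := fun τ hτ hτT hle => by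
    have h1 := h.isTraj hk hρ hτ hτT hWc he' ho' fun t ht =>
      ⟨(le_max_left _ _).trans ((hle t ht).trans hr), (le_max_right _ _).trans ((hle t ht).trans hr)⟩
    exact isTraj_unique hk hρ hτ h1 (hs.mono hτT) hs0
  have hlt : ∀ t ∈ Icc (-T) T, max ‖W t‖ |α t - 1| < r := by
    refine lt_of_bootstrap ?_ ?_ ?_
    · exact hWc.norm.sup ((h.contDiff_α.continuousOn.sub continuousOn_const).abs)
    · rw [hW0, hα]
      exact max_lt (hsm 0 h0T).1 (hsm 0 h0T).2
    · intro τ hτ hτT hle t ht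
      have e := heqs τ hτ hτT hle t ht
      have h1 := hsm t ⟨by linarith [ht.1], ht.2.trans hτT⟩
      rw [← e, norm_U] at h1
      exact max_lt h1.1 h1.2
  intro t ht
  have e := heqs T hT le_rfl (fun t ht => (hlt t ht).le) t ht
  rw [he' t ht, ho' t ht, ← e]
  simp only [U_U_neg, and_self]

end
end NNLS

theorem mainTheorem2 (κ : ℝ → ℝ)
    (hκ : (∀ a : ℝ, κ a = 1) ∨ (∀ a : ℝ, κ a = a ^ 2))
    (K : ℝ) (hK : 0 < K) :
    ∃ c C ε₀ : ℝ, 0 < c ∧ 0 < C ∧ 0 < ε₀ ∧ ε₀ < 1 ∧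
      ∀ ε : ℝ, 0 < ε → ε ≤ ε₀ →
      ∀ (ve₀ vo₀ ηe₀ ηo₀ : NNLS.L2) (ae₀ be₀ ao₀ bo₀ θ₀ α₀ : ℝ),
        NNLS.IsEven ve₀ → NNLS.IsOdd vo₀ →
        NNLS.IsRootDecomposition ve₀ vo₀ ae₀ be₀ ao₀ bo₀ ηe₀ ηo₀ →
        NNLS.Constraint α₀ ve₀ vo₀ →
        |α₀ - 1| ≤ K * ε →
        |ae₀| + |be₀| + |ao₀| ≤ K * ε →
        |bo₀| + NNLS.normH1 ηe₀ + NNLS.normH1 ηo₀ ≤ K * ε ^ 2 →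
      ∀ T : ℝ, 0 < T → T ≤ c * Real.log (1 / ε) →
      ∃ (ve vo ηe ηo : ℝ → NNLS.L2) (ae be ao bo θ α : ℝ → ℝ),
        -- a solution with the given initial data
        NNLS.IsModulatedSolution κ T ve vo θ α ∧
        (ve 0 = ve₀ ∧ vo 0 = vo₀ ∧ θ 0 = θ₀ ∧ α 0 = α₀) ∧
        -- its uniqueness
        (∀ (ve' vo' : ℝ → NNLS.L2) (θ' α' : ℝ → ℝ),
          NNLS.IsModulatedSolution κ T ve' vo' θ' α' →
          (ve' 0 = ve₀ ∧ vo' 0 = vo₀ ∧ θ' 0 = θ₀ ∧ α' 0 = α₀) →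
          ∀ t ∈ Set.Icc (-T) T, ve' t = ve t ∧ vo' t = vo t ∧ θ' t = θ t ∧ α' t = α t) ∧
        -- the a priori bounds
        (∀ t ∈ Set.Icc (-T) T,
          NNLS.IsRootDecomposition (ve t) (vo t) (ae t) (be t) (ao t) (bo t) (ηe t) (ηo t) ∧
          |ae t| + |be t| + |ao t| + |bo t| + NNLS.normH1 (ηe t) + NNLS.normH1 (ηo t)
              + |α t - 1| ≤ C * ε ∧
          |κ (α t) + derivWithin θ (Set.Icc (-T) T) t|
              + |derivWithin α (Set.Icc (-T) T) t| ≤ C * ε ^ 2) := by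
  have hk := NNLS.isKappa_of hκ
  obtain ⟨ρ, hρ⟩ := NNLS.exists_isAdm
  obtain ⟨K', hKK', hinit⟩ := NNLS.exists_initial hK
  obtain ⟨D, hD, hdec⟩ := NNLS.exists_isRootDecomposition
  -- The a priori bound is applied with K' ≥ K, because K' controls the distance of the initial data
  -- to the stationary mode.
  obtain ⟨c, M, C, ε₁, hc, hM, hC, hε₁, hε₁', hMρ, hap⟩ :=
    NNLS.exists_apriori hk hρ (hK.trans_le hKK')
  choose ae be ao bo ηe ηo hdec hdecle using hdec
  -- D·M bounds the root-space components, M bounds α - 1, and C the modulation rates. The cut-off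
  -- 1/(2K) puts α₀ in `dilI`.
  refine ⟨c, D * M + M + C, min ε₁ (1 / (2 * K)), hc, by positivity,
    lt_min hε₁ (by positivity), (min_le_left _ _).trans_lt hε₁', ?_⟩
  intro ε hε hεle ve₀ vo₀ ηe₀ ηo₀ ae₀ be₀ ao₀ bo₀ θ₀ α₀ heven hodd hroot hcon h1 h2 h3 T hT hTc
  have hε1 : ε ≤ ε₁ := hεle.trans (min_le_left _ _)
  have hKε : K * ε ≤ 1 / 2 := by
    have := hεle.trans (min_le_right _ _)
    rw [le_div_iff₀ (by positivity)] at this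
    linarith
  have hMε : M * ε ≤ ρ := le_trans (by gcongr) hMρ
  obtain ⟨We, Wo, rfl, rfl, horth, hW⟩ := hinit ε hε (by linarith) hKε ve₀ vo₀ ηe₀ ηo₀ ae₀ be₀ ao₀
    bo₀ α₀ hroot hcon h1 h2 h3
  obtain ⟨s, hs0, hs⟩ := NNLS.exists_isTraj hk hρ hT (We + Wo, α₀, θ₀)
  have hKK'ε : K * ε ≤ K' * ε := by gcongr
  have hbd := hap ε hε hε1 T ao₀ s hTc hT hs
    (by linarith [abs_nonneg ae₀, abs_nonneg be₀]) (by rw [hs0]; exact hW)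
    (by rw [hs0]; exact h1.trans hKK'ε)
  obtain ⟨hsol, hder⟩ := NNLS.isModulatedSolution_of_isTraj hk hρ hT hs
    (fun t ht => ⟨(hbd t ht).1.le.trans hMε, (hbd t ht).2.1.le.trans hMε⟩) (by rw [hs0]; exact horth)
  have he0 : NNLS.evenP (s 0).1 = We := by rw [hs0]; exact NNLS.evenP_add_eq heven hodd
  have ho0 : NNLS.oddP (s 0).1 = Wo := by rw [hs0]; exact NNLS.oddP_add_eq heven hodd
  refine ⟨_, _, fun t => NNLS.J (ηe (NNLS.U t (s t).1)), fun t => NNLS.J (ηo (NNLS.U t (s t).1)),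
    fun t => ae (NNLS.U t (s t).1), fun t => be (NNLS.U t (s t).1), fun t => ao (NNLS.U t (s t).1),
    fun t => bo (NNLS.U t (s t).1), _, _, hsol, ?_, ?_, ?_⟩
  · refine ⟨?_, ?_, ?_, ?_⟩
    · rw [NNLS.U_zero, he0]
    · rw [NNLS.U_zero, ho0]
    · rw [hs0]
    · rw [hs0]
  · rintro ve' vo' θ' α' hsol' ⟨i1, i2, i3, i4⟩
    refine hsol'.eq_of_isTraj hk hρ hT hs hMε (fun t ht => ⟨(hbd t ht).1, (hbd t ht).2.1⟩) ?_ ?_ ?_ ?_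
    · rw [i1, he0]
    · rw [i2, ho0]
    · rw [i4, hs0]
    · rw [i3, hs0]
  · intro t ht
    obtain ⟨b1, b2, b3⟩ := hbd t ht
    refine ⟨hdec _, ?_, ?_⟩
    · have e1 := hdecle (NNLS.U t (s t).1)
      rw [NNLS.norm_U] at e1
      have e2 : D * ‖(s t).1‖ ≤ D * (M * ε) := by gcongr
      simp only [NNLS.normH1_J]
      have e3 : 0 < C * ε := by positivity
      linarith
    · rw [(hder t ht).1, (hder t ht).2, add_sub_cancel]
      refine b3.trans ?_
      gcongr
      have : 0 ≤ D * M := by positivity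
      linarith
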